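/- **Setting.** A *network* $(V,G,L)$ is a finite connected undirected simple graph $(V,G)$ with degrees at most a fixed $D$, together with a labeling $L:V\to C$ into a fixed finite set $C$ of identifiers; the nodes may also carry finitely many unary properties $P_1,\dots,P_p$. Let $\mathcal N^k(a)=\{b\in V: \mathrm{dist}(a,b)\le k\}$. The network is *$k$-locally consistent* if for every $a\in V$ any two distinct nodes of $\mathcal N^k(a)$ have distinct labels. **Formulas.** Let $T$ be a relation symbol of arity $\ell+1$ and let $\varphi(T)(x,y_1,\dots,y_\ell)$ be a first-order formula over $G$, $=$, $T$ and $P_1,\dots,P_p$. The formula $\varphi^{(k)}(T)(x,\vec y)$ is obtained by restricting every quantifier to $\mathcal N^k(x)$ and adding the conditions $y_i\in\mathcal N^k(x)$ for $i=1,\dots,\ell$. The $FP_{loc}$ formula $\mu(\varphi^{(k)}(T)(x,\vec y))$ denotes the inflationary fixpoint $I=\bigcup_i I_i$, where $I_0=\emptyset$ and $I_{i+1}=\varphi^{(k)}(I_i)\cup I_i$. **Distributed evaluation.** All nodes run the same algorithm, a multi-stack Turing machine with finite control, in synchronous rounds. A node initially knows only its own label and properties, the labels of its neighbors, and whether it is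 the requesting node; the requesting node starts, and every other node is idle until a message reaches it. In each round every active node performs an in-node computation and then broadcasts the messages (bit strings) in its out-buffer to all its neighbors; they arrive, in arbitrary order, before the next round. The evaluation has terminated when no node sends messages any more. The result is distributed: node $a$ holds the tuples $(a,\vec b)\in I$, with the nodes $b_i\in\mathcal N^k(a)$ named by their labels. **Theorem.** For all $k$, $D$, $C$ and every $FP_{loc}$ formula $\mu(\varphi^{(k)}(T)(x,\vec y))$ there are an algorithm and a constant $c$, depending only on these, such that on every $k$-locally consistent network with $n$ nodes and degrees at most $D$, for every requesting node and every order of arrival of messages: 1. (in-node time) the in-node computation of any node in any round takes at most $c$ steps, i.e. $O(1)$; 2. (distributed time) the evaluation terminates after at most $c\,n$ rounds, i.e. $O(n)$, and from then on each node $a$ holds exactly the set $\{(L(b_1),\dots,L(b_\ell)) : (a,b_1,\dots,b_\ell)\in I\}$; 3. (message size) every message has at most $c$ bits, i.e. $O(1)$; 4. (messages per node) every node sends at most $c$ messages in total, i.e. $O(1)$. -/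

import Mathlib

namespace NetLogic

/-! ### First-order logic over graphs with a fixpoint relation -/

/-- First-order formulas with free variables among `Fin m`, over the edge relation `G`, equality,
`p` unary relation symbols for node properties, and a relation symbol `T` of arity `a`. A quantifier
over `Formula p a (m + 1)` binds the variable `Fin.last m`. -/
inductive Formula (p a : ℕ) : ℕ → Type
  | eq {m : ℕ} (i j : Fin m) : Formula p a m
  | edge {m : ℕ} (i j : Fin m) : Formula p a m
  | prop {m : ℕ} (P : Fin p) (i : Fin m) : Formula p a m
  | fixRel {m : ℕ} (x : Fin a → Fin m) : Formula p a m
  | not {m : ℕ} (φ : Formula p a m) : Formula p a m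
  | and {m : ℕ} (φ ψ : Formula p a m) : Formula p a m
  | or {m : ℕ} (φ ψ : Formula p a m) : Formula p a m
  | ex {m : ℕ} (φ : Formula p a (m + 1)) : Formula p a m
  | all {m : ℕ} (φ : Formula p a (m + 1)) : Formula p a m

namespace Formula

/-- Satisfaction in the graph `G` with node properties `P`, `T` interpreted by `I`, and the free
variables by `e`. -/
def Holds {p a : ℕ} {V : Type*} (G : SimpleGraph V) (P : Fin p → V → Prop)
    (I : Set (Fin a → V)) : {m : ℕ} → Formula p a m → (Fin m → V) → Prop
  | _, eq i j, e => e i = e j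
  | _, edge i j, e => G.Adj (e i) (e j)
  | _, prop Q i, e => P Q (e i)
  | _, fixRel x, e => (fun s => e (x s)) ∈ I
  | _, not φ, e => ¬ Holds G P I φ e
  | _, and φ ψ, e => Holds G P I φ e ∧ Holds G P I ψ e
  | _, or φ ψ, e => Holds G P I φ e ∨ Holds G P I ψ e
  | _, ex φ, e => ∃ b : V, Holds G P I φ (Fin.snoc e b)
  | _, all φ, e => ∀ b : V, Holds G P I φ (Fin.snoc e b)

/-- The first-order formula `dist(i, j) ≤ k`. -/
def distLE {p a : ℕ} : ℕ → {m : ℕ} → Fin m → Fin m → Formula p a m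
  | 0, _, i, j => eq i j
  | k + 1, m, i, j =>
      or (distLE k i j) (ex (and (edge i.castSucc (Fin.last m)) (distLE k (Fin.last m) j.castSucc)))

/-- Every quantifier is restricted to the `k`-neighborhood of the variable `x`. -/
def relativize {p a : ℕ} (k : ℕ) : {m : ℕ} → Fin m → Formula p a m → Formula p a m
  | _, _, eq i j => eq i j
  | _, _, edge i j => edge i j
  | _, _, prop Q i => prop Q i
  | _, _, fixRel y => fixRel y
  | _, x, not φ => not (relativize k x φ)
  | _, x, and φ ψ => and (relativize k x φ) (relativize k x ψ)
  | _, x, or φ ψ => or (relativize k x φ) (relativize k x ψ)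
  | m, x, ex φ => ex (and (distLE k x.castSucc (Fin.last m)) (relativize k x.castSucc φ))
  | m, x, all φ => all (or (not (distLE k x.castSucc (Fin.last m))) (relativize k x.castSucc φ))

/-- The local formula `φ^(k)(x, y₁, …, y_ℓ)`, where `x` is the variable `0`: all quantifiers and
all the free variables `yᵢ` are restricted to the `k`-neighborhood of `x`. -/
def localize {p a ℓ : ℕ} (k : ℕ) (φ : Formula p a (ℓ + 1)) : Formula p a (ℓ + 1) :=
  (List.finRange ℓ).foldr (fun j ψ => and (distLE k 0 j.succ) ψ) (relativize k 0 φ)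

/-- The stages of the inflationary fixpoint of `φ(T)`. -/
def stage {p a : ℕ} {V : Type*} (G : SimpleGraph V) (P : Fin p → V → Prop) (φ : Formula p a a) :
    ℕ → Set (Fin a → V)
  | 0 => ∅
  | i + 1 => {e | φ.Holds G P (stage G P φ i) e} ∪ stage G P φ i

/-- The inflationary fixpoint `μ(φ(T))`. -/
def fixpoint {p a : ℕ} {V : Type*} (G : SimpleGraph V) (P : Fin p → V → Prop) (φ : Formula p a a) :
    Set (Fin a → V) :=
  ⋃ i, stage G P φ i

end Formula

/-! ### Networks -/

/-- A network: a graph with a labeling of the nodes by identifiers in `C` and `p` unary node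
properties. -/
structure Network (V : Type*) (C : Type) (p : ℕ) where
  graph : SimpleGraph V
  label : V → C
  prop : Fin p → V → Prop

/-- The `k`-neighborhood of `a`. -/
def Network.nbhd {V : Type*} {C : Type} {p : ℕ} (N : Network V C p) (k : ℕ) (a : V) : Set V :=
  {b | N.graph.edist a b ≤ k}

/-- Any two distinct nodes of any `k`-neighborhood have distinct labels. -/
def Network.LocallyConsistent {V : Type*} {C : Type} {p : ℕ} (N : Network V C p) (k : ℕ) : Prop :=
  ∀ a : V, ∀ b₁ ∈ N.nbhd k a, ∀ b₂ ∈ N.nbhd k a, b₁ ≠ b₂ → N.label b₁ ≠ N.label b₂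

/-- The pieces of information a node has about itself before the evaluation starts. -/
inductive Datum (C : Type) (p : ℕ) : Type
  | self (c : C)
  | neighbor (c : C)
  | prop (P : Fin p)
  | requesting

open scoped Classical in
/-- The local data of the node `v` when `r` is the requesting node: its label, the labels of its
neighbors, the properties it has, and whether it is the requesting node. -/
noncomputable def Network.localData {V : Type*} [Fintype V] {C : Type} {p : ℕ}
    (N : Network V C p) (r v : V) : Multiset (Datum C p) :=
  {Datum.self (N.label v)}
    + (N.graph.neighborFinset v).val.map (fun u => Datum.neighbor (N.label u))
    + (Finset.univ.filter (fun P => N.prop P v)).val.map Datum.prop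
    + (if v = r then {Datum.requesting} else 0)

/-! ### The algorithm run by the nodes -/

/-- A message is a string of bits. -/
abbrev Message := List Bool

/-- The contents of a buffer holding the given messages, each closed by the separator `none`. -/
def pack (ms : List Message) : List (Option Bool) :=
  ms.flatMap (fun m => m.map some ++ [none])

/-- The messages held in a buffer. A last message without separator counts as a message. -/
def unpack : List (Option Bool) → List Message
  | [] => []
  | none :: s => [] :: unpack s
  | some b :: s =>
    match unpack s with
    | [] => [[b]]
    | m :: ms => (b :: m) :: ms

/-- The stacks of a node: its local data, its in-buffer, its out-buffer, its table of result tuples,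
and the work stacks. -/
inductive StackName (W : Type) : Type
  | data
  | inbox
  | outbox
  | result
  | work (w : W)
  deriving DecidableEq

/-- The stack alphabets. A symbol of the result table is a tuple of `ℓ` labels. -/
def StackName.Alphabet (C : Type) (p ℓ : ℕ) {W : Type} (A : Type) : StackName W → Type
  | data => Datum C p
  | inbox => Option Bool
  | outbox => Option Bool
  | result => Fin ℓ → C
  | work _ => A

/-- A node algorithm: a multi-stack machine (in the sense of `Turing.TM2`) with finitely many
stacks, a finite work alphabet and a finite control. -/
structure Engine (C : Type) (p ℓ : ℕ) where
  W : Type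
  A : Type
  Λ : Type
  σ : Type
  [decW : DecidableEq W]
  [finW : Finite W]
  [finA : Finite A]
  [finΛ : Finite Λ]
  [finσ : Finite σ]
  main : Λ
  start : σ
  prog : Λ → Turing.TM2.Stmt (StackName.Alphabet C p ℓ A : StackName W → Type) Λ σ

namespace Engine

variable {C : Type} {p ℓ : ℕ} (M : Engine C p ℓ)

instance : DecidableEq M.W := M.decW

/-- The alphabets of the stacks of `M`. -/
abbrev Γ : StackName M.W → Type := StackName.Alphabet C p ℓ M.A

/-- The configuration of a node between two rounds. A node is idle (`awake = false`) until the
query or some message reaches it. -/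
structure NodeState where
  awake : Bool
  var : M.σ
  stk : ∀ s, List (M.Γ s)

/-- The machine configuration in which the computation of a round begins. -/
def begin (s : M.NodeState) : Turing.TM2.Cfg M.Γ M.Λ M.σ := ⟨some M.main, s.var, s.stk⟩

/-- One elementary step; a halted machine stays as it is. -/
def next (x : Turing.TM2.Cfg M.Γ M.Λ M.σ) : Turing.TM2.Cfg M.Γ M.Λ M.σ :=
  (Turing.TM2.step M.prog x).getD x

/-- Starting from node state `s`, the in-node computation of the round takes at most `c` steps. -/
def HaltsWithin (s : M.NodeState) (c : ℕ) : Prop := (M.next^[c] (M.begin s)).l = none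

open scoped Classical in
/-- The node state after the in-node computation of a round. Idle nodes do not compute. (A
computation that never halts is given the value `s`.) -/
noncomputable def compute (s : M.NodeState) : M.NodeState :=
  if h : s.awake = true ∧ ∃ c, M.HaltsWithin s c then
    let x := M.next^[Nat.find h.2] (M.begin s)
    ⟨true, x.var, x.stk⟩
  else s

/-- The messages that a node in state `s` broadcasts to its neighbors at the end of the round. -/
noncomputable def sent (s : M.NodeState) : List Message :=
  unpack ((M.compute s).stk StackName.outbox)

/-- The tuples of labels held in the result table of a node in state `s`. -/
def held (s : M.NodeState) : Set (Fin ℓ → C) :=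
  {y | y ∈ (show List (Fin ℓ → C) from s.stk StackName.result)}

/-- The node state after the delivery events of a round: the out-buffer has been emptied, and the
arriving messages have been appended to the in-buffer. -/
def deliver (s : M.NodeState) (arriving : List Message) : M.NodeState where
  awake := s.awake || !arriving.isEmpty
  var := s.var
  stk := Function.update (Function.update s.stk StackName.outbox [])
    StackName.inbox ((show List (Option Bool) from s.stk StackName.inbox) ++ pack arriving)

open scoped Classical in
/-- `E t v` is the state of the node `v` at the beginning of round `t` in a synchronous execution of
`M` on the network `N` upon a request from `r`. In every round, all messages sent by the neighbors
arrive, in any order. -/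
structure IsExecution {V : Type*} [Fintype V] (N : Network V C p) (r : V)
    (E : ℕ → V → M.NodeState) : Prop where
  init_awake : ∀ v, ((E 0 v).awake = true ↔ v = r)
  init_var : ∀ v, (E 0 v).var = M.start
  init_data : ∀ v, ((show List (Datum C p) from (E 0 v).stk StackName.data) : Multiset (Datum C p))
    = N.localData r v
  init_stk : ∀ v, ∀ s, s ≠ StackName.data → (E 0 v).stk s = []
  round : ∀ t v, ∃ arriving : List Message,
    (arriving : Multiset Message)
      = ∑ u ∈ N.graph.neighborFinset v, (M.sent (E t u) : Multiset Message) ∧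
    E (t + 1) v = M.deliver (M.compute (E t v)) arriving

/-- Executions exist, so that statements about all executions are never void. -/
theorem exists_isExecution {V : Type*} [Fintype V] (N : Network V C p) (r : V) :
    ∃ E : ℕ → V → M.NodeState, M.IsExecution N r E := by
  classical
  let dat : V → List (Datum C p) := fun v => (N.localData r v).toList
  let E₀ : V → M.NodeState := fun v =>
    ⟨decide (v = r), M.start, fun s => match s with
      | .data => dat v
      | .inbox => []
      | .outbox => []
      | .result => []
      | .work _ => []⟩
  let E : ℕ → V → M.NodeState := fun t => Nat.rec E₀ (fun _ S v => M.deliver (M.compute (S v))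
    (∑ u ∈ N.graph.neighborFinset v, (M.sent (S u) : Multiset Message)).toList) t
  refine ⟨E, fun v => by simp [E, E₀], fun v => rfl, fun v => Multiset.coe_toList _, ?_, ?_⟩
  · intro v s hs
    cases s <;> first | rfl | exact absurd rfl hs
  · intro t v
    exact ⟨_, Multiset.coe_toList _, rfl⟩

end Engine

end NetLogic

/-! Labels are consistent only inside `k`-balls, so a node cannot combine what others report about
tuples without names that stay unambiguous farther away. The first half of the algorithm creates
such names: for `k ≠ 0`, colors that differ on distinct nodes at distance at most `3 * k + 1`. Balls
of this radius have at most `n = (D + 1) ^ (3 * k + 1)` nodes, so `n + 1` colors suffice for a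
greedy choice, provided that the nodes choose one after the other. A token serializes the choices by
Tarry's rules: no dart is used twice, and the dart back to the node from which a vertex was first
reached is used last. Counting arrivals and departures shows that the token gets stuck only at the
root, after having been everywhere (`Traversal.stuck`). The same count tells a node locally whether
it has the token (`holds_iff`); labels suffice for this, since a closed neighborhood has distinct
labels. The holder waits `3 * k + 1` rounds before it acts, so that all colors in its ball have
reached it (`TokenAt.proper_succ`). There are at most `D * |V|` moves, hence linearly many rounds.
For `k = 0` a formula sees a single node and one color is enough.

In the second half a start signal spreads from the root, and every node evaluates one stage per `2 *
k + 3` rounds of a clock started by the signal. The formula need not be monotone in `T`, so a node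
must see exactly the current stage in its neighborhood. It does, because facts travel as fast as the
signal did (`Started.tab_mem_iff`). A tuple of the fixpoint is determined by its first node and the
colors of its entries, so there are only `O(|V|)` tuples and the stages stabilize after `O(|V|)`
steps (`Started.ncard_stage_le`, `Formula.exists_stage_eq`).

The remaining bounds come from writing the algorithm as a gossip protocol. Knowledge is a growing
family of subsets of a finite set and is broadcast only when it changes, so a node broadcasts a
bounded number of times (`Gossip.sum_emit_le`), yet nothing is lost (`Gossip.know_adj`). The end of
the computation need not be detected: when no new facts arise, all nodes fall silent. Since
everything stored or sent is of bounded size, a node is a finite automaton, and a round of it is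
compiled to one straight-line stack program (`Automaton.engine_correct`). -/

open Turing Function

namespace NetLogic

/-! ### Straight-line stack programs -/

section Programs

variable {K : Type} [DecidableEq K] {Γ : K → Type} {Λ σ : Type}

/-- Pop `n` symbols from the stack `k`, processing each of them by `f`. -/
def popMany (k : K) (f : σ → Option (Γ k) → σ) : ℕ → TM2.Stmt Γ Λ σ → TM2.Stmt Γ Λ σ
  | 0, q => q
  | n + 1, q => .pop k f (popMany k f n q)

/-- Surplus pops find an empty stack and leave the memory alone by `hf`. A constant bound on the
height therefore lets code without loops empty the stack. -/
theorem stepAux_popMany (k : K) (f : σ → Option (Γ k) → σ) (hf : ∀ v, f v none = v) (n : ℕ)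
    (q : TM2.Stmt Γ Λ σ) (v : σ) (S : ∀ k, List (Γ k)) (hn : (S k).length ≤ n) :
    TM2.stepAux (popMany k f n q) v S =
      TM2.stepAux q ((S k).foldl (fun v x => f v (some x)) v) (update S k []) := by
  induction n generalizing v S with
  | zero =>
    have h : S k = [] := List.eq_nil_of_length_eq_zero (by omega)
    simp only [popMany, h, List.foldl_nil]
    rw [← h, update_eq_self]
  | succ n ih =>
    simp only [popMany, TM2.stepAux]
    rw [ih _ _ (by simp; omega)]
    cases h : S k with
    | nil => simp [hf]
    | cons x l => simp

/-- Push the symbols of the list `l` one after the other. -/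
def pushList (k : K) (l : List (Γ k)) (q : TM2.Stmt Γ Λ σ) : TM2.Stmt Γ Λ σ :=
  l.foldr (fun x q => .push k (fun _ => x) q) q

theorem stepAux_pushList (k : K) (l : List (Γ k)) (q : TM2.Stmt Γ Λ σ) (v : σ)
    (S : ∀ k, List (Γ k)) :
    TM2.stepAux (pushList k l q) v S = TM2.stepAux q v (update S k (l.reverse ++ S k)) := by
  induction l generalizing S with
  | nil => simp [pushList]
  | cons x l ih =>
    have := ih (update S k (x :: S k))
    simp only [pushList, List.foldr_cons, TM2.stepAux] at this ⊢
    rw [this]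
    simp

/-- Push the string of the first index in the list whose test succeeds. -/
def pushFirst {ι : Type} (k : K) (g : ι → σ → Bool) (w : ι → List (Γ k)) (q : TM2.Stmt Γ Λ σ) :
    List ι → TM2.Stmt Γ Λ σ
  | [] => q
  | i :: is => .branch (g i) (pushList k (w i) q) (pushFirst k g w q is)

theorem stepAux_pushFirst_none {ι : Type} (k : K) (g : ι → σ → Bool) (w : ι → List (Γ k))
    (q : TM2.Stmt Γ Λ σ) (is : List ι) (v : σ) (S : ∀ k, List (Γ k)) (h : ∀ i, g i v = false) :
    TM2.stepAux (pushFirst k g w q is) v S = TM2.stepAux q v S := by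
  induction is with
  | nil => rfl
  | cons i is ih => simp [pushFirst, h, ih]

theorem stepAux_pushFirst_some {ι : Type} (k : K) (g : ι → σ → Bool) (w : ι → List (Γ k))
    (q : TM2.Stmt Γ Λ σ) (is : List ι) (v : σ) (S : ∀ k, List (Γ k)) (j : ι) (hj : j ∈ is)
    (h : ∀ i, g i v = true ↔ i = j) :
    TM2.stepAux (pushFirst k g w q is) v S =
      TM2.stepAux q v (update S k ((w j).reverse ++ S k)) := by
  induction is with
  | nil => simp at hj
  | cons i is ih =>
    by_cases hi : i = j
    · subst hi
      simp [pushFirst, (h i).2 rfl, stepAux_pushList]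
    · have hg : g i v = false := by
        rw [← Bool.not_eq_true, h]; exact hi
      simp only [pushFirst, TM2.stepAux, hg, cond_false]
      exact ih (by simpa [Ne.symm hi] using hj)

/-- Push all symbols of the list whose test succeeds. -/
def pushFilter (k : K) (g : Γ k → σ → Bool) (q : TM2.Stmt Γ Λ σ) :
    List (Γ k) → TM2.Stmt Γ Λ σ
  | [] => q
  | y :: ys => .branch (g y) (.push k (fun _ => y) (pushFilter k g q ys)) (pushFilter k g q ys)

theorem stepAux_pushFilter (k : K) (g : Γ k → σ → Bool) (q : TM2.Stmt Γ Λ σ) (ys : List (Γ k))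
    (v : σ) (S : ∀ k, List (Γ k)) :
    TM2.stepAux (pushFilter k g q ys) v S =
      TM2.stepAux q v (update S k ((ys.filter (g · v)).reverse ++ S k)) := by
  induction ys generalizing S with
  | nil => simp [pushFilter]
  | cons y ys ih =>
    cases h : g y v <;> simp [pushFilter, h, ih]

end Programs

/-! ### Message coding -/

theorem unpack_pack_singleton (m : Message) : unpack (pack [m]) = [m] := by
  have h : ∀ m : Message, unpack (m.map some ++ [none]) = [m] := by
    intro m
    induction m with
    | nil => rfl
    | cons b m ih => simp [unpack, ih]
  simpa [pack] using h m

theorem length_pack_le (ms : List Message) (b : ℕ) (h : ∀ m ∈ ms, m.length ≤ b) :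
    (pack ms).length ≤ ms.length * (b + 1) := by
  induction ms with
  | nil => simp [pack]
  | cons m ms ih =>
    have h1 := ih fun x hx => h x (by simp [hx])
    have h2 := h m (by simp)
    simp only [pack, List.flatMap_cons, List.length_append, List.length_map, List.length_cons,
      List.length_nil] at h1 ⊢
    nlinarith

instance {C : Type} [Finite C] {p : ℕ} : Finite (Datum C p) := by
  let f : C ⊕ C ⊕ Fin p ⊕ Unit → Datum C p
    | .inl c => .self c
    | .inr (.inl c) => .neighbor c
    | .inr (.inr (.inl P)) => .prop P
    | .inr (.inr (.inr _)) => .requesting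
  refine Finite.of_surjective f ?_
  rintro (c | c | P | _)
  · exact ⟨.inl c, rfl⟩
  · exact ⟨.inr (.inl c), rfl⟩
  · exact ⟨.inr (.inr (.inl P)), rfl⟩
  · exact ⟨.inr (.inr (.inr ())), rfl⟩

/-! ### Finite automata at the nodes -/

/-- A node algorithm in abstract form: in every round, a node in a state of the finite set `Q` reads
the set of messages that have arrived, changes its state and broadcasts at most one message. In
state `q` it holds the result tuples `out q`. -/
structure Automaton (C : Type) (p ℓ : ℕ) where
  Q : Type
  Msg : Type
  [finQ : Finite Q]
  [finMsg : Finite Msg]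
  init : Set (Datum C p) → Q
  step : Q → Set Msg → Q × Option Msg
  out : Q → Set (Fin ℓ → C)

namespace Automaton

variable {C : Type} {p ℓ : ℕ} (A : Automaton C p ℓ)

instance : Finite A.Q := A.finQ
instance : Finite A.Msg := A.finMsg

/-- The situation of a node at the beginning of a round. -/
structure Loc where
  awake : Prop
  state : A.Q
  inbox : Set A.Msg
  res : Set (Fin ℓ → C)

variable {A}

open scoped Classical in
/-- The state after the computation of a round. -/
noncomputable def Loc.after (x : A.Loc) : A.Q :=
  if x.awake then (A.step x.state x.inbox).1 else x.state

open scoped Classical in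
/-- The message broadcast in a round. -/
noncomputable def Loc.emit (x : A.Loc) : Option A.Msg :=
  if x.awake then (A.step x.state x.inbox).2 else none

variable (A)

/-- The synchronous run of the automaton on a network upon a request from `r`. -/
noncomputable def run {V : Type} [Fintype V] (N : Network V C p) (r : V) : ℕ → V → A.Loc
  | 0, v => ⟨v = r, A.init {d | d ∈ N.localData r v}, ∅, ∅⟩
  | t + 1, v =>
    ⟨(run N r t v).awake ∨ ∃ u m, N.graph.Adj v u ∧ (run N r t u).emit = some m,
      (run N r t v).after,
      {m | ∃ u, N.graph.Adj v u ∧ (run N r t u).emit = some m},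
      (run N r t v).res ∪ {y | (run N r t v).awake ∧ y ∈ A.out (run N r t v).after}⟩

/-! ### Compiling an automaton to a stack machine -/

/-- The number of messages. -/
noncomputable def size : ℕ := Nat.card A.Msg

/-- The index of a message. -/
noncomputable def index (m : A.Msg) : Fin A.size := Finite.equivFin A.Msg m

/-- Messages are coded in unary. -/
noncomputable def encode (m : A.Msg) : Message := List.replicate (A.index m) true

theorem encode_injective : Injective A.encode := by
  intro m m' h
  have h' := congrArg List.length h
  simp only [encode, List.length_replicate] at h'
  exact (Finite.equivFin A.Msg).injective (Fin.ext h')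

theorem length_encode_le (m : A.Msg) : (A.encode m).length ≤ A.size := by
  simp [encode]

/-- The internal memory of the machine. -/
structure Memory where
  ctrl : Option A.Q
  dat : Set (Datum C p)
  cnt : Fin (A.size + 1)
  inb : Set A.Msg
  msg : Option A.Msg

instance [Finite C] : Finite A.Memory := by
  refine Finite.of_injective
    (β := Option A.Q × Set (Datum C p) × Fin (A.size + 1) × Set A.Msg × Option A.Msg)
    (fun s => (s.ctrl, s.dat, s.cnt, s.inb, s.msg)) ?_
  rintro ⟨⟩ ⟨⟩ h
  simpa using h

variable {A}

/-- Read a symbol of the local data. -/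
noncomputable def Memory.readDatum (s : A.Memory) : Option (Datum C p) → A.Memory
  | none => s
  | some d => { s with dat := insert d s.dat }

/-- Read a symbol of the in-buffer. -/
noncomputable def Memory.readSymbol (s : A.Memory) : Option (Option Bool) → A.Memory
  | none => s
  | some (some _) => { s with cnt := s.cnt + 1 }
  | some none => { s with cnt := 0, inb := s.inb ∪ {m | (A.index m : ℕ) = s.cnt} }

/-- The automaton state represented in the memory. -/
noncomputable def Memory.state (s : A.Memory) : A.Q := s.ctrl.getD (A.init s.dat)

/-- Perform a step of the automaton. -/
noncomputable def Memory.move (s : A.Memory) : A.Memory where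
  ctrl := some (A.step s.state s.inb).1
  dat := ∅
  cnt := 0
  inb := ∅
  msg := (A.step s.state s.inb).2

theorem foldl_readDatum (l : List (Datum C p)) (s : A.Memory) :
    l.foldl (fun v x => v.readDatum (some x)) s = { s with dat := s.dat ∪ {d | d ∈ l} } := by
  induction l generalizing s with
  | nil => simp
  | cons d l ih =>
    rw [List.foldl_cons, ih]
    simp only [Memory.readDatum, Memory.mk.injEq, true_and, and_true]
    ext x
    simp
    tauto

theorem foldl_readSymbol_encode (m : A.Msg) (s : A.Memory) (hs : s.cnt = 0) :
    ((A.encode m).map some ++ [none]).foldl (fun v x => v.readSymbol (some x)) s =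
      { s with inb := insert m s.inb } := by
  have h : ∀ n : ℕ, n ≤ A.size → ((List.replicate n true).map some).foldl
      (fun v x => v.readSymbol (some x)) s = { s with cnt := Fin.ofNat _ n } := by
    intro n hn
    induction n with
    | zero => cases s; simp at hs; subst hs; rfl
    | succ n ih =>
      rw [List.replicate_succ', List.map_append, List.foldl_append, ih (by omega)]
      simp only [List.map_cons, List.map_nil, List.foldl_cons, List.foldl_nil, Memory.readSymbol]
      congr 1
      ext
      simp [Fin.val_add]
  rw [List.foldl_append, encode, h _ (A.index m).2.le]
  -- The index is below `A.size + 1`, so the counter has not wrapped around and determines the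
  -- message.
  have h2 : {m' | (A.index m' : ℕ) = ((Fin.ofNat (A.size + 1) (A.index m) : Fin _) : ℕ)} = {m} := by
    ext m'
    have : (A.index m : ℕ) % (A.size + 1) = A.index m := Nat.mod_eq_of_lt (by omega)
    simp only [Fin.val_ofNat, this, Set.mem_ofPred_eq, Set.mem_singleton_iff]
    exact ⟨fun h => (Finite.equivFin A.Msg).injective (Fin.ext h), fun h => by rw [h]⟩
  simp only [List.foldl_cons, List.foldl_nil, Memory.readSymbol, h2]
  rw [Set.union_singleton, hs]

/-- Each separator resets the counter, so the codes are read independently. Only the set of messages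
survives, which makes the order of arrival irrelevant. -/
theorem foldl_readSymbol_pack (l : List Message) (hl : ∀ x ∈ l, ∃ m, A.encode m = x)
    (s : A.Memory) (hs : s.cnt = 0) :
    (pack l).foldl (fun v x => v.readSymbol (some x)) s =
      { s with inb := s.inb ∪ {m | A.encode m ∈ l} } := by
  induction l generalizing s with
  | nil => simp [pack]
  | cons x l ih =>
    obtain ⟨m, rfl⟩ := hl x (by simp)
    have : pack (A.encode m :: l) = ((A.encode m).map some ++ [none]) ++ pack l := by simp [pack]
    rw [this, List.foldl_append, foldl_readSymbol_encode m s hs,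
      ih (fun x hx => hl x (by simp [hx])) { s with inb := insert m s.inb } hs]
    simp only [Memory.mk.injEq, true_and, and_true]
    ext m'
    simp [A.encode_injective.eq_iff]
    tauto

variable (A)

/-- The alphabets of the machine, which needs no work stacks. -/
abbrev Stacks (C : Type) (p ℓ : ℕ) : StackName Empty → Type := StackName.Alphabet C p ℓ Unit

open scoped Classical in
/-- The program of a round: read the local data and the in-buffer, make a step of the automaton,
write the out-buffer and the result table. -/
noncomputable def program [Finite C] (d b : ℕ) : TM2.Stmt (Stacks C p ℓ) Unit A.Memory :=
  popMany (Γ := Stacks C p ℓ) StackName.data Memory.readDatum d <|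
  popMany (Γ := Stacks C p ℓ) StackName.inbox Memory.readSymbol b <|
  .load Memory.move <|
  pushFirst (Γ := Stacks C p ℓ) (ι := A.Msg) StackName.outbox (fun m s => decide (s.msg = some m))
    (fun m => (pack [A.encode m]).reverse)
    (pushFilter (Γ := Stacks C p ℓ) StackName.result
      (fun y s => decide ((show Fin ℓ → C from y) ∈ A.out s.state)) .halt
      (@Finset.univ (Fin ℓ → C) (Fintype.ofFinite _)).toList)
    (@Finset.univ A.Msg (Fintype.ofFinite _)).toList

/-- The machine executing the automaton, with room for `d` data and `b` symbols of messages. -/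
noncomputable def engine [Finite C] (d b : ℕ) : Engine C p ℓ where
  W := Empty
  A := Unit
  Λ := Unit
  σ := A.Memory
  main := ()
  start := ⟨none, ∅, 0, ∅, none⟩
  prog := fun _ => A.program d b

/-! ### The machine follows the automaton round by round -/

section Simulation

variable {A}

/-- The stacks of a node without work stacks. -/
def packStacks (dat : List (Datum C p)) (inb outb : List (Option Bool)) (res : List (Fin ℓ → C)) :
    ∀ s, List (Stacks C p ℓ s)
  | .data => dat
  | .inbox => inb
  | .outbox => outb
  | .result => res

theorem update_data_packStacks (dat dat' : List (Datum C p)) (inb outb : List (Option Bool))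
    (res : List (Fin ℓ → C)) :
    update (packStacks dat inb outb res) StackName.data dat' = packStacks dat' inb outb res := by
  funext k; rcases k with _ | _ | _ | _ | ⟨⟨⟩⟩ <;> rfl

theorem update_inbox_packStacks (inb inb' : List (Option Bool)) (dat : List (Datum C p))
    (outb : List (Option Bool)) (res : List (Fin ℓ → C)) :
    update (packStacks dat inb outb res) StackName.inbox inb' = packStacks dat inb' outb res := by
  funext k; rcases k with _ | _ | _ | _ | ⟨⟨⟩⟩ <;> rfl

theorem update_outbox_packStacks (outb outb' : List (Option Bool)) (dat : List (Datum C p))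
    (inb : List (Option Bool)) (res : List (Fin ℓ → C)) :
    update (packStacks dat inb outb res) StackName.outbox outb' = packStacks dat inb outb' res := by
  funext k; rcases k with _ | _ | _ | _ | ⟨⟨⟩⟩ <;> rfl

theorem update_result_packStacks (res res' : List (Fin ℓ → C)) (dat : List (Datum C p))
    (inb outb : List (Option Bool)) :
    update (packStacks dat inb outb res) StackName.result res' = packStacks dat inb outb res' := by
  funext k; rcases k with _ | _ | _ | _ | ⟨⟨⟩⟩ <;> rfl

variable [Finite C] {d b : ℕ}

-- The control state is `none` until the first computation, when it is initialized from the data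
-- stack; that stack is then empty for good. `getD` covers both situations.
open scoped Classical in
theorem stepAux_program (dat : List (Datum C p)) (l : List Message) (res : List (Fin ℓ → C))
    (s : A.Memory) (hdat : dat.length ≤ d) (hl : ∀ x ∈ l, ∃ m, A.encode m = x)
    (hlen : (pack l).length ≤ b) (hs : s.dat = ∅) (hc : s.cnt = 0) (hi : s.inb = ∅) :
    ∃ new : List (Fin ℓ → C),
      TM2.stepAux (A.program d b) s (packStacks dat (pack l) [] res) =
        ⟨none, ⟨some (A.step (s.ctrl.getD (A.init {x | x ∈ dat})) {m | A.encode m ∈ l}).1, ∅, 0, ∅,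
          (A.step (s.ctrl.getD (A.init {x | x ∈ dat})) {m | A.encode m ∈ l}).2⟩,
        packStacks [] [] (pack ((A.step (s.ctrl.getD (A.init {x | x ∈ dat}))
          {m | A.encode m ∈ l}).2.map A.encode).toList) (new ++ res)⟩ ∧
      ∀ y, y ∈ new ↔
        y ∈ A.out (A.step (s.ctrl.getD (A.init {x | x ∈ dat})) {m | A.encode m ∈ l}).1 := by
  set q := s.ctrl.getD (A.init {x | x ∈ dat}) with hq
  set I := {m | A.encode m ∈ l} with hI
  set s' : A.Memory := ⟨some (A.step q I).1, ∅, 0, ∅, (A.step q I).2⟩ with hs'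
  have e1 : dat.foldl (fun v x => v.readDatum (some x)) s = { s with dat := {x | x ∈ dat} } := by
    rw [foldl_readDatum, hs, Set.empty_union]
  have e2 : (pack l).foldl (fun v x => v.readSymbol (some x)) { s with dat := {x | x ∈ dat} } =
      { s with dat := {x | x ∈ dat}, inb := I } := by
    rw [foldl_readSymbol_pack l hl { s with dat := {x | x ∈ dat} } hc]
    simp only [hi, Set.empty_union, hI]
  let ys : List (Fin ℓ → C) := (@Finset.univ (Fin ℓ → C) (Fintype.ofFinite _)).toList
  let new : List (Fin ℓ → C) := (ys.filter (fun y => decide (y ∈ A.out s'.state))).reverse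
  let prog₄ : TM2.Stmt (Stacks C p ℓ) Unit A.Memory := pushFilter (Γ := Stacks C p ℓ)
    StackName.result (fun y s => decide ((show Fin ℓ → C from y) ∈ A.out s.state)) .halt ys
  let prog₃ : TM2.Stmt (Stacks C p ℓ) Unit A.Memory :=
    pushFirst (Γ := Stacks C p ℓ) (ι := A.Msg) StackName.outbox
      (fun m s => decide (s.msg = some m)) (fun m => (pack [A.encode m]).reverse) prog₄
      (@Finset.univ A.Msg (Fintype.ofFinite _)).toList
  let prog₂ : TM2.Stmt (Stacks C p ℓ) Unit A.Memory :=
    popMany (Γ := Stacks C p ℓ) StackName.inbox Memory.readSymbol b (.load Memory.move prog₃)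
  have r1 : TM2.stepAux (A.program d b) s (packStacks dat (pack l) [] res) =
      TM2.stepAux prog₂ { s with dat := {x | x ∈ dat} } (packStacks [] (pack l) [] res) := by
    rw [← update_data_packStacks dat [], ← e1]
    exact stepAux_popMany (Γ := Stacks C p ℓ) StackName.data Memory.readDatum (fun _ => rfl) d
      prog₂ s (packStacks dat (pack l) [] res) hdat
  have r2 : TM2.stepAux prog₂ { s with dat := {x | x ∈ dat} } (packStacks [] (pack l) [] res) =
      TM2.stepAux prog₃ s' (packStacks [] [] [] res) := by
    rw [← update_inbox_packStacks (pack l) []]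
    have h3 : s' = ((pack l).foldl (fun (v : A.Memory) x => v.readSymbol (some x))
      { s with dat := {x | x ∈ dat} }).move := by rw [e2]; rfl
    rw [h3]
    exact stepAux_popMany (Γ := Stacks C p ℓ) StackName.inbox Memory.readSymbol (fun _ => rfl) b
      (.load Memory.move prog₃) _ (packStacks [] (pack l) [] res) hlen
  -- Pushing reverses a string, so the program stores the code reversed and the out-buffer reads
  -- correctly from the top.
  have r3 : TM2.stepAux prog₃ s' (packStacks [] [] [] res) = TM2.stepAux prog₄ s'
      (packStacks [] [] (pack ((A.step q I).2.map A.encode).toList) res) := by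
    cases ho : (A.step q I).2 with
    | none => exact stepAux_pushFirst_none _ _ _ _ _ _ _ (by intro i; simp [hs', ho])
    | some m =>
      refine (stepAux_pushFirst_some (Γ := Stacks C p ℓ) (ι := A.Msg) StackName.outbox
        (fun m s => decide (s.msg = some m)) (fun m => (pack [A.encode m]).reverse) prog₄ _ s'
        (packStacks [] [] [] res) m (Finset.mem_toList.2 (@Finset.mem_univ _ (_) _))
        (by intro i; simp [hs', ho, eq_comm])).trans ?_
      have h := update_outbox_packStacks (C := C) (p := p) (ℓ := ℓ) []
        ((pack [A.encode m]).reverse.reverse ++ []) [] [] res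
      refine (congrArg (TM2.stepAux prog₄ s') h).trans ?_
      rw [List.reverse_reverse, List.append_nil]
      rfl
  have r4 : ∀ o, TM2.stepAux prog₄ s' (packStacks [] [] o res) =
      ⟨none, s', packStacks [] [] o (new ++ res)⟩ := by
    intro o
    rw [← update_result_packStacks res (new ++ res)]
    exact stepAux_pushFilter (Γ := Stacks C p ℓ) StackName.result
      (fun y s => decide ((show Fin ℓ → C from y) ∈ A.out s.state)) .halt ys s'
      (packStacks [] [] o res)
  refine ⟨new, by rw [r1, r2, r3, r4], fun y => ?_⟩
  simp [new, ys, Memory.state, hs']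

/-- A single `TM2` step runs a whole statement up to `halt`, and the program is a single statement
without jumps. -/
theorem halts_and_compute (E : (A.engine d b).NodeState) (mem : A.Memory)
    (dat : List (Datum C p)) (l : List Message) (res : List (Fin ℓ → C))
    (hE : E = ⟨true, mem, packStacks dat (pack l) [] res⟩) (hdat : dat.length ≤ d)
    (hl : ∀ x ∈ l, ∃ m, A.encode m = x)
    (hlen : (pack l).length ≤ b) (hs : mem.dat = ∅) (hc : mem.cnt = 0) (hi : mem.inb = ∅) :
    (A.engine d b).HaltsWithin E 1 ∧
    ∃ new : List (Fin ℓ → C), (A.engine d b).compute E =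
        ⟨true, (⟨some (A.step (mem.ctrl.getD (A.init {x | x ∈ dat})) {m | A.encode m ∈ l}).1,
          ∅, 0, ∅,
          (A.step (mem.ctrl.getD (A.init {x | x ∈ dat})) {m | A.encode m ∈ l}).2⟩ : A.Memory),
        packStacks [] [] (pack ((A.step (mem.ctrl.getD (A.init {x | x ∈ dat}))
          {m | A.encode m ∈ l}).2.map A.encode).toList) (new ++ res)⟩ ∧
      ∀ y, y ∈ new ↔
        y ∈ A.out (A.step (mem.ctrl.getD (A.init {x | x ∈ dat})) {m | A.encode m ∈ l}).1 := by
  obtain ⟨new, h1, h2⟩ := stepAux_program (d := d) (b := b) dat l res mem hdat hl hlen hs hc hi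
  have hnext : (A.engine d b).next ((A.engine d b).begin E) = _ := (by subst hE; rfl :
    (A.engine d b).next ((A.engine d b).begin E) =
      TM2.stepAux (A.program d b) mem (packStacks dat (pack l) [] res)).trans h1
  have hhalt : (A.engine d b).HaltsWithin E 1 := by
    rw [Engine.HaltsWithin, iterate_one, hnext]; rfl
  refine ⟨hhalt, new, ?_, h2⟩
  have hex : ∃ c, (A.engine d b).HaltsWithin E c := ⟨1, hhalt⟩
  -- Stated for every decidability instance, because `compute` uses the classical one.
  have hfind : ∀ inst : DecidablePred ((A.engine d b).HaltsWithin E), @Nat.find _ inst hex = 1 := by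
    intro inst
    rw [Nat.find_eq_iff]
    refine ⟨hhalt, fun n hn h => ?_⟩
    obtain rfl : n = 0 := by omega
    exact absurd h (by simp [Engine.HaltsWithin, Engine.begin])
  have hawake : E.awake = true := by rw [hE]
  rw [Engine.compute, dif_pos ⟨hawake, hex⟩]
  simp only [hfind, iterate_one, hnext]

/-- The machine state `E` represents the situation `x` of an automaton. -/
def Represents (b : ℕ) (x : A.Loc) (E : (A.engine d b).NodeState) : Prop :=
  ∃ (mem : A.Memory) (dat : List (Datum C p)) (l : List Message) (res : List (Fin ℓ → C)),
    E = ⟨E.awake, mem, packStacks dat (pack l) [] res⟩ ∧ (E.awake = true ↔ x.awake) ∧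
    dat.length ≤ d ∧ (∀ y ∈ l, ∃ m, A.encode m = y) ∧ (pack l).length ≤ b ∧
    mem.dat = ∅ ∧ mem.cnt = 0 ∧ mem.inb = ∅ ∧
    mem.ctrl.getD (A.init {y | y ∈ dat}) = x.state ∧ {m | A.encode m ∈ l} = x.inbox ∧
    {y | y ∈ res} = x.res ∧ (¬ x.awake → l = [])

theorem Represents.compute {x : A.Loc} {E : (A.engine d b).NodeState} (h : Represents b x E) :
    (E.awake = true → (A.engine d b).HaltsWithin E 1) ∧
    (A.engine d b).sent E = (x.emit.map A.encode).toList ∧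
    ∃ (mem : A.Memory) (dat : List (Datum C p)) (res : List (Fin ℓ → C)),
      (A.engine d b).compute E =
        ⟨E.awake, mem, packStacks dat [] (pack (x.emit.map A.encode).toList) res⟩ ∧
      dat.length ≤ d ∧ mem.dat = ∅ ∧ mem.cnt = 0 ∧ mem.inb = ∅ ∧
      mem.ctrl.getD (A.init {y | y ∈ dat}) = x.after ∧
      {y | y ∈ res} = x.res ∪ {y | x.awake ∧ y ∈ A.out x.after} := by
  obtain ⟨mem, dat, l, res, hE, haw, hdat, hl, hlen, hs, hc, hi, hst, hin, hres, hidle⟩ := h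
  by_cases ha : x.awake
  · rw [haw.2 ha] at hE
    obtain ⟨hh, new, hcomp, hnew⟩ := halts_and_compute E mem dat l res hE hdat hl hlen hs hc hi
    rw [hst, hin] at hcomp hnew
    have hem : x.emit = (A.step x.state x.inbox).2 := by simp [Loc.emit, ha]
    have haf : x.after = (A.step x.state x.inbox).1 := by simp [Loc.after, ha]
    rw [← hem, ← haf] at hcomp
    rw [← haf] at hnew
    refine ⟨fun _ => hh, ?_, ⟨some x.after, ∅, 0, ∅, x.emit⟩, [], new ++ res, ?_, by simp, rfl,
      rfl, rfl, rfl, ?_⟩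
    · rw [Engine.sent, hcomp]
      change unpack (pack (x.emit.map A.encode).toList) = _
      cases x.emit with
      | none => rfl
      | some m => exact unpack_pack_singleton _
    · rw [hcomp, haw.2 ha]
    · ext y
      rw [← hres]
      simp [hnew, ha, or_comm]
  · have hna : E.awake = false := by
      rw [← Bool.not_eq_true, haw]; exact ha
    have hem : x.emit = none := by simp [Loc.emit, ha]
    have haf : x.after = x.state := by simp [Loc.after, ha]
    have hcomp : (A.engine d b).compute E = E := by
      rw [Engine.compute, dif_neg (by simp [hna])]
    have hl0 := hidle ha
    subst hl0
    refine ⟨fun h => absurd h (by simp [hna]), ?_, mem, dat, res, ?_, hdat, hs, hc, hi,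
      by rw [haf, hst], by simp [hres, ha]⟩
    · rw [Engine.sent, hcomp, hE, hem]; rfl
    · rw [hcomp, hem]; exact hE

theorem represents_deliver {x : A.Loc} {E : (A.engine d b).NodeState} (h : Represents b x E)
    (arr : List Message) (I : Set A.Msg) (harr : ∀ y ∈ arr, ∃ m, A.encode m = y)
    (hI : {m | A.encode m ∈ arr} = I) (hlen : (pack arr).length ≤ b) (aw : Prop)
    (haw : aw ↔ x.awake ∨ I.Nonempty) :
    Represents b ⟨aw, x.after, I, x.res ∪ {y | x.awake ∧ y ∈ A.out x.after}⟩
      ((A.engine d b).deliver ((A.engine d b).compute E) arr) := by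
  have hE := h
  obtain ⟨-, -, -, -, -, hawE, -⟩ := hE
  obtain ⟨-, -, mem, dat, res, hcomp, hdat, hs, hc, hi, hst, hres⟩ := h.compute
  -- Waking depends on the list of arriving strings, while the automaton sees a set of messages; the
  -- two are empty together because every string is a code.
  have hne : arr ≠ [] ↔ I.Nonempty := by
    constructor
    · intro hne
      obtain ⟨y, hy⟩ := List.exists_mem_of_ne_nil _ hne
      obtain ⟨m, rfl⟩ := harr y hy
      exact ⟨m, by rw [← hI]; exact hy⟩
    · rintro ⟨m, hm⟩ rfl
      rw [← hI] at hm
      simp at hm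
  refine ⟨mem, dat, arr, res, ?_, ?_, hdat, harr, hlen, hs, hc, hi, hst, hI, hres, ?_⟩
  · rw [hcomp]
    have h1 := update_outbox_packStacks (C := C) (p := p) (ℓ := ℓ)
      (pack (x.emit.map A.encode).toList) [] dat [] res
    have h2 := update_inbox_packStacks (C := C) (p := p) (ℓ := ℓ) [] (pack arr) dat [] res
    rw [← h1] at h2
    exact congrArg (Engine.NodeState.mk (M := A.engine d b) _ _) h2
  · rw [haw, ← hawE, ← hne, hcomp]
    simp [Engine.deliver]
  · intro hn
    by_contra hne'
    exact hn (haw.2 (Or.inr (hne.1 hne')))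

end Simulation

/-- Every execution of the machine behaves like the run of the automaton. -/
theorem engine_correct [Finite C] (D : ℕ) :
    ∃ d b : ℕ, ∀ (V : Type) [Fintype V] (N : Network V C p),
      (∀ v, (N.graph.neighborSet v).ncard ≤ D) →
      ∀ (r : V) (E : ℕ → V → (A.engine d b).NodeState), (A.engine d b).IsExecution N r E →
      ∀ t v, ((E t v).awake = true → (A.engine d b).HaltsWithin (E t v) 1) ∧
        (A.engine d b).sent (E t v) = ((A.run N r t v).emit.map A.encode).toList ∧
        (A.engine d b).held (E t v) = (A.run N r t v).res := by
  classical
  -- Data: one label, at most `D` neighbors, at most `p` properties, one request mark. In-buffer: at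
  -- most `D` messages, each of at most `A.size` bits and a separator.
  refine ⟨1 + D + p + 1, D * (A.size + 1), ?_⟩
  intro V _ N hD r E hE
  have hdeg : ∀ v, (N.graph.neighborFinset v).card ≤ D := by
    intro v
    refine le_trans (le_of_eq ?_) (hD v)
    have h := Set.ncard_coe_finset (N.graph.neighborFinset v)
    rw [SimpleGraph.coe_neighborFinset] at h
    exact h.symm
  have key : ∀ t v, Represents (D * (A.size + 1)) (A.run N r t v) (E t v) := by
    intro t
    induction t with
    | zero =>
      intro v
      have hlen : ((E 0 v).stk StackName.data).length ≤ 1 + D + p + 1 := by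
        have h := congrArg Multiset.card (hE.init_data v)
        have h1 := hdeg v
        have h2 : (Finset.univ.filter (fun P => N.prop P v)).card ≤ p := by
          simpa using Finset.card_filter_le (Finset.univ : Finset (Fin p)) (fun P => N.prop P v)
        have h3 : Multiset.card (if v = r then {Datum.requesting} else 0 :
          Multiset (Datum C p)) ≤ 1 := by split <;> simp
        simp only [Network.localData, Multiset.card_add, Multiset.card_map,
          Multiset.card_singleton, Finset.card_val] at h
        have h4 : ((E 0 v).stk StackName.data).length = _ := h
        rw [h4]
        convert (show 1 + (N.graph.neighborFinset v).card +
          (Finset.univ.filter (fun P => N.prop P v)).card +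
          Multiset.card (if v = r then {Datum.requesting} else 0 :
          Multiset (Datum C p)) ≤ 1 + D + p + 1 by omega)
      refine ⟨⟨none, ∅, 0, ∅, none⟩, (E 0 v).stk StackName.data, [], [], ?_, ?_, hlen, by simp,
        by simp [pack], rfl, rfl, rfl, ?_, ?_, by simp [run], by simp⟩
      · have hv := hE.init_var v
        have hk : (E 0 v).stk = packStacks ((E 0 v).stk StackName.data) (pack []) [] [] := by
          funext k
          rcases k with _ | _ | _ | _ | ⟨⟨⟩⟩
          · rfl
          all_goals exact hE.init_stk v _ (by simp)
        change E 0 v = ⟨_, (A.engine _ _).start, _⟩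
        rw [← hv, ← hk]
      · rw [hE.init_awake]; rfl
      · change A.init _ = A.init _
        congr 1
        ext x
        simp only [Set.mem_ofPred_eq]
        rw [← hE.init_data v]
        exact Multiset.mem_coe.symm
      · simp [run]
    | succ t ih =>
      intro v
      obtain ⟨arr, harr, hstep⟩ := hE.round t v
      have hsent : ∀ u, (A.engine _ _).sent (E t u) =
        ((A.run N r t u).emit.map A.encode).toList := fun u => (ih u).compute.2.1
      simp only [hsent] at harr
      have hmem : ∀ y, y ∈ arr ↔
          ∃ u m, N.graph.Adj v u ∧ (A.run N r t u).emit = some m ∧ A.encode m = y := by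
        intro y
        rw [← Multiset.mem_coe, harr, Multiset.mem_sum]
        simp only [SimpleGraph.mem_neighborFinset, Multiset.mem_coe, Option.mem_toList,
          Option.map_eq_some_iff]
        exact ⟨fun ⟨u, hu, m, h1, h2⟩ => ⟨u, m, hu, h1, h2⟩,
          fun ⟨u, m, hu, h1, h2⟩ => ⟨u, hu, m, h1, h2⟩⟩
      have hcard : arr.length ≤ D := by
        have h := congrArg Multiset.card harr
        rw [Multiset.coe_card, Multiset.card_sum] at h
        rw [h]
        refine le_trans (Finset.sum_le_card_nsmul _ _ 1 ?_) (by simpa using hdeg v)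
        intro u _
        cases (A.run N r t u).emit <;> simp
      have henc : ∀ y ∈ arr, ∃ m, A.encode m = y := by
        intro y hy
        obtain ⟨u, m, -, -, h⟩ := (hmem y).1 hy
        exact ⟨m, h⟩
      rw [hstep]
      refine represents_deliver (ih v) arr _ henc ?_ ?_ _ ?_
      · ext m
        simp only [Set.mem_ofPred_eq, hmem]
        constructor
        · rintro ⟨u, m', hu, h1, h2⟩
          exact ⟨u, hu, by rw [h1, A.encode_injective h2]⟩
        · rintro ⟨u, hu, h1⟩
          exact ⟨u, m, hu, h1, rfl⟩
      · refine le_trans (length_pack_le arr A.size ?_) (Nat.mul_le_mul_right _ hcard)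
        intro y hy
        obtain ⟨m, rfl⟩ := henc y hy
        exact A.length_encode_le m
      · refine or_congr Iff.rfl ?_
        exact ⟨fun ⟨u, m, h⟩ => ⟨m, u, h⟩, fun ⟨m, u, h⟩ => ⟨u, m, h⟩⟩
  intro t v
  obtain ⟨h1, h2, -⟩ := (key t v).compute
  refine ⟨h1, h2, ?_⟩
  obtain ⟨mem, dat, l, res, hE', -, -, -, -, -, -, -, -, -, hres, -⟩ := key t v
  rw [← hres, hE']
  rfl

end Automaton

/-! ### Distances -/

theorem exists_adj_dist {V : Type} {G : SimpleGraph V} (hG : G.Connected) {a v : V} {n : ℕ}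
    (h : G.dist a v = n + 1) : ∃ u, G.Adj v u ∧ G.dist a u = n := by
  obtain ⟨w, hw⟩ := hG.exists_walk_length_eq_dist v a
  cases w with
  | nil => simp at h
  | cons hadj w =>
    rename_i u
    refine ⟨u, hadj, ?_⟩
    rw [SimpleGraph.Walk.length_cons, SimpleGraph.dist_comm, h] at hw
    have h1 := SimpleGraph.dist_le w
    have h2 := hG.dist_triangle (u := v) (v := u) (w := a)
    rw [SimpleGraph.dist_eq_one_iff_adj.2 hadj, SimpleGraph.dist_comm (u := v) (v := a), h] at h2
    rw [SimpleGraph.dist_comm]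
    omega

theorem dist_le_succ {V : Type} {G : SimpleGraph V} (hG : G.Connected) (a : V) {u v : V} (h : G.Adj v u) :
    G.dist a v ≤ G.dist a u + 1 := by
  have h2 := hG.dist_triangle (u := a) (v := u) (w := v)
  rwa [SimpleGraph.dist_eq_one_iff_adj.2 h.symm] at h2

theorem dist_lt_card {V : Type} [Fintype V] {G : SimpleGraph V} (hG : G.Connected) (a b : V) :
    G.dist a b < Fintype.card V := by
  obtain ⟨w, hw, hl⟩ := hG.exists_path_of_dist a b
  rw [← hl]
  exact hw.length_lt

/-! ### Gossip protocols -/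

/-- For each radius `j ≤ R`, the set of facts that a node has learned from distance at most `j`. -/
abbrev Know (R : ℕ) (Fact : Type) : Type := Fin (R + 1) → Set Fact

/-- Merge received knowledge into `K`: the distance of a fact grows by one. -/
def Know.merge {R : ℕ} {Fact : Type} (K : Know R Fact) (I : Set (Know R Fact)) : Know R Fact :=
  fun j => K j ∪ {f | ∃ M ∈ I, ∃ i : Fin (R + 1), (i : ℕ) + 1 = j ∧ f ∈ M i}

/-- A gossip protocol: in every round a node merges the knowledge received from its neighbors into
its own knowledge and then adds new facts; the rule that determines these, and the new private
state, sees the knowledge before and after merging. The node broadcasts its knowledge when it has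
changed. -/
structure Gossip (C : Type) (p ℓ R : ℕ) (Fact : Type) where
  Priv : Type
  [finPriv : Finite Priv]
  init : Set (Datum C p) → Priv
  rule : Priv → Know R Fact → Know R Fact → Priv × Set Fact
  out : Priv → Know R Fact → Set (Fin ℓ → C)
  alive : Fact
  alive_mem : ∀ q K K', alive ∈ (rule q K K').2

namespace Gossip

variable {C : Type} {p ℓ R : ℕ} {Fact : Type} [Finite Fact] (P : Gossip C p ℓ R Fact)

instance : Finite P.Priv := P.finPriv

/-- The private state and the knowledge after a round. -/
def update (q : P.Priv) (K K' : Know R Fact) : P.Priv × Know R Fact :=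
  ((P.rule q K K').1, fun j => K' j ∪ (P.rule q K K').2)

open scoped Classical in
/-- The automaton executing a gossip protocol. -/
noncomputable def automaton : Automaton C p ℓ where
  Q := P.Priv × Know R Fact
  Msg := Know R Fact
  init := fun d => (P.init d, fun _ => ∅)
  step := fun q I =>
    (P.update q.1 q.2 (q.2.merge I),
      if (P.update q.1 q.2 (q.2.merge I)).2 = q.2 then none
      else some (P.update q.1 q.2 (q.2.merge I)).2)
  out := fun q => P.out q.1 q.2

variable {V : Type} [Fintype V] (N : Network V C p) (r : V)

/-- The private state of a node at the beginning of a round. -/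
noncomputable def priv (t : ℕ) (v : V) : P.Priv := (P.automaton.run N r t v).state.1

/-- The knowledge of a node at the beginning of a round. -/
noncomputable def know (t : ℕ) (v : V) : Know R Fact := (P.automaton.run N r t v).state.2

/-- The knowledge of a node merged with that of its neighbors. -/
def merged (t : ℕ) (v : V) : Know R Fact := fun j =>
  P.know N r t v j ∪
    {f | ∃ u, N.graph.Adj v u ∧ ∃ i : Fin (R + 1), (i : ℕ) + 1 = j ∧ f ∈ P.know N r t u i}

theorem know_zero (v : V) : P.know N r 0 v = fun _ => ∅ := rfl

theorem state_succ_of_awake {t : ℕ} {v : V} (h : (P.automaton.run N r t v).awake) :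
    (P.automaton.run N r (t + 1) v).state = P.update (P.priv N r t v) (P.know N r t v)
      ((P.know N r t v).merge (P.automaton.run N r t v).inbox) := by
  simp only [Automaton.run, Automaton.Loc.after, if_pos h]
  rfl

theorem state_succ_of_not_awake {t : ℕ} {v : V} (h : ¬ (P.automaton.run N r t v).awake) :
    (P.automaton.run N r (t + 1) v).state = (P.automaton.run N r t v).state := by
  simp only [Automaton.run, Automaton.Loc.after, if_neg h]

theorem know_mono_succ (t : ℕ) (v : V) (j : Fin (R + 1)) :
    P.know N r t v j ⊆ P.know N r (t + 1) v j := by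
  by_cases h : (P.automaton.run N r t v).awake
  · intro f hf
    rw [know, P.state_succ_of_awake N r h]
    exact Or.inl (Or.inl hf)
  · rw [know, know, P.state_succ_of_not_awake N r h]

theorem emit_eq (t : ℕ) (v : V) [Decidable (P.know N r (t + 1) v = P.know N r t v)] :
    (P.automaton.run N r t v).emit =
      if P.know N r (t + 1) v = P.know N r t v then none else some (P.know N r (t + 1) v) := by
  by_cases h : (P.automaton.run N r t v).awake
  · have h1 : P.know N r (t + 1) v = (P.update (P.priv N r t v) (P.know N r t v)
      ((P.know N r t v).merge (P.automaton.run N r t v).inbox)).2 := by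
      rw [know, P.state_succ_of_awake N r h]
    simp only [Automaton.Loc.emit, if_pos h, h1]
    simp only [automaton]
    congr
  · have h1 : P.know N r (t + 1) v = P.know N r t v := by
      rw [know, P.state_succ_of_not_awake N r h]; rfl
    rw [if_pos h1, Automaton.Loc.emit, if_neg h]; rfl

theorem mem_inbox_succ {t : ℕ} {v : V} {M : Know R Fact} :
    M ∈ (P.automaton.run N r (t + 1) v).inbox ↔
      ∃ u, N.graph.Adj v u ∧ P.know N r (t + 1) u ≠ P.know N r t u ∧ M = P.know N r (t + 1) u := by
  classical
  have h : M ∈ (P.automaton.run N r (t + 1) v).inbox ↔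
      ∃ u, N.graph.Adj v u ∧ (P.automaton.run N r t u).emit = some M := Iff.rfl
  rw [h]
  refine exists_congr fun u => and_congr_right fun _ => ?_
  rw [P.emit_eq]
  split_ifs with hk
  · exact ⟨fun h => (by cases h), fun h => absurd hk h.1⟩
  · exact ⟨fun h => ⟨hk, (Option.some.inj h).symm⟩, fun h => congrArg some h.2.symm⟩

theorem awake_of_inbox {t : ℕ} {v : V} {M : Know R Fact}
    (h : M ∈ (P.automaton.run N r t v).inbox) : (P.automaton.run N r t v).awake := by
  cases t with
  | zero => exact h.elim
  | succ t =>
    obtain ⟨u, hu, he⟩ := h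
    exact Or.inr ⟨u, M, hu, he⟩

/-- What a neighbor knows is known already or contained in a message that has just arrived. -/
theorem know_adj {t : ℕ} {u v : V} (huv : N.graph.Adj v u) {i j : Fin (R + 1)}
    (hij : (i : ℕ) + 1 = j) {f : Fact} (hf : f ∈ P.know N r t u i) :
    f ∈ P.know N r t v j ∨ ∃ M ∈ (P.automaton.run N r t v).inbox, f ∈ M i := by
  induction t with
  | zero => exact absurd hf (by simp [know_zero])
  | succ t ih =>
    -- If the neighbor was silent in the last round, the fact is older, and by induction it has
    -- already been received and merged.
    by_cases hk : P.know N r (t + 1) u = P.know N r t u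
    · rw [hk] at hf
      left
      rcases ih hf with h | ⟨M, hM, hfM⟩
      · exact P.know_mono_succ N r t v j h
      · rw [know, P.state_succ_of_awake N r (P.awake_of_inbox N r hM)]
        exact Or.inl (Or.inr ⟨M, hM, i, hij, hfM⟩)
    · exact Or.inr ⟨_, (P.mem_inbox_succ N r).2 ⟨u, huv, hk, rfl⟩, hf⟩

/-- Broadcasting only changes loses nothing: the effect is as if each node read the full current
knowledge of its neighbors in every round. -/
theorem merge_inbox (t : ℕ) (v : V) :
    (P.know N r t v).merge (P.automaton.run N r t v).inbox = P.merged N r t v := by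
  funext j
  ext f
  constructor
  · rintro (h | ⟨M, hM, i, hij, hf⟩)
    · exact Or.inl h
    · cases t with
      | zero => exact hM.elim
      | succ t =>
        obtain ⟨u, hu, -, rfl⟩ := (P.mem_inbox_succ N r).1 hM
        exact Or.inr ⟨u, hu, i, hij, hf⟩
  · rintro (h | ⟨u, hu, i, hij, hf⟩)
    · exact Or.inl h
    · rcases P.know_adj N r hu hij hf with h | ⟨M, hM, hfM⟩
      · exact Or.inl h
      · exact Or.inr ⟨M, hM, i, hij, hfM⟩

theorem know_of_not_awake {t : ℕ} {v : V} (h : ¬ (P.automaton.run N r t v).awake) :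
    P.know N r t v = fun _ => ∅ := by
  induction t with
  | zero => rfl
  | succ t ih =>
    have h' : ¬ (P.automaton.run N r t v).awake := fun ha => h (Or.inl ha)
    rw [know, P.state_succ_of_not_awake N r h']
    exact ih h'

theorem alive_mem_know {t : ℕ} {v : V} (h : (P.automaton.run N r t v).awake) (j : Fin (R + 1)) :
    P.alive ∈ P.know N r (t + 1) v j := by
  rw [know, P.state_succ_of_awake N r h]
  exact Or.inr (P.alive_mem _ _ _)

variable {N}

/-- The fact `alive` changes the knowledge of a node in its first active round, so the node
certainly broadcasts then. The request thus spreads as a breadth-first wave of speed one. Both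
claims are proved together, since a change is visible only against empty knowledge. -/
theorem awake_and_know (hN : N.graph.Connected) (t : ℕ) (v : V) :
    ((P.automaton.run N r t v).awake ↔ N.graph.dist r v ≤ t) ∧
      (t ≤ N.graph.dist r v → P.know N r t v = fun _ => ∅) := by
  classical
  induction t generalizing v with
  | zero =>
    rw [Nat.le_zero, hN.dist_eq_zero_iff]
    exact ⟨eq_comm, fun _ => rfl⟩
  | succ t ih =>
    have hs : (P.automaton.run N r (t + 1) v).awake ↔ (P.automaton.run N r t v).awake ∨
      ∃ u m, N.graph.Adj v u ∧ (P.automaton.run N r t u).emit = some m := Iff.rfl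
    rw [hs, (ih v).1]
    refine ⟨⟨?_, ?_⟩, ?_⟩
    · rintro (h | ⟨u, m, hu, he⟩)
      · omega
      · have ha : (P.automaton.run N r t u).awake := by
          by_contra hna
          simp [Automaton.Loc.emit, hna] at he
        rw [(ih u).1] at ha
        have := dist_le_succ hN r hu
        omega
    · intro h
      rcases Nat.lt_or_ge t (N.graph.dist r v) with h1 | h1
      · right
        obtain ⟨u, hu, hd⟩ := exists_adj_dist hN (a := r) (v := v) (n := t) (by omega)
        refine ⟨u, P.know N r (t + 1) u, hu, ?_⟩
        have hne : P.know N r (t + 1) u ≠ P.know N r t u := by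
          intro he
          have := P.alive_mem_know N r ((ih u).1.2 hd.le) 0
          rw [he, (ih u).2 hd.ge] at this
          exact this
        rw [P.emit_eq, if_neg hne]; rfl
      · exact Or.inl h1
    · intro h
      have hna : ¬ (P.automaton.run N r t v).awake := by
        rw [(ih v).1]; omega
      rw [know, P.state_succ_of_not_awake N r hna]
      exact P.know_of_not_awake N r hna

theorem awake_iff (hN : N.graph.Connected) (t : ℕ) (v : V) :
    (P.automaton.run N r t v).awake ↔ N.graph.dist r v ≤ t :=
  (P.awake_and_know r hN t v).1

theorem know_eq_empty (hN : N.graph.Connected) {t : ℕ} {v : V} (h : t ≤ N.graph.dist r v) :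
    P.know N r t v = fun _ => ∅ :=
  (P.awake_and_know r hN t v).2 h

theorem priv_eq_init (hN : N.graph.Connected) {t : ℕ} {v : V} (h : t ≤ N.graph.dist r v) :
    P.priv N r t v = P.init {d | d ∈ N.localData r v} := by
  induction t with
  | zero => rfl
  | succ t ih =>
    rw [priv, P.state_succ_of_not_awake N r (by rw [P.awake_iff r hN]; omega)]
    exact ih (by omega)

theorem priv_succ (hN : N.graph.Connected) {t : ℕ} {v : V} (h : N.graph.dist r v ≤ t) :
    P.priv N r (t + 1) v =
      (P.rule (P.priv N r t v) (P.know N r t v) (P.merged N r t v)).1 := by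
  rw [priv, P.state_succ_of_awake N r ((P.awake_iff r hN t v).2 h), P.merge_inbox]
  rfl

theorem know_succ (hN : N.graph.Connected) {t : ℕ} {v : V} (h : N.graph.dist r v ≤ t)
    (j : Fin (R + 1)) :
    P.know N r (t + 1) v j = P.merged N r t v j ∪
      (P.rule (P.priv N r t v) (P.know N r t v) (P.merged N r t v)).2 := by
  rw [know, P.state_succ_of_awake N r ((P.awake_iff r hN t v).2 h), P.merge_inbox]
  rfl

/-- The facts contributed by a node up to a round. -/
def facts (N : Network V C p) (r : V) (t : ℕ) (v : V) : Set Fact := P.know N r t v 0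

theorem facts_succ (hN : N.graph.Connected) {t : ℕ} {v : V} (h : N.graph.dist r v ≤ t) :
    P.facts N r (t + 1) v = P.facts N r t v ∪
      (P.rule (P.priv N r t v) (P.know N r t v) (P.merged N r t v)).2 := by
  rw [facts, P.know_succ r hN h]
  congr 1
  ext f
  simp [merged, facts]

theorem facts_eq_empty (hN : N.graph.Connected) {t : ℕ} {v : V} (h : t ≤ N.graph.dist r v) :
    P.facts N r t v = ∅ := by
  rw [facts, P.know_eq_empty r hN h]

theorem dist_lt_of_mem_facts (hN : N.graph.Connected) {t : ℕ} {v : V} {f : Fact}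
    (h : f ∈ P.facts N r t v) : N.graph.dist r v < t := by
  by_contra hle
  rw [P.facts_eq_empty r hN (by omega)] at h
  exact h

theorem know_mono {s t : ℕ} (h : s ≤ t) (v : V) (j : Fin (R + 1)) :
    P.know N r s v j ⊆ P.know N r t v j :=
  monotone_nat_of_le_succ (f := fun t => P.know N r t v j) (fun t => P.know_mono_succ N r t v j) h

theorem facts_mono {s t : ℕ} (h : s ≤ t) (v : V) : P.facts N r s v ⊆ P.facts N r t v :=
  P.know_mono r h v 0

theorem facts_subset_know (hN : N.graph.Connected) (t : ℕ) (v : V) (j : Fin (R + 1)) :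
    P.facts N r t v ⊆ P.know N r t v j := by
  induction t with
  | zero => exact fun f hf => hf.elim
  | succ t ih =>
    rcases Nat.lt_or_ge t (N.graph.dist r v) with h | h
    · rw [P.facts_eq_empty r hN (by omega)]
      exact Set.empty_subset _
    · rw [P.facts_succ r hN h, P.know_succ r hN h]
      exact Set.union_subset_union_left _ (ih.trans fun f hf => Or.inl hf)

/-- The facts known from distance at most `j` at time `t`. -/
theorem mem_know_iff (hN : N.graph.Connected) {t : ℕ} {v : V} {j : Fin (R + 1)} {f : Fact} :
    f ∈ P.know N r t v j ↔ ∃ a s, N.graph.dist a v ≤ j ∧ s + N.graph.dist a v ≤ t ∧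
      f ∈ P.facts N r s a := by
  constructor
  · intro hf
    induction t generalizing v j with
    | zero => exact hf.elim
    | succ t ih =>
      rcases Nat.lt_or_ge t (N.graph.dist r v) with h | h
      · rw [P.know_eq_empty r hN (by omega)] at hf
        exact hf.elim
      · rw [P.know_succ r hN h] at hf
        rcases hf with (hf | ⟨u, hu, i, hij, hf⟩) | hf
        · obtain ⟨a, s, h1, h2, h3⟩ := ih hf
          exact ⟨a, s, h1, by omega, h3⟩
        · obtain ⟨a, s, h1, h2, h3⟩ := ih hf
          have := dist_le_succ hN a hu
          exact ⟨a, s, by omega, by omega, h3⟩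
        · refine ⟨v, t + 1, by simp, by simp, ?_⟩
          rw [P.facts_succ r hN h]
          exact Or.inr hf
  · rintro ⟨a, s, h1, h2, h3⟩
    induction t generalizing v j with
    | zero =>
      obtain rfl : s = 0 := by omega
      exact h3.elim
    | succ t ih =>
      cases hd : N.graph.dist a v with
      | zero =>
        rw [hN.dist_eq_zero_iff] at hd
        subst hd
        exact P.facts_subset_know r hN (t + 1) a j (P.facts_mono r (by omega) a h3)
      | succ n =>
        obtain ⟨u, hu, hun⟩ := exists_adj_dist hN hd
        -- The source was awake when it contributed the fact, so by the triangle inequality the wave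
        -- has reached `v` in time for `know_succ` to apply.
        have ha := P.dist_lt_of_mem_facts r hN h3
        have htri := hN.dist_triangle (u := r) (v := a) (w := v)
        rw [P.know_succ r hN (by omega)]
        refine Or.inl (Or.inr ⟨u, hu, ⟨j - 1, by omega⟩, ?_, ih ?_ ?_⟩)
        · simp only; omega
        · simp only; omega
        · omega

/-- Merging precedes the rule, so this layer shows the neighbors' facts of the same moment, without
the delay in `mem_know_iff`. This is why a passed token is noticed at once and never seems to be at
two nodes or at none. -/
theorem mem_merged_one_iff (hN : N.graph.Connected) {t : ℕ} {v : V} {i : Fin (R + 1)}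
    (hi : (i : ℕ) = 1) {f : Fact} :
    f ∈ P.merged N r t v i ↔ ∃ a, (a = v ∨ N.graph.Adj v a) ∧ f ∈ P.facts N r t a := by
  constructor
  · rintro (hf | ⟨u, hu, j, hj, hf⟩)
    · obtain ⟨a, s, h1, h2, h3⟩ := (P.mem_know_iff r hN).1 hf
      refine ⟨a, ?_, P.facts_mono r (by omega) a h3⟩
      rw [hi] at h1
      rcases Nat.le_one_iff_eq_zero_or_eq_one.1 h1 with h | h
      · exact Or.inl (hN.dist_eq_zero_iff.1 h)
      · exact Or.inr (SimpleGraph.dist_eq_one_iff_adj.1 h).symm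
    · obtain rfl : j = 0 := Fin.ext (show (j : ℕ) = 0 by omega)
      exact ⟨u, Or.inr hu, hf⟩
  · rintro ⟨a, rfl | ha, hf⟩
    · exact Or.inl (P.facts_subset_know r hN t a i hf)
    · exact Or.inr ⟨a, ha, 0, by simp [hi], hf⟩

/-- The number of broadcasts of a node is bounded by the number of possible facts. -/
theorem sum_emit_le (N : Network V C p) (s : ℕ) (v : V) :
    ∑ t ∈ Finset.range s, (P.automaton.run N r t v).emit.toList.length ≤
      (R + 1) * Nat.card Fact := by
  classical
  -- The total size of all layers is a potential that grows strictly with every broadcast.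
  have h : ∑ t ∈ Finset.range s, (P.automaton.run N r t v).emit.toList.length ≤
      ∑ j, (P.know N r s v j).ncard := by
    induction s with
    | zero => simp
    | succ s ih =>
      rw [Finset.sum_range_succ, P.emit_eq]
      have hle : ∀ j, (P.know N r s v j).ncard ≤ (P.know N r (s + 1) v j).ncard := fun j =>
        Set.ncard_le_ncard (P.know_mono_succ N r s v j) (Set.toFinite _)
      by_cases hk : P.know N r (s + 1) v = P.know N r s v
      · rw [if_pos hk, hk]
        exact ih
      · rw [if_neg hk]
        obtain ⟨j, hj⟩ := Function.ne_iff.1 hk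
        have hlt : ∑ j, (P.know N r s v j).ncard < ∑ j, (P.know N r (s + 1) v j).ncard := by
          refine Finset.sum_lt_sum (fun j _ => hle j) ⟨j, Finset.mem_univ _, ?_⟩
          exact Set.ncard_lt_ncard ((P.know_mono_succ N r s v j).ssubset_of_ne (Ne.symm hj))
            (Set.toFinite _)
        change _ + 1 ≤ _
        omega
  refine h.trans ((Finset.sum_le_card_nsmul _ _ (Nat.card Fact) fun j _ => ?_).trans (by simp))
  rw [← Set.ncard_univ]
  exact Set.ncard_le_ncard (Set.subset_univ _) (Set.toFinite _)

/-- If no node contributes facts after time `T`, then no messages are sent after time `T + R`. -/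
theorem emit_eq_none (hN : N.graph.Connected) {T : ℕ}
    (hT : ∀ t ≥ T, ∀ a, P.facts N r t a ⊆ P.facts N r T a) {t : ℕ} (ht : T + R ≤ t) (v : V) :
    (P.automaton.run N r t v).emit = none := by
  classical
  suffices h : P.know N r (t + 1) v = P.know N r t v by
    rw [P.emit_eq, if_pos h]; rfl
  funext j
  refine Set.Subset.antisymm ?_ (P.know_mono_succ N r t v j)
  intro f hf
  obtain ⟨a, s, h1, h2, h3⟩ := (P.mem_know_iff r hN).1 hf
  rcases Nat.lt_or_ge T s with h | h
  -- The fact was already there at time `T` and needs at most `R` further rounds to arrive.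
  · exact (P.mem_know_iff r hN).2 ⟨a, T, h1, by omega, hT s h.le a h3⟩
  · exact (P.mem_know_iff r hN).2 ⟨a, s, h1, by omega, h3⟩

/-- The result table never shrinks, so outputs have to be sound at all times and not only at the
end. -/
theorem mem_res_iff (hN : N.graph.Connected) {t : ℕ} {v : V} {y : Fin ℓ → C} :
    y ∈ (P.automaton.run N r t v).res ↔
      ∃ s ≤ t, N.graph.dist r v < s ∧ y ∈ P.out (P.priv N r s v) (P.know N r s v) := by
  induction t with
  | zero => exact ⟨fun h => h.elim, fun ⟨s, h1, h2, _⟩ => by omega⟩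
  | succ t ih =>
    have h : y ∈ (P.automaton.run N r (t + 1) v).res ↔ y ∈ (P.automaton.run N r t v).res ∨
      ((P.automaton.run N r t v).awake ∧
        y ∈ P.out (P.priv N r (t + 1) v) (P.know N r (t + 1) v)) := Iff.rfl
    rw [h, ih, P.awake_iff r hN]
    constructor
    · rintro (⟨s, h1, h2, h3⟩ | ⟨h1, h2⟩)
      · exact ⟨s, by omega, h2, h3⟩
      · exact ⟨t + 1, le_rfl, by omega, h2⟩
    · rintro ⟨s, h1, h2, h3⟩
      rcases Nat.lt_or_ge t s with hs | hs
      · obtain rfl : s = t + 1 := by omega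
        exact Or.inr ⟨by omega, h3⟩
      · exact Or.inl ⟨s, hs, h2, h3⟩

end Gossip

namespace Formula

variable {p a : ℕ}

/-! ### Local formulas -/

/-- Satisfaction with all quantifiers restricted to `dom`. -/
def HoldsIn {U : Type*} (dom : Set U) (E : U → U → Prop) (P : Fin p → U → Prop)
    (I : Set (Fin a → U)) : {m : ℕ} → Formula p a m → (Fin m → U) → Prop
  | _, eq i j, e => e i = e j
  | _, edge i j, e => E (e i) (e j)
  | _, prop Q i, e => P Q (e i)
  | _, fixRel x, e => (fun s => e (x s)) ∈ I
  | _, not φ, e => ¬ HoldsIn dom E P I φ e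
  | _, and φ ψ, e => HoldsIn dom E P I φ e ∧ HoldsIn dom E P I ψ e
  | _, or φ ψ, e => HoldsIn dom E P I φ e ∨ HoldsIn dom E P I ψ e
  | _, ex φ, e => ∃ b ∈ dom, HoldsIn dom E P I φ (Fin.snoc e b)
  | _, all φ, e => ∀ b ∈ dom, HoldsIn dom E P I φ (Fin.snoc e b)

variable {V : Type} {G : SimpleGraph V}

theorem holds_distLE (hG : G.Connected) (P : Fin p → V → Prop) (I : Set (Fin a → V)) (k : ℕ)
    {m : ℕ} (i j : Fin m) (e : Fin m → V) :
    (distLE k i j).Holds G P I e ↔ G.dist (e i) (e j) ≤ k := by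
  induction k generalizing m with
  | zero => simp [distLE, Holds, hG.dist_eq_zero_iff]
  | succ k ih =>
    simp only [distLE, Holds, ih, Fin.snoc_castSucc, Fin.snoc_last]
    constructor
    · rintro (h | ⟨b, hb, h⟩)
      · omega
      · have := dist_le_succ hG (e j) hb
        rw [SimpleGraph.dist_comm, SimpleGraph.dist_comm (u := e j)] at this
        omega
    · intro h
      rcases Nat.lt_or_ge k (G.dist (e i) (e j)) with h1 | h1
      · rw [SimpleGraph.dist_comm] at h h1
        obtain ⟨u, hu, hd⟩ := exists_adj_dist hG (a := e j) (v := e i) (n := k) (by omega)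
        rw [SimpleGraph.dist_comm] at hd
        exact Or.inr ⟨u, hu, hd.le⟩
      · exact Or.inl h1

theorem holds_relativize (hG : G.Connected) (P : Fin p → V → Prop) (I : Set (Fin a → V)) (k : ℕ)
    {m : ℕ} (φ : Formula p a m) (x : Fin m) (e : Fin m → V) :
    (relativize k x φ).Holds G P I e ↔ φ.HoldsIn {b | G.dist (e x) b ≤ k} G.Adj P I e := by
  induction φ with
  | eq i j => rfl
  | edge i j => rfl
  | prop Q i => rfl
  | fixRel y => rfl
  | not φ ih => simp only [relativize, Holds, HoldsIn, ih]
  | and φ ψ ih1 ih2 => simp only [relativize, Holds, HoldsIn, ih1, ih2]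
  | or φ ψ ih1 ih2 => simp only [relativize, Holds, HoldsIn, ih1, ih2]
  | ex φ ih =>
    simp only [relativize, Holds, HoldsIn, ih, holds_distLE hG, Fin.snoc_castSucc, Fin.snoc_last,
      Set.mem_ofPred_eq]
  | all φ ih =>
    simp only [relativize, Holds, HoldsIn, ih, holds_distLE hG, Fin.snoc_castSucc, Fin.snoc_last,
      Set.mem_ofPred_eq, imp_iff_not_or]

theorem holds_localize (hG : G.Connected) (P : Fin p → V → Prop) (I : Set (Fin a → V)) (k : ℕ)
    {ℓ : ℕ} (φ : Formula p a (ℓ + 1)) (e : Fin (ℓ + 1) → V) :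
    (localize k φ).Holds G P I e ↔
      (∀ j, G.dist (e 0) (e j) ≤ k) ∧ φ.HoldsIn {b | G.dist (e 0) b ≤ k} G.Adj P I e := by
  have h : ∀ l : List (Fin ℓ),
      (l.foldr (fun j ψ => and (distLE k 0 j.succ) ψ) (relativize k 0 φ)).Holds G P I e ↔
      (∀ j ∈ l, G.dist (e 0) (e j.succ) ≤ k) ∧
        φ.HoldsIn {b | G.dist (e 0) b ≤ k} G.Adj P I e := by
    intro l
    induction l with
    | nil => simp [holds_relativize hG]
    | cons j l ih => simp [Holds, holds_distLE hG, ih, and_assoc]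
  rw [localize, h]
  refine and_congr_left fun _ => ?_
  rw [Fin.forall_fin_succ]
  simp

/-- Transfer of satisfaction along a map that is injective on the domain. -/
theorem holdsIn_comp {U : Type} {dom : Set V} {E : V → V → Prop} {P : Fin p → V → Prop}
    {I : Set (Fin a → V)} {dom' : Set U} {E' : U → U → Prop} {P' : Fin p → U → Prop}
    {I' : Set (Fin a → U)} (f : V → U) (hdom : f '' dom = dom') (hinj : Set.InjOn f dom)
    (hE : ∀ x ∈ dom, ∀ y ∈ dom, (E x y ↔ E' (f x) (f y)))
    (hP : ∀ Q, ∀ x ∈ dom, (P Q x ↔ P' Q (f x)))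
    (hI : ∀ z : Fin a → V, (∀ i, z i ∈ dom) → (z ∈ I ↔ f ∘ z ∈ I'))
    {m : ℕ} (φ : Formula p a m) (e : Fin m → V) (he : ∀ i, e i ∈ dom) :
    φ.HoldsIn dom E P I e ↔ φ.HoldsIn dom' E' P' I' (f ∘ e) := by
  subst hdom
  have hs : ∀ {m : ℕ} (e : Fin m → V) (b : V), (∀ i, e i ∈ dom) → b ∈ dom →
      ∀ i, (Fin.snoc e b : Fin (m + 1) → V) i ∈ dom := by
    intro m e b he hb i
    refine Fin.lastCases ?_ (fun i => ?_) i
    · simpa using hb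
    · simpa using he i
  induction φ with
  | eq i j => exact ⟨fun h => congrArg f h, fun h => hinj (he i) (he j) h⟩
  | edge i j => exact hE _ (he i) _ (he j)
  | prop Q i => exact hP Q _ (he i)
  | fixRel y => exact hI _ fun s => he _
  | not φ ih => simp only [HoldsIn, ih e he]
  | and φ ψ ih1 ih2 => simp only [HoldsIn, ih1 e he, ih2 e he]
  | or φ ψ ih1 ih2 => simp only [HoldsIn, ih1 e he, ih2 e he]
  | ex φ ih =>
    simp only [HoldsIn, Set.exists_mem_image]
    refine exists_congr fun b => and_congr_right fun hb => ?_
    have h := ih (Fin.snoc e b) (hs e b he hb)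
    rwa [Fin.comp_snoc] at h
  | all φ ih =>
    simp only [HoldsIn, Set.forall_mem_image]
    refine forall_congr' fun b => forall_congr' fun hb => ?_
    have h := ih (Fin.snoc e b) (hs e b he hb)
    rwa [Fin.comp_snoc] at h

/-! ### Stages -/

theorem stage_mono_succ (P : Fin p → V → Prop) (φ : Formula p a a) (i : ℕ) :
    stage G P φ i ⊆ stage G P φ (i + 1) := Set.subset_union_right

theorem stage_mono (P : Fin p → V → Prop) (φ : Formula p a a) : Monotone (stage G P φ) :=
  monotone_nat_of_le_succ (stage_mono_succ P φ)

theorem dist_le_of_mem_stage (hG : G.Connected) (P : Fin p → V → Prop) (k : ℕ) {ℓ : ℕ}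
    (φ : Formula p (ℓ + 1) (ℓ + 1)) {i : ℕ} {e : Fin (ℓ + 1) → V}
    (he : e ∈ stage G P (φ.localize k) i) (j : Fin (ℓ + 1)) : G.dist (e 0) (e j) ≤ k := by
  induction i with
  | zero => exact he.elim
  | succ i ih =>
    rcases he with he | he
    · exact ((holds_localize hG P _ k φ e).1 he).1 j
    · exact ih he

theorem stage_eq_of_stage_succ_eq (P : Fin p → V → Prop) (φ : Formula p a a) {m : ℕ}
    (h : stage G P φ (m + 1) = stage G P φ m) {i : ℕ} (hi : m ≤ i) :
    stage G P φ i = stage G P φ m := by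
  induction i, hi using Nat.le_induction with
  | base => rfl
  | succ i _ ih => rw [stage, ih]; exact h

/-- The stages stabilize once there is no room for new tuples. -/
theorem exists_stage_eq [Finite V] (P : Fin p → V → Prop) (φ : Formula p a a) (B : ℕ)
    (hB : ∀ i, (stage G P φ i).ncard ≤ B) :
    ∃ m ≤ B, ∀ i ≥ m, stage G P φ i = stage G P φ m := by
  by_contra hcon
  have hne : ∀ m ≤ B, stage G P φ (m + 1) ≠ stage G P φ m := fun m hm h =>
    hcon ⟨m, hm, fun i hi => stage_eq_of_stage_succ_eq P φ h hi⟩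
  -- As long as the stages do not stabilize, each step adds a tuple.
  have hgrow : ∀ m ≤ B + 1, m ≤ (stage G P φ m).ncard := by
    intro m hm
    induction m with
    | zero => simp
    | succ m ih =>
      have := Set.ncard_lt_ncard ((stage_mono_succ P φ m).ssubset_of_ne
        (hne m (by omega)).symm) (Set.toFinite _)
      have := ih (by omega)
      omega
  have h1 := hgrow (B + 1) le_rfl
  have h2 := hB (B + 1)
  omega

end Formula

/-! ### Tarry's traversal of a graph by a token -/

open scoped Classical in
/-- The state of a traversal started at `r`: the token is at `x` and has passed along the darts in
`U`; the vertices in `done` have been processed, and `par` gives the vertices from which they were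
first reached. -/
structure Traversal {V : Type} (G : SimpleGraph V) (r x : V) (U : V → V → Prop)
    (par : V → Option V) (done : V → Prop) : Prop where
  adj : ∀ {u w}, U u w → G.Adj u w
  balance : ∀ v, {u | U u v}.ncard + (if v = r then 1 else 0) =
    {w | U v w}.ncard + (if v = x then 1 else 0)
  done_of_out : ∀ {v w}, U v w → done v
  done_of_in : ∀ {u v}, U u v → v ≠ x → done v
  done_root : r ≠ x → done r
  par_root : par r = none
  par_done : ∀ {v}, done v → v ≠ r → ∃ u, par v = some u ∧ U u v
  back : ∀ {v u w}, par v = some u → U v u → G.Adj v w → U v w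
  induct : ∀ Z : V → Prop, Z r → (∀ v u, done v → par v = some u → Z u → Z v) →
    ∀ v, done v → Z v

namespace Traversal

variable {V : Type} {G : SimpleGraph V} {r x : V} {U : V → V → Prop} {par : V → Option V}
  {done : V → Prop}

theorem start (G : SimpleGraph V) (r : V) :
    Traversal G r r (fun _ _ => False) (fun _ => none) (fun _ => False) where
  adj h := h.elim
  balance v := by simp
  done_of_out h := h.elim
  done_of_in h _ := h.elim
  done_root h := (h rfl).elim
  par_root := rfl
  par_done h := h.elim
  back h := by simp at h
  induct _ _ _ _ h := h.elim

/-- The token is at the vertex that has been entered more often than left. -/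
theorem eq_iff (h : Traversal G r x U par done) (v : V) [Decidable (v = r)] :
    v = x ↔ {w | U v w}.ncard < {u | U u v}.ncard + (if v = r then 1 else 0) := by
  classical
  have hb := h.balance v
  by_cases hv : v = x
  · simp only [hv, if_true, true_iff] at hb ⊢
    split_ifs at hb ⊢ <;> omega
  · simp only [hv, if_false, false_iff] at hb ⊢
    split_ifs at hb ⊢ <;> omega

theorem out_empty (h : Traversal G r x U par done) (hx : ¬ done x) (w : V) : ¬ U x w :=
  fun hw => hx (h.done_of_out hw)

/-- When the token is at an unprocessed vertex other than the root, it got there along a single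
dart. -/
theorem exists_unique_in (h : Traversal G r x U par done) (hx : ¬ done x) (hr : x ≠ r) :
    ∃ u, U u x ∧ ∀ u', U u' x → u' = u := by
  have hb := h.balance x
  have h0 : {w | U x w} = ∅ := Set.eq_empty_of_forall_notMem (h.out_empty hx)
  rw [h0] at hb
  simp only [hr, if_false, Set.ncard_empty, if_true, add_zero, zero_add] at hb
  obtain ⟨u, hu⟩ := Set.ncard_eq_one.1 hb
  refine ⟨u, ?_, fun u' hu' => ?_⟩
  · have : u ∈ {u | U u x} := by rw [hu]; rfl
    exact this
  · have : u' ∈ {u | U u x} := hu'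
    rwa [hu] at this

/-- Processing the vertex at which the token is. -/
theorem process (h : Traversal G r x U par done) (hx : ¬ done x) (par' : V → Option V)
    (hpar : ∀ v, v ≠ x → par' v = par v) (hroot : x = r → par' x = none)
    (hin : x ≠ r → ∃ u, par' x = some u ∧ U u x) :
    Traversal G r x U par' (fun v => done v ∨ v = x) where
  adj := h.adj
  balance := h.balance
  done_of_out hv := Or.inl (h.done_of_out hv)
  done_of_in hv hne := Or.inl (h.done_of_in hv hne)
  done_root hr := Or.inl (h.done_root hr)
  par_root := by
    by_cases hr : x = r
    · rw [← hr]; exact hroot hr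
    · rw [hpar r (Ne.symm hr)]; exact h.par_root
  par_done := by
    rintro v hv hr
    by_cases hvx : v = x
    · subst hvx; exact hin hr
    · rw [hpar v hvx]
      exact h.par_done (hv.resolve_right hvx) hr
  back := by
    intro v u w hp hu hw
    by_cases hvx : v = x
    · subst hvx; exact (h.out_empty hx u hu).elim
    · rw [hpar v hvx] at hp
      exact h.back hp hu hw
  induct := by
    intro Z hZ hstep v hv
    have hold : ∀ v, done v → Z v := by
      refine h.induct Z hZ fun v u hd hp hu => hstep v u (Or.inl hd) ?_ hu
      rwa [hpar v (by rintro rfl; exact hx hd)]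
    rcases hv with hv | rfl
    · exact hold v hv
    · by_cases hr : v = r
      · rwa [hr]
      · obtain ⟨u, hp, hu⟩ := hin hr
        exact hstep v u (Or.inr rfl) hp (hold u (h.done_of_out hu))

theorem exists_in (h : Traversal G r x U par done) (hx : x ≠ r) : ∃ u, U u x := by
  by_contra hno
  have h0 : {u | U u x} = ∅ := Set.eq_empty_of_forall_notMem fun u hu => hno ⟨u, hu⟩
  have hb := h.balance x
  rw [h0] at hb
  simp [hx] at hb

variable [Finite V]

theorem no_in_root (h : Traversal G r r U par done) (hr : ¬ done r) (u : V) : ¬ U u r := by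
  have hb := h.balance r
  have h0 : {w | U r w} = ∅ := Set.eq_empty_of_forall_notMem (h.out_empty hr)
  rw [h0] at hb
  simp only [Set.ncard_empty, if_true, zero_add, Nat.add_eq_right] at hb
  rw [Set.ncard_eq_zero] at hb
  intro hu
  have : u ∈ {u | U u r} := hu
  rw [hb] at this
  exact this

theorem ncard_out_move {w : V} (hU : ¬ U x w) (v : V) [Decidable (v = x)] :
    {b | U v b ∨ (v = x ∧ b = w)}.ncard = {b | U v b}.ncard + (if v = x then 1 else 0) := by
  by_cases hv : v = x
  · subst hv
    have : {b | U v b ∨ (v = v ∧ b = w)} = insert w {b | U v b} := by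
      ext u; simp [or_comm]
    rw [this, Set.ncard_insert_of_notMem (s := {b | U v b}) hU, if_pos rfl]
  · simp [hv]

/-- Passing the token along an unused dart; the dart back to the parent comes last. -/
theorem move (h : Traversal G r x U par done) (hx : done x) {w : V} (hw : G.Adj x w)
    (hU : ¬ U x w) (hlast : par x = some w → ∀ w', G.Adj x w' → w' ≠ w → U x w') :
    Traversal G r w (fun a b => U a b ∨ (a = x ∧ b = w)) par done where
  adj := by
    rintro a b (hab | ⟨rfl, rfl⟩)
    · exact h.adj hab
    · exact hw
  balance := by
    classical
    intro v
    have hb := h.balance v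
    have hin : {u | U u v ∨ (u = x ∧ v = w)}.ncard =
        {u | U u v}.ncard + (if v = w then 1 else 0) := by
      by_cases hv : v = w
      · subst hv
        have : {u | U u v ∨ (u = x ∧ v = v)} = insert x {u | U u v} := by
          ext u; simp [or_comm]
        rw [this, Set.ncard_insert_of_notMem (s := {u | U u v}) hU, if_pos rfl]
      · simp [hv]
    rw [hin, ncard_out_move hU]
    omega
  done_of_out := by
    rintro v b (hv | ⟨rfl, -⟩)
    · exact h.done_of_out hv
    · exact hx
  done_of_in := by
    rintro u v (hv | ⟨-, rfl⟩) hne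
    · by_cases hvx : v = x
      · rwa [hvx]
      · exact h.done_of_in hv hvx
    · exact (hne rfl).elim
  done_root hr := by
    by_cases hrx : r = x
    · rwa [hrx]
    · exact h.done_root hrx
  par_root := h.par_root
  par_done hv hr := by
    obtain ⟨u, h1, h2⟩ := h.par_done hv hr
    exact ⟨u, h1, Or.inl h2⟩
  back := by
    rintro v u b hp (hu | ⟨rfl, rfl⟩) hb
    · exact Or.inl (h.back hp hu hb)
    · by_cases hbu : b = u
      · exact Or.inr ⟨rfl, hbu⟩
      · exact Or.inl (hlast hp b hb hbu)
  induct := h.induct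

/-- The token gets stuck only at the root, after all vertices have been processed. -/
theorem stuck (hG : G.Connected) (h : Traversal G r x U par done) (hx : done x)
    (hstuck : ∀ w, G.Adj x w → U x w) :
    x = r ∧ (∀ v, done v) ∧ ∀ v w, G.Adj v w → U v w := by
  have hfull : ∀ v, (∀ w, G.Adj v w → U v w) → {w | U v w} = G.neighborSet v := by
    intro v hv
    ext w
    exact ⟨fun hw => h.adj hw, fun hw => hv w hw⟩
  have hsub : ∀ v, {u | U u v} ⊆ G.neighborSet v := fun v u hu => (h.adj hu).symm
  -- At a vertex other than the root the token has arrived once more than it has left. Having left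
  -- along all darts, it would have arrived along more darts than there are.
  have hxr : x = r := by
    by_contra hne
    have hb := h.balance x
    simp only [hne, if_false, if_true, hfull x hstuck] at hb
    have := Set.ncard_le_ncard (hsub x) (Set.toFinite _)
    omega
  subst hxr
  -- With the token back at the root, arrivals and departures balance at every vertex.
  have hall : ∀ v, (∀ w, G.Adj v w → U v w) → ∀ u, G.Adj v u → U u v := by
    intro v hv u hu
    have hb := h.balance v
    rw [hfull v hv, Nat.add_right_cancel_iff] at hb
    have := Set.eq_of_subset_of_ncard_le (hsub v) hb.ge (Set.toFinite _)
    have hu' : u ∈ G.neighborSet v := hu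
    rw [← this] at hu'
    exact hu'
  -- Induction along parents: if the parent `u` is exhausted, all darts into `u` are used, among
  -- them the one from `v`. That dart comes last at `v`, so `v` is exhausted too.
  have hout : ∀ v, done v → ∀ w, G.Adj v w → U v w := by
    refine h.induct (fun v => ∀ w, G.Adj v w → U v w) hstuck ?_
    intro v u hd hp hu w hw
    have hvx : v ≠ x := by
      rintro rfl
      rw [h.par_root] at hp
      simp at hp
    obtain ⟨u', hp', huv⟩ := h.par_done hd hvx
    rw [hp] at hp'
    obtain rfl := Option.some.inj hp'
    exact h.back hp (hall u hu v (h.adj huv)) hw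
  suffices hdone : ∀ v, done v from ⟨rfl, hdone, fun v => hout v (hdone v)⟩
  intro v
  obtain ⟨p⟩ := hG.preconnected x v
  -- An exhausted vertex has sent the token to all its neighbors, so being processed spreads along
  -- walks.
  have key : ∀ {a b : V} (p : G.Walk a b), done a → done b := by
    intro a b p
    induction p with
    | nil => exact id
    | cons hadj p ih =>
      intro ha
      refine ih ?_
      rename_i a' b' c'
      by_cases hbx : b' = x
      · rw [hbx]; exact hx
      · exact h.done_of_in (hout _ ha _ hadj) hbx
  exact key p hx

theorem ncard_le (h : Traversal G r x U par done) {D : ℕ}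
    (hD : ∀ v, (G.neighborSet v).ncard ≤ D) : ∑ᶠ v, {w | U v w}.ncard ≤ D * Nat.card V := by
  have := Fintype.ofFinite V
  rw [finsum_eq_sum_of_fintype, Nat.card_eq_fintype_card]
  refine (Finset.sum_le_card_nsmul _ _ D fun v _ => ?_).trans (by simp [mul_comm])
  exact (Set.ncard_le_ncard (fun w hw => h.adj hw) (Set.toFinite _)).trans (hD v)

theorem sum_move {w : V} (hU : ¬ U x w) :
    ∑ᶠ v, {b | U v b ∨ (v = x ∧ b = w)}.ncard = ∑ᶠ v, {b | U v b}.ncard + 1 := by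
  classical
  have := Fintype.ofFinite V
  rw [finsum_eq_sum_of_fintype, finsum_eq_sum_of_fintype]
  simp [ncard_out_move hU, Finset.sum_add_distrib]

end Traversal

/-! ### Sizes of neighborhoods -/

theorem ncard_dist_le {V : Type} [Finite V] {G : SimpleGraph V} (hG : G.Connected) {D : ℕ}
    (hD : ∀ v, (G.neighborSet v).ncard ≤ D) (x : V) (n : ℕ) :
    {a | G.dist a x ≤ n}.ncard ≤ (D + 1) ^ n := by
  induction n with
  | zero =>
    have : {a | G.dist a x ≤ 0} = {x} := by
      ext a; simp [hG.dist_eq_zero_iff]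
    rw [this]; simp
  | succ n ih =>
    have hfin : {a | G.dist a x ≤ n}.Finite := Set.toFinite _
    have hsub : {a | G.dist a x ≤ n + 1} ⊆
        ⋃ b ∈ hfin.toFinset, insert b (G.neighborSet b) := by
      intro a ha
      simp only [Set.Finite.mem_toFinset, Set.mem_iUnion]
      rcases Nat.lt_or_ge n (G.dist a x) with h | h
      · have hd : G.dist x a = n + 1 := by
          rw [SimpleGraph.dist_comm]
          exact le_antisymm ha h
        obtain ⟨u, hu, hun⟩ := exists_adj_dist hG hd
        exact ⟨u, by rw [Set.mem_ofPred_eq, SimpleGraph.dist_comm]; exact hun.le,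
          Or.inr hu.symm⟩
      · exact ⟨a, h, Or.inl rfl⟩
    refine (Set.ncard_le_ncard hsub (Set.toFinite _)).trans ?_
    refine (Finset.set_ncard_biUnion_le _ _).trans ?_
    refine (Finset.sum_le_card_nsmul _ _ (D + 1) fun b _ => ?_).trans ?_
    · exact (Set.ncard_insert_le _ _).trans (by have := hD b; omega)
    · rw [← Set.ncard_eq_toFinset_card _ hfin, smul_eq_mul, pow_succ]
      exact Nat.mul_le_mul_right _ ih

/-! ### The protocol -/

/-- The facts exchanged by the nodes; `n + 1` colors serve as names of nodes. -/
inductive Fact (C : Type) (p ℓ n : ℕ) : Type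
  | alive
  /-- the fixpoint computation has started -/
  | go
  /-- a node labeled `c` has passed the token to its neighbor labeled `c'` -/
  | used (c c' : C)
  /-- there is a node of color `x` -/
  | col (x : Fin (n + 1))
  /-- the node of color `x` is labeled `c` -/
  | name (x : Fin (n + 1)) (c : C)
  /-- the node of color `x` has the property `Q` -/
  | prop (x : Fin (n + 1)) (Q : Fin p)
  /-- the nodes of color `x` and `y` are adjacent -/
  | edge (x y : Fin (n + 1))
  /-- the tuple belongs to the fixpoint -/
  | tab (y : Fin (ℓ + 1) → Fin (n + 1))

instance {C : Type} [Finite C] {p ℓ n : ℕ} : Finite (Fact C p ℓ n) := by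
  let f : Unit ⊕ Unit ⊕ (C × C) ⊕ Fin (n + 1) ⊕ (Fin (n + 1) × C) ⊕ (Fin (n + 1) × Fin p) ⊕
      (Fin (n + 1) × Fin (n + 1)) ⊕ (Fin (ℓ + 1) → Fin (n + 1)) → Fact C p ℓ n
    | .inl _ => .alive
    | .inr (.inl _) => .go
    | .inr (.inr (.inl x)) => .used x.1 x.2
    | .inr (.inr (.inr (.inl x))) => .col x
    | .inr (.inr (.inr (.inr (.inl x)))) => .name x.1 x.2
    | .inr (.inr (.inr (.inr (.inr (.inl x))))) => .prop x.1 x.2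
    | .inr (.inr (.inr (.inr (.inr (.inr (.inl x)))))) => .edge x.1 x.2
    | .inr (.inr (.inr (.inr (.inr (.inr (.inr x)))))) => .tab x
  refine Finite.of_surjective f ?_
  rintro (_ | _ | ⟨c, c'⟩ | x | ⟨x, c⟩ | ⟨x, Q⟩ | ⟨x, y⟩ | y)
  · exact ⟨.inl (), rfl⟩
  · exact ⟨.inr (.inl ()), rfl⟩
  · exact ⟨.inr (.inr (.inl (c, c'))), rfl⟩
  · exact ⟨.inr (.inr (.inr (.inl x))), rfl⟩
  · exact ⟨.inr (.inr (.inr (.inr (.inl (x, c))))), rfl⟩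
  · exact ⟨.inr (.inr (.inr (.inr (.inr (.inl (x, Q)))))), rfl⟩
  · exact ⟨.inr (.inr (.inr (.inr (.inr (.inr (.inl (x, y))))))), rfl⟩
  · exact ⟨.inr (.inr (.inr (.inr (.inr (.inr (.inr y)))))), rfl⟩

/-- The private state of a node: its local data, the time for which it has had the token, its color,
the label of the neighbor from which it first got the token, and the clock of the fixpoint
computation. -/
structure Priv (C : Type) (p k n : ℕ) where
  dat : Set (Datum C p)
  timer : Fin (3 * k + 1 + 1)
  color : Option (Fin (n + 1))
  parent : Option C
  clock : Fin (2 * k + 2 + 1)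

instance {C : Type} [Finite C] {p k n : ℕ} : Finite (Priv C p k n) := by
  refine Finite.of_injective
    (β := Set (Datum C p) × Fin (3 * k + 1 + 1) × Option (Fin (n + 1)) × Option C ×
      Fin (2 * k + 2 + 1))
    (fun s => (s.dat, s.timer, s.color, s.parent, s.clock)) ?_
  rintro ⟨⟩ ⟨⟩ h
  simpa using h

namespace Priv

variable {C : Type} [Nonempty C] {p ℓ k n : ℕ} (q : Priv C p k n)
  (K K' : Know (3 * k + 1) (Fact C p ℓ n))

/-- The label of the node. -/
noncomputable def me : C := Classical.epsilon fun c => Datum.self c ∈ q.dat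

/-- The labels of the neighbors from which the token has come. -/
def ins : Set C := {c | Datum.neighbor c ∈ q.dat ∧ Fact.used c q.me ∈ K' ⟨1, by omega⟩}

/-- The labels of the neighbors to which the token has been passed. -/
def outs : Set C := {c | Fact.used q.me c ∈ K 0}

open scoped Classical in
/-- The node has the token. -/
def Holds : Prop :=
  (q.outs K).ncard < (q.ins K').ncard + if Datum.requesting ∈ q.dat then 1 else 0

/-- The node has had the token for long enough to act. -/
def Ready : Prop := k ≠ 0 ∧ q.Holds K K' ∧ q.timer = Fin.last _

-- Counting up to `3 * k + 1` before acting makes every stay of the token last `3 * k + 2` rounds.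
open scoped Classical in
noncomputable def timer' : Fin (3 * k + 1 + 1) :=
  if q.Holds K K' ∧ q.timer ≠ Fin.last _ then q.timer + 1 else 0

-- The parent is fixed together with the color, at the first visit. At that moment the token has
-- come in along one dart only, or along none at the root, so the choice is forced.
open scoped Classical in
noncomputable def parent' : Option C :=
  if q.Ready K K' ∧ q.color = none then
    if h : (q.ins K').Nonempty then some h.some else none
  else q.parent

-- Colors must separate nodes up to distance `3 * k`: a tuple reported by a node of the `k`-ball may
-- reach `2 * k` away from the center and is compared with nodes of the `k`-ball. The extra unit in
-- the radius provides the radius-one layer also when `k = 0`.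
open scoped Classical in
noncomputable def color' : Option (Fin (n + 1)) :=
  if k = 0 then some 0
  else if q.Ready K K' ∧ q.color = none then
    some (Classical.epsilon fun x => Fact.col x ∉ K (Fin.last _))
  else q.color

/-- The labels of the neighbors other than the parent to which the token may be passed. -/
def cand : Set C :=
  {c | Datum.neighbor c ∈ q.dat ∧ c ∉ q.outs K ∧ q.parent' K K' ≠ some c}

open scoped Classical in
/-- The label of the neighbor to which the token is passed next. -/
noncomputable def dest : Option C :=
  if h : (q.cand K K').Nonempty then some h.some
  else if ∃ c, q.parent' K K' = some c ∧ c ∉ q.outs K then q.parent' K K' else none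

/-- The node starts the fixpoint computation. -/
def Starts : Prop :=
  (q.Ready K K' ∧ q.dest K K' = none) ∨ (k = 0 ∧ Datum.requesting ∈ q.dat)

-- Addition in `Fin` wraps around, so the clock has period `2 * k + 3`.
open scoped Classical in
noncomputable def clock' : Fin (2 * k + 2 + 1) :=
  if Fact.go ∈ K 0 then q.clock + 1 else 0

/-- The tuples of the next stage of the fixpoint, as far as they belong to the node. -/
def Evals (φ : Formula p (ℓ + 1) (ℓ + 1)) (y : Fin (ℓ + 1) → Fin (n + 1)) : Prop :=
  Fact.go ∈ K 0 ∧ q.clock = Fin.last _ ∧ q.color = some (y 0) ∧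
    (∀ i, Fact.col (y i) ∈ K ⟨k, by omega⟩) ∧
    φ.HoldsIn {x | Fact.col x ∈ K ⟨k, by omega⟩} (fun x y => Fact.edge x y ∈ K ⟨k, by omega⟩)
      (fun Q x => Fact.prop x Q ∈ K ⟨k, by omega⟩) {y | Fact.tab y ∈ K ⟨k, by omega⟩} y

/-- The new facts. -/
def New (φ : Formula p (ℓ + 1) (ℓ + 1)) : Fact C p ℓ n → Prop
  | .alive => True
  | .go => Fact.go ∈ K' ⟨1, by omega⟩ ∨ q.Starts K K'
  | .used c c' => q.Ready K K' ∧ c = q.me ∧ q.dest K K' = some c'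
  | .col x => q.color' K K' = some x
  | .name x c => q.color' K K' = some x ∧ c = q.me
  | .prop x Q => q.color' K K' = some x ∧ Datum.prop Q ∈ q.dat
  | .edge x y => q.color' K K' = some x ∧ y ≠ x ∧ Fact.col y ∈ K' ⟨1, by omega⟩
  | .tab y => q.Evals K φ y

end Priv

/-- The protocol evaluating the fixpoint of the local formula obtained from `φ`. A token traverses
the network; the node that has it chooses a color that is not used up to distance `3 * k + 1`.
Afterwards the stages of the fixpoint are computed, one in every `2 * k + 3` rounds of a clock that
each node starts when it hears of the end of the traversal. -/
noncomputable def protocol {C : Type} [Finite C] [Nonempty C] {p ℓ : ℕ} (k n : ℕ)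
    (φ : Formula p (ℓ + 1) (ℓ + 1)) : Gossip C p ℓ (3 * k + 1) (Fact C p ℓ n) where
  Priv := Priv C p k n
  init := fun d => ⟨d, 0, none, none, 0⟩
  rule := fun q K K' =>
    (⟨q.dat, q.timer' K K', q.color' K K', q.parent' K K', q.clock' K⟩, {f | q.New K K' φ f})
  out := fun _ K => {y | ∃ z, Fact.tab z ∈ K 0 ∧ ∀ i, Fact.name (z i.succ) (y i) ∈ K ⟨k, by omega⟩}
  alive := .alive
  alive_mem := fun _ _ _ => trivial

/-- Induction over the rounds of a node that wakes up at time `d`. -/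
theorem round_induction (d : ℕ) {Q : ℕ → Prop} (idle : ∀ t ≤ d, Q t)
    (step : ∀ t, d ≤ t → Q t → Q (t + 1)) (t : ℕ) : Q t := by
  induction t with
  | zero => exact idle 0 (Nat.zero_le _)
  | succ t ih =>
    rcases Nat.lt_or_ge t d with h | h
    · exact idle _ h
    · exact step t h ih

/-! ### The rounds of the protocol: local data, colors and the start signal -/

section Analysis

variable {C : Type} [Finite C] [Nonempty C] {p ℓ k n : ℕ} (φ : Formula p (ℓ + 1) (ℓ + 1))
  {V : Type} [Fintype V] (N : Network V C p) (r : V)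

/-- The private state of a node. -/
noncomputable def pv (k n : ℕ) (t : ℕ) (v : V) : Priv C p k n := (protocol k n φ).priv N r t v

/-- The knowledge of a node. -/
noncomputable def kn (k n : ℕ) (t : ℕ) (v : V) : Know (3 * k + 1) (Fact C p ℓ n) :=
  (protocol k n φ).know N r t v

/-- The knowledge of a node merged with that of its neighbors. -/
noncomputable def mg (k n : ℕ) (t : ℕ) (v : V) : Know (3 * k + 1) (Fact C p ℓ n) :=
  (protocol k n φ).merged N r t v

/-- The facts contributed by a node. -/
noncomputable def fa (k n : ℕ) (t : ℕ) (v : V) : Set (Fact C p ℓ n) :=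
  (protocol k n φ).facts N r t v

variable {N}

theorem pv_succ (hN : N.graph.Connected) {t : ℕ} {v : V} (h : N.graph.dist r v ≤ t) :
    pv φ N r k n (t + 1) v = ⟨(pv φ N r k n t v).dat,
      (pv φ N r k n t v).timer' (kn φ N r k n t v) (mg φ N r k n t v),
      (pv φ N r k n t v).color' (kn φ N r k n t v) (mg φ N r k n t v),
      (pv φ N r k n t v).parent' (kn φ N r k n t v) (mg φ N r k n t v),
      (pv φ N r k n t v).clock' (kn φ N r k n t v)⟩ :=
  (protocol k n φ).priv_succ r hN h

theorem pv_init (hN : N.graph.Connected) {t : ℕ} {v : V} (h : t ≤ N.graph.dist r v) :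
    pv φ N r k n t v = ⟨{d | d ∈ N.localData r v}, 0, none, none, 0⟩ :=
  (protocol k n φ).priv_eq_init r hN h

theorem mem_fa_succ (hN : N.graph.Connected) {t : ℕ} {v : V} (h : N.graph.dist r v ≤ t)
    {f : Fact C p ℓ n} : f ∈ fa φ N r k n (t + 1) v ↔ f ∈ fa φ N r k n t v ∨
      (pv φ N r k n t v).New (kn φ N r k n t v) (mg φ N r k n t v) φ f := by
  rw [fa, (protocol k n φ).facts_succ r hN h]
  rfl

theorem notMem_fa (hN : N.graph.Connected) {t : ℕ} {v : V} (h : t ≤ N.graph.dist r v)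
    {f : Fact C p ℓ n} : f ∉ fa φ N r k n t v := by
  rw [fa, (protocol k n φ).facts_eq_empty r hN h]
  exact id

theorem mem_kn_iff (hN : N.graph.Connected) {t : ℕ} {v : V} {j : Fin (3 * k + 1 + 1)}
    {f : Fact C p ℓ n} : f ∈ kn φ N r k n t v j ↔
      ∃ a s, N.graph.dist a v ≤ j ∧ s + N.graph.dist a v ≤ t ∧ f ∈ fa φ N r k n s a :=
  (protocol k n φ).mem_know_iff r hN

theorem mem_mg_iff (hN : N.graph.Connected) {t : ℕ} {v : V} {f : Fact C p ℓ n} :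
    f ∈ mg φ N r k n t v ⟨1, by omega⟩ ↔
      ∃ a, (a = v ∨ N.graph.Adj v a) ∧ f ∈ fa φ N r k n t a :=
  (protocol k n φ).mem_merged_one_iff r hN rfl

theorem fa_mono {s t : ℕ} (h : s ≤ t) (v : V) : fa φ N r k n s v ⊆ fa φ N r k n t v :=
  (protocol k n φ).facts_mono r h v

theorem dist_lt_of_mem_fa (hN : N.graph.Connected) {t : ℕ} {v : V} {f : Fact C p ℓ n}
    (h : f ∈ fa φ N r k n t v) : N.graph.dist r v < t := by
  by_contra hlt
  exact notMem_fa φ r hN (by omega) h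

theorem dat_eq (hN : N.graph.Connected) (t : ℕ) (v : V) :
    (pv φ N r k n t v).dat = {d | d ∈ N.localData r v} := by
  refine round_induction (N.graph.dist r v) (Q := fun t => (pv φ N r k n t v).dat = _) ?_ ?_ t
  · intro t h; rw [pv_init φ r hN h]
  · intro t h ih; rw [pv_succ φ r hN h]; exact ih

theorem self_mem_dat (hN : N.graph.Connected) {t : ℕ} {v : V} {c : C} :
    Datum.self c ∈ (pv φ N r k n t v).dat ↔ c = N.label v := by
  rw [dat_eq φ r hN, Set.mem_ofPred_eq, Network.localData]
  split_ifs <;> simp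

theorem neighbor_mem_dat (hN : N.graph.Connected) {t : ℕ} {v : V} {c : C} :
    Datum.neighbor c ∈ (pv φ N r k n t v).dat ↔ ∃ u, N.graph.Adj v u ∧ N.label u = c := by
  rw [dat_eq φ r hN, Set.mem_ofPred_eq, Network.localData]
  split_ifs <;> simp

theorem prop_mem_dat (hN : N.graph.Connected) {t : ℕ} {v : V} {Q : Fin p} :
    Datum.prop Q ∈ (pv φ N r k n t v).dat ↔ N.prop Q v := by
  rw [dat_eq φ r hN, Set.mem_ofPred_eq, Network.localData]
  split_ifs <;> simp

theorem requesting_mem_dat (hN : N.graph.Connected) {t : ℕ} {v : V} :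
    Datum.requesting ∈ (pv φ N r k n t v).dat ↔ v = r := by
  rw [dat_eq φ r hN, Set.mem_ofPred_eq, Network.localData]
  split_ifs with h <;> simp [h]

theorem me_eq (hN : N.graph.Connected) (t : ℕ) (v : V) :
    (pv φ N r k n t v).me = N.label v := by
  have h := Classical.epsilon_spec (p := fun c => Datum.self c ∈ (pv φ N r k n t v).dat)
    ⟨N.label v, (self_mem_dat φ r hN).2 rfl⟩
  exact (self_mem_dat φ r hN).1 h

/-! #### Colors -/

theorem color_zero (hN : N.graph.Connected) (t : ℕ) (v : V) :
    N.graph.dist r v < t → (pv φ N r 0 n t v).color = some 0 := by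
  refine round_induction (N.graph.dist r v)
    (Q := fun t => N.graph.dist r v < t → (pv φ N r 0 n t v).color = some 0) ?_ ?_ t
  · intro t h h'; omega
  · intro t h _ _
    rw [pv_succ φ r hN h]
    simp [Priv.color']

theorem color_succ (hN : N.graph.Connected) {t : ℕ} {v : V} {x : Fin (n + 1)}
    (h : (pv φ N r k n t v).color = some x) : (pv φ N r k n (t + 1) v).color = some x := by
  rcases Nat.lt_or_ge t (N.graph.dist r v) with hd | hd
  · rw [pv_init φ r hN hd.le] at h
    simp at h
  · by_cases hk : k = 0
    · subst hk
      have h1 : N.graph.dist r v < t := by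
        by_contra hlt
        rw [pv_init φ r hN (by omega)] at h
        simp at h
      rw [color_zero φ r hN t v h1] at h
      rw [color_zero φ r hN (t + 1) v (by omega), h]
    · rw [pv_succ φ r hN hd]
      simp [Priv.color', hk, h]

theorem color_mono (hN : N.graph.Connected) {s t : ℕ} (hst : s ≤ t) {v : V} {x : Fin (n + 1)}
    (h : (pv φ N r k n s v).color = some x) : (pv φ N r k n t v).color = some x := by
  induction t, hst using Nat.le_induction with
  | base => exact h
  | succ t _ ih => exact color_succ φ r hN ih

theorem col_mem_iff (hN : N.graph.Connected) {t : ℕ} {v : V} {x : Fin (n + 1)} :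
    Fact.col x ∈ fa φ N r k n t v ↔ (pv φ N r k n t v).color = some x := by
  refine round_induction (N.graph.dist r v) (Q := fun t =>
    Fact.col x ∈ fa φ N r k n t v ↔ (pv φ N r k n t v).color = some x) ?_ ?_ t
  · intro t h
    simp [pv_init φ r hN h, notMem_fa φ r hN h]
  · intro t h ih
    rw [mem_fa_succ φ r hN h, ih]
    constructor
    · rintro (hc | hc)
      · exact color_succ φ r hN hc
      · rw [pv_succ φ r hN h]; exact hc
    · intro hc
      rw [pv_succ φ r hN h] at hc
      exact Or.inr hc

/-! #### The start of the fixpoint computation -/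

/-- The signal is a wave of speed one from `r`, where it appears one round after `T`. The root may
start again later; this is harmless, as facts are never withdrawn. -/
theorem go_mem_iff (hN : N.graph.Connected) {T : ℕ}
    (hT : (pv φ N r k n T r).Starts (kn φ N r k n T r) (mg φ N r k n T r))
    (hstart : ∀ t v, N.graph.dist r v ≤ t →
      (pv φ N r k n t v).Starts (kn φ N r k n t v) (mg φ N r k n t v) → v = r ∧ T ≤ t)
    (t : ℕ) (v : V) : Fact.go ∈ fa φ N r k n t v ↔ T + N.graph.dist r v < t := by
  induction t generalizing v with
  | zero => simp [notMem_fa φ r hN (Nat.zero_le _)]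
  | succ t ih =>
    rcases Nat.lt_or_ge t (N.graph.dist r v) with h | h
    · simp only [notMem_fa φ r hN h, false_iff]
      omega
    · rw [mem_fa_succ φ r hN h]
      simp only [Priv.New, mem_mg_iff φ r hN, ih]
      constructor
      · rintro (hlt | ⟨a, rfl | ha, hlt⟩ | hs)
        · omega
        · omega
        · have := dist_le_succ hN r ha
          omega
        · obtain ⟨rfl, hle⟩ := hstart t v h hs
          simp only [SimpleGraph.dist_self]
          omega
      · intro hlt
        cases hd : N.graph.dist r v with
        | zero =>
          obtain rfl := hN.dist_eq_zero_iff.1 hd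
          rcases Nat.lt_or_ge T t with h1 | h1
          · exact Or.inl (by omega)
          · obtain rfl : T = t := by omega
            exact Or.inr (Or.inr hT)
        | succ d =>
          obtain ⟨u, hu, hud⟩ := exists_adj_dist hN hd
          exact Or.inr (Or.inl ⟨u, Or.inr hu, by omega⟩)

end Analysis

section Token

variable {C : Type} [Finite C] [Nonempty C] {p ℓ k n : ℕ} (φ : Formula p (ℓ + 1) (ℓ + 1))
  {V : Type} [Fintype V] (N : Network V C p) (r : V)

/-! #### The token -/

/-- Adjacent nodes and nodes with a common neighbor have distinct labels. -/
def Network.NeighborsDistinct {V : Type} {C : Type} {p : ℕ} (N : Network V C p) : Prop :=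
  ∀ v a b, (a = v ∨ N.graph.Adj v a) → (b = v ∨ N.graph.Adj v b) → N.label a = N.label b → a = b

theorem Network.LocallyConsistent.neighborsDistinct {V : Type} {C : Type} {p k : ℕ}
    {N : Network V C p} (h : N.LocallyConsistent k) (hk : k ≠ 0) : N.NeighborsDistinct := by
  have hmem : ∀ v a, (a = v ∨ N.graph.Adj v a) → a ∈ N.nbhd k v := by
    intro v a ha
    have h1 : N.graph.edist v a ≤ 1 := by
      rw [SimpleGraph.edist_le_one_iff_adj_or_eq]
      rcases ha with rfl | ha
      · exact Or.inr rfl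
      · exact Or.inl ha
    exact h1.trans (by exact_mod_cast Nat.one_le_iff_ne_zero.2 hk)
  intro v a b ha hb hab
  by_contra hne
  exact h v a (hmem v a ha) b (hmem v b hb) hne hab

/-- The token has passed from `a` to `b`. -/
def Passed (k n : ℕ) (t : ℕ) (a b : V) : Prop :=
  N.graph.Adj a b ∧ Fact.used (N.label a) (N.label b) ∈ fa φ N r k n t a

/-- The node can act in round `t`. -/
def ReadyAt (k n : ℕ) (t : ℕ) (v : V) : Prop :=
  (pv φ N r k n t v).Ready (kn φ N r k n t v) (mg φ N r k n t v)

/-- The label of the next node for the token. -/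
noncomputable def destAt (k n : ℕ) (t : ℕ) (v : V) : Option C :=
  (pv φ N r k n t v).dest (kn φ N r k n t v) (mg φ N r k n t v)

variable {N}

theorem parent'_label (hN : N.graph.Connected) {t : ℕ} {v : V} {c : C}
    (hpar : ∀ c, (pv φ N r k n t v).parent = some c → ∃ u, N.graph.Adj v u ∧ N.label u = c)
    (h : (pv φ N r k n t v).parent' (kn φ N r k n t v) (mg φ N r k n t v) = some c) :
    ∃ u, N.graph.Adj v u ∧ N.label u = c := by
  rw [Priv.parent'] at h
  split_ifs at h with h1 h2
  · rw [← Option.some.inj h]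
    exact (neighbor_mem_dat φ r hN).1 h2.some_mem.1
  · exact hpar c h

theorem parent_label (hN : N.graph.Connected) {t : ℕ} {v : V} {c : C}
    (h : (pv φ N r k n t v).parent = some c) : ∃ u, N.graph.Adj v u ∧ N.label u = c := by
  revert c
  refine round_induction (N.graph.dist r v) (Q := fun t => ∀ {c : C},
    (pv φ N r k n t v).parent = some c → ∃ u, N.graph.Adj v u ∧ N.label u = c) ?_ ?_ t
  · intro t ht c h
    rw [pv_init φ r hN ht] at h
    simp at h
  · intro t ht ih c h
    rw [pv_succ φ r hN ht] at h
    exact parent'_label φ r hN (fun c => ih) h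

theorem destAt_label (hN : N.graph.Connected) {t : ℕ} {v : V} {c : C}
    (h : destAt φ N r k n t v = some c) : ∃ u, N.graph.Adj v u ∧ N.label u = c := by
  rw [destAt, Priv.dest] at h
  split_ifs at h with h1 h2
  · rw [← Option.some.inj h]
    exact (neighbor_mem_dat φ r hN).1 h1.some_mem.1
  · exact parent'_label φ r hN (fun c => parent_label φ r hN) h

theorem used_mem (hN : N.graph.Connected) {t : ℕ} {v : V} {c c' : C}
    (h : Fact.used c c' ∈ fa φ N r k n t v) :
    c = N.label v ∧ ∃ w, N.graph.Adj v w ∧ N.label w = c' := by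
  revert h
  refine round_induction (N.graph.dist r v) (Q := fun t => Fact.used c c' ∈ fa φ N r k n t v →
    c = N.label v ∧ ∃ w, N.graph.Adj v w ∧ N.label w = c') ?_ ?_ t
  · intro t ht h
    exact (notMem_fa φ r hN ht h).elim
  · intro t ht ih h
    rw [mem_fa_succ φ r hN ht] at h
    rcases h with h | ⟨-, h1, h2⟩
    · exact ih h
    · rw [me_eq φ r hN] at h1
      exact ⟨h1, destAt_label φ r hN h2⟩

theorem outs_eq (hN : N.graph.Connected) (t : ℕ) (v : V) :
    (pv φ N r k n t v).outs (kn φ N r k n t v) = N.label '' {w | Passed φ N r k n t v w} := by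
  ext c
  have h : c ∈ (pv φ N r k n t v).outs (kn φ N r k n t v) ↔
      Fact.used (N.label v) c ∈ fa φ N r k n t v := by
    rw [← me_eq φ r hN (k := k) (n := n) t v]; rfl
  rw [h]
  constructor
  · intro hc
    obtain ⟨-, w, hw, rfl⟩ := used_mem φ r hN hc
    exact ⟨w, ⟨hw, hc⟩, rfl⟩
  · rintro ⟨w, ⟨-, hc⟩, rfl⟩
    exact hc

theorem ins_eq (hN : N.graph.Connected) (hL : N.NeighborsDistinct) (t : ℕ) (v : V) :
    (pv φ N r k n t v).ins (mg φ N r k n t v) = N.label '' {u | Passed φ N r k n t u v} := by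
  ext c
  have h : c ∈ (pv φ N r k n t v).ins (mg φ N r k n t v) ↔
      Datum.neighbor c ∈ (pv φ N r k n t v).dat ∧
      Fact.used c (N.label v) ∈ mg φ N r k n t v ⟨1, by omega⟩ := by
    rw [← me_eq φ r hN (k := k) (n := n) t v]; rfl
  rw [h, neighbor_mem_dat φ r hN, mem_mg_iff φ r hN]
  constructor
  -- The radius-one layer also contains the node's own facts; these do not interfere, since no
  -- neighbor shares its label.
  · rintro ⟨-, a, rfl | ha, hu⟩
    · obtain ⟨-, w, hw, hl⟩ := used_mem φ r hN hu
      exact absurd (hL a w a (Or.inr hw) (Or.inl rfl) hl) hw.ne'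
    · obtain ⟨rfl, -⟩ := used_mem φ r hN hu
      exact ⟨a, ⟨ha.symm, hu⟩, rfl⟩
  · rintro ⟨u, ⟨hadj, hu⟩, rfl⟩
    exact ⟨⟨u, hadj.symm, rfl⟩, u, Or.inr hadj.symm, hu⟩

/-- Labels are injective on a closed neighborhood, so counting labels is counting darts, and the
excess of arrivals over departures singles out the position of the token. -/
theorem holds_iff (hN : N.graph.Connected) (hL : N.NeighborsDistinct) {t : ℕ} {x : V}
    {par : V → Option V} {done : V → Prop}
    (hT : Traversal N.graph r x (Passed φ N r k n t) par done) (v : V) :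
    (pv φ N r k n t v).Holds (kn φ N r k n t v) (mg φ N r k n t v) ↔ v = x := by
  classical
  rw [hT.eq_iff v, Priv.Holds, outs_eq φ r hN, ins_eq φ r hN hL,
    Set.InjOn.ncard_image, Set.InjOn.ncard_image]
  · simp only [requesting_mem_dat φ r hN]
  · intro a ha b hb hab
    exact hL v a b (Or.inr ha.1.symm) (Or.inr hb.1.symm) hab
  · intro a ha b hb hab
    exact hL v a b (Or.inr ha.1) (Or.inr hb.1) hab

theorem color_succ_of_not_ready (hN : N.graph.Connected) (hk : k ≠ 0) {t : ℕ} {v : V}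
    (h : ¬ ReadyAt φ N r k n t v) : (pv φ N r k n (t + 1) v).color = (pv φ N r k n t v).color := by
  rcases Nat.lt_or_ge t (N.graph.dist r v) with hd | hd
  · rw [pv_init φ r hN hd, pv_init φ r hN hd.le]
  · rw [pv_succ φ r hN hd]
    rw [ReadyAt] at h
    simp [Priv.color', hk, h]

theorem parent_succ_of_not_ready (hN : N.graph.Connected) {t : ℕ} {v : V}
    (h : ¬ ReadyAt φ N r k n t v) :
    (pv φ N r k n (t + 1) v).parent = (pv φ N r k n t v).parent := by
  rcases Nat.lt_or_ge t (N.graph.dist r v) with hd | hd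
  · rw [pv_init φ r hN hd, pv_init φ r hN hd.le]
  · rw [pv_succ φ r hN hd]
    rw [ReadyAt] at h
    simp [Priv.parent', h]

theorem passed_succ_iff (hN : N.graph.Connected) {t : ℕ} {a b : V} :
    Passed φ N r k n (t + 1) a b ↔ Passed φ N r k n t a b ∨ (N.graph.Adj a b ∧
      N.graph.dist r a ≤ t ∧ ReadyAt φ N r k n t a ∧ destAt φ N r k n t a = some (N.label b)) := by
  rcases Nat.lt_or_ge t (N.graph.dist r a) with hd | hd
  · simp only [Passed, notMem_fa φ r hN hd, notMem_fa φ r hN hd.le]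
    simp
    omega
  · simp only [Passed, mem_fa_succ φ r hN hd, Priv.New, me_eq φ r hN, true_and, ReadyAt, destAt]
    tauto

/-- The invariant of the traversal by the token, which is at `x`. -/
structure TokenAt (N : Network V C p) (r : V) (k n t : ℕ) (x : V) (par : V → Option V) : Prop where
  trav : Traversal N.graph r x (Passed φ N r k n t) par
    (fun v => (pv φ N r k n t v).color ≠ none)
  parent : ∀ v, (pv φ N r k n t v).parent = (par v).map N.label
  timer : ∀ v, v ≠ x → (pv φ N r k n t v).timer = 0
  timer_le : ((pv φ N r k n t x).timer : ℕ) ≤ t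
  recent : ∀ a, (pv φ N r k n t a).color ≠ none →
    (pv φ N r k n (t - (pv φ N r k n t x).timer) a).color ≠ none
  proper : ∀ a b c, N.graph.dist a b ≤ 3 * k + 1 → (pv φ N r k n t a).color = some c →
    (pv φ N r k n t b).color = some c → a = b
  budget : (∀ s < t, ∀ v, N.graph.dist r v ≤ s → ReadyAt φ N r k n s v →
      destAt φ N r k n s v ≠ none) →
    (3 * k + 2) * (∑ᶠ v, {w | Passed φ N r k n t v w}.ncard) + (pv φ N r k n t x).timer = t

namespace TokenAt

variable {φ r} {t : ℕ} {x : V} {par : V → Option V}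

theorem start (hN : N.graph.Connected) : TokenAt φ N r k n 0 r (fun _ => none) := by
  have hU : Passed φ N r k n 0 = fun _ _ => False := by
    funext a b
    simp [Passed, notMem_fa φ r hN (Nat.zero_le _)]
  have hc : (fun v => (pv φ N r k n 0 v).color ≠ none) = fun _ => False := by
    funext v
    simp [pv_init φ r hN (Nat.zero_le _)]
  refine ⟨?_, ?_, ?_, ?_, ?_, ?_, ?_⟩
  · rw [hU, hc]; exact Traversal.start _ _
  · intro v; rw [pv_init φ r hN (Nat.zero_le _)]; rfl
  · intro v _; rw [pv_init φ r hN (Nat.zero_le _)]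
  · rw [pv_init φ r hN (Nat.zero_le _)]; simp
  · intro a h; rw [pv_init φ r hN (Nat.zero_le _)] at h; simp at h
  · intro a b c _ h; rw [pv_init φ r hN (Nat.zero_le _)] at h; simp at h
  · intro _; rw [hU, pv_init φ r hN (Nat.zero_le _)]; simp

theorem awake (hN : N.graph.Connected) (h : TokenAt φ N r k n t x par) :
    N.graph.dist r x ≤ t := by
  by_cases hx : x = r
  · simp [hx]
  · obtain ⟨u, hu, hf⟩ := h.trav.exists_in hx
    have h1 := dist_lt_of_mem_fa φ r hN hf
    have h2 := dist_le_succ hN r hu.symm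
    omega

theorem eq_of_ready (hN : N.graph.Connected) (hL : N.NeighborsDistinct)
    (h : TokenAt φ N r k n t x par) {v : V} (hv : ReadyAt φ N r k n t v) : v = x :=
  (holds_iff φ r hN hL h.trav v).1 hv.2.1

/-- The traversal after the node that has the token has been processed. -/
theorem processed (hN : N.graph.Connected) (hL : N.NeighborsDistinct)
    (hk : k ≠ 0) (h : TokenAt φ N r k n t x par) (hx : ReadyAt φ N r k n t x) :
    ∃ par' : V → Option V, Traversal N.graph r x (Passed φ N r k n t) par'
      (fun v => (pv φ N r k n (t + 1) v).color ≠ none) ∧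
      (pv φ N r k n (t + 1) x).color ≠ none ∧
      ∀ v, (pv φ N r k n (t + 1) v).parent = (par' v).map N.label := by
  classical
  have haw := h.awake hN
  have hnr : ∀ v, v ≠ x → ¬ ReadyAt φ N r k n t v := fun v hv hr => hv (h.eq_of_ready hN hL hr)
  -- An uncolored holder is visited for the first time: it is processed now. Otherwise colors and
  -- parents stay as they are.
  by_cases hc : (pv φ N r k n t x).color = none
  · have hnd : ¬ (fun v => (pv φ N r k n t v).color ≠ none) x := fun hne => hne hc
    have hcx : (pv φ N r k n (t + 1) x).color ≠ none := by
      rw [pv_succ φ r hN haw]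
      have hx' := hx
      rw [ReadyAt] at hx'
      simp [Priv.color', hk, hc, hx']
    have hdone : (fun v => (pv φ N r k n (t + 1) v).color ≠ none) =
        fun v => (pv φ N r k n t v).color ≠ none ∨ v = x := by
      funext v
      by_cases hv : v = x
      · subst hv; simp [hcx]
      · simp [hv, color_succ_of_not_ready φ r hN hk (hnr v hv)]
    have hpx : (pv φ N r k n (t + 1) x).parent =
        if h : ((pv φ N r k n t x).ins (mg φ N r k n t x)).Nonempty then some h.some else none := by
      rw [pv_succ φ r hN haw]
      have hx' := hx
      rw [ReadyAt] at hx'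
      simp [Priv.parent', hc, hx']
    by_cases hxr : x = r
    · subst hxr
      refine ⟨par, ?_, hcx, ?_⟩
      · rw [hdone]
        exact h.trav.process hnd par (fun _ _ => rfl) (fun _ => h.trav.par_root)
          (fun hne => (hne rfl).elim)
      · intro v
        by_cases hv : v = x
        · subst hv
          rw [hpx, dif_neg, h.trav.par_root]
          · rfl
          · rintro ⟨c, hcin⟩
            rw [ins_eq φ v hN hL] at hcin
            obtain ⟨u, hu, -⟩ := hcin
            exact h.trav.no_in_root hnd u hu
        · rw [parent_succ_of_not_ready φ _ hN (hnr v hv), h.parent]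
    -- The set `ins` is a singleton here, so the label stored as parent is that of `u`.
    · obtain ⟨u, hu, huniq⟩ := h.trav.exists_unique_in hnd hxr
      refine ⟨Function.update par x (some u), ?_, hcx, ?_⟩
      · rw [hdone]
        exact h.trav.process hnd _ (fun v hv => Function.update_of_ne hv _ _)
          (fun hr => (hxr hr).elim) (fun _ => ⟨u, Function.update_self _ _ _, hu⟩)
      · intro v
        by_cases hv : v = x
        · subst hv
          have hne : ((pv φ N r k n t v).ins (mg φ N r k n t v)).Nonempty := by
            rw [ins_eq φ r hN hL]; exact ⟨_, u, hu, rfl⟩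
          have hmem := hne.some_mem
          rw [hpx, dif_pos hne, Function.update_self]
          generalize hne.some = c at hmem
          rw [ins_eq φ r hN hL] at hmem
          obtain ⟨u', hu', rfl⟩ := hmem
          rw [huniq u' hu']; rfl
        · rw [parent_succ_of_not_ready φ _ hN (hnr v hv), h.parent, Function.update_of_ne hv]
  · have hcol : ∀ v, (pv φ N r k n (t + 1) v).color = (pv φ N r k n t v).color := by
      intro v
      by_cases hv : v = x
      · subst hv
        obtain ⟨c, hc'⟩ := Option.ne_none_iff_exists'.1 hc
        rw [hc', color_succ φ r hN hc']
      · exact color_succ_of_not_ready φ r hN hk (hnr v hv)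
    refine ⟨par, ?_, ?_, ?_⟩
    · simp only [hcol]; exact h.trav
    · rw [hcol]; exact hc
    · intro v
      by_cases hv : v = x
      · subst hv
        rw [pv_succ φ r hN haw, ← h.parent]
        simp [Priv.parent', hc]
      · rw [parent_succ_of_not_ready φ _ hN (hnr v hv), h.parent]

theorem all_passed (hN : N.graph.Connected) (hL : N.NeighborsDistinct)
    (hd : destAt φ N r k n t x = none) {w : V} (hw : N.graph.Adj x w) :
    Passed φ N r k n t x w := by
  have hout : N.label w ∈ (pv φ N r k n t x).outs (kn φ N r k n t x) → Passed φ N r k n t x w := by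
    intro hmem
    rw [outs_eq φ r hN] at hmem
    obtain ⟨w', hw', hl⟩ := hmem
    rwa [← hL x w' w (Or.inr hw'.1) (Or.inr hw) hl]
  refine hout ?_
  by_contra hno
  rw [destAt, Priv.dest] at hd
  split_ifs at hd with h1 h2
  · obtain ⟨c, hc, -⟩ := h2
    rw [hc] at hd
    simp at hd
  · by_cases hp : (pv φ N r k n t x).parent' (kn φ N r k n t x) (mg φ N r k n t x) =
      some (N.label w)
    · exact h2 ⟨_, hp, hno⟩
    · exact h1 ⟨N.label w, (neighbor_mem_dat φ r hN).2 ⟨w, hw, rfl⟩, hno, hp⟩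

/-- The parent is chosen only when there is no other candidate, which is Tarry's rule that the dart
to the parent comes last. Distinct labels around `x` turn the chosen label into one unused dart. -/
theorem exists_dest (hN : N.graph.Connected) (hL : N.NeighborsDistinct)
    {par' : V → Option V} {done : V → Prop} (haw : N.graph.dist r x ≤ t)
    (hT : Traversal N.graph r x (Passed φ N r k n t) par' done) (hx : done x)
    (hpar : (pv φ N r k n (t + 1) x).parent = (par' x).map N.label) {c : C}
    (hd : destAt φ N r k n t x = some c) :
    ∃ w, N.graph.Adj x w ∧ N.label w = c ∧ ¬ Passed φ N r k n t x w ∧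
      (par' x = some w → ∀ w', N.graph.Adj x w' → w' ≠ w → Passed φ N r k n t x w') := by
  rw [pv_succ φ r hN haw] at hpar
  simp only at hpar
  rw [destAt, Priv.dest] at hd
  split_ifs at hd with h1 h2
  · obtain ⟨hnb, hno, hp⟩ := h1.some_mem
    rw [Option.some.inj hd] at hnb hno hp
    obtain ⟨w, hw, rfl⟩ := (neighbor_mem_dat φ r hN).1 hnb
    refine ⟨w, hw, rfl, ?_, ?_⟩
    · intro hpass
      rw [outs_eq φ r hN] at hno
      exact hno ⟨w, hpass, rfl⟩
    · intro hpw
      rw [hpar, hpw] at hp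
      exact (hp rfl).elim
  · obtain ⟨c', hc', hno⟩ := h2
    rw [hd] at hc'
    obtain rfl := Option.some.inj hc'
    rw [hpar] at hd
    obtain ⟨w, hw, hwc⟩ := Option.map_eq_some_iff.1 hd
    have hxr : x ≠ r := by
      rintro rfl
      rw [hT.par_root] at hw
      simp at hw
    obtain ⟨u, hu, hux⟩ := hT.par_done hx hxr
    rw [hw] at hu
    obtain rfl := Option.some.inj hu
    have hadj := (hT.adj hux).symm
    refine ⟨w, hadj, hwc, ?_, ?_⟩
    · intro hpass
      rw [outs_eq φ r hN] at hno
      exact hno ⟨w, hpass, hwc⟩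
    · intro _ w' hw' hne
      by_contra hnp
      refine h1 ⟨N.label w', (neighbor_mem_dat φ r hN).2 ⟨w', hw', rfl⟩, ?_, ?_⟩
      · rw [outs_eq φ r hN]
        rintro ⟨w'', hw'', hl⟩
        rw [hL x w'' w' (Or.inr hw''.1) (Or.inr hw') hl] at hw''
        exact hnp hw''
      · rw [hpar, hw]
        intro heq
        exact hne (hL x w w' (Or.inr hadj) (Or.inr hw') (Option.some.inj heq)).symm

theorem stuck (hN : N.graph.Connected) (hL : N.NeighborsDistinct)
    (hk : k ≠ 0) (h : TokenAt φ N r k n t x par) {v : V} (hv : ReadyAt φ N r k n t v)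
    (hd : destAt φ N r k n t v = none) :
    v = r ∧ (∀ a, (pv φ N r k n (t + 1) a).color ≠ none) ∧
      ∀ a b, N.graph.Adj a b → Passed φ N r k n t a b := by
  obtain rfl := h.eq_of_ready hN hL hv
  obtain ⟨par', hT, hx, -⟩ := h.processed hN hL hk hv
  exact hT.stuck hN hx fun w hw => all_passed hN hL hd hw

/-- A newly chosen color is not used in the neighborhood. -/
theorem fresh (hN : N.graph.Connected) {D : ℕ} (hD : ∀ v, (N.graph.neighborSet v).ncard ≤ D)
    (hn : (D + 1) ^ (3 * k + 1) ≤ n) (t : ℕ) (x : V) :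
    Fact.col (Classical.epsilon fun c => Fact.col c ∉ kn φ N r k n t x (Fin.last _)) ∉
      kn φ N r k n t x (Fin.last _) := by
  refine Classical.epsilon_spec (p := fun c => Fact.col c ∉ kn φ N r k n t x (Fin.last _)) ?_
  by_contra hall
  push Not at hall
  -- If all colors were known, those of the ball together with `none` would exhaust the `n + 2`
  -- elements of `Option (Fin (n + 1))`, but the ball has at most `n` nodes.
  have hsub : (Set.univ : Set (Option (Fin (n + 1)))) ⊆
      insert none ((fun a => (pv φ N r k n t a).color) '' {a | N.graph.dist a x ≤ 3 * k + 1}) := by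
    rintro (_ | c) -
    · exact Or.inl rfl
    · obtain ⟨a, s, h1, h2, h3⟩ := (mem_kn_iff φ r hN).1 (hall c)
      refine Or.inr ⟨a, h1, ?_⟩
      exact (col_mem_iff φ r hN).1 (fa_mono φ r (by omega) a h3)
  have h1 := Set.ncard_le_ncard hsub (Set.toFinite _)
  have h2 := (Set.ncard_insert_le none ((fun a => (pv φ N r k n t a).color) ''
    {a | N.graph.dist a x ≤ 3 * k + 1}))
  have h3 := Set.ncard_image_le (f := fun a => (pv φ N r k n t a).color)
    (Set.toFinite {a | N.graph.dist a x ≤ 3 * k + 1})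
  have h4 := ncard_dist_le hN hD x (3 * k + 1)
  rw [Set.ncard_univ, Nat.card_eq_fintype_card, Fintype.card_option, Fintype.card_fin] at h1
  omega

/-- Only the holder can change color. No color has changed while it waited, so it knows every color
in its ball and chooses a different one. -/
theorem proper_succ (hN : N.graph.Connected) (hL : N.NeighborsDistinct)
    (hk : k ≠ 0) {D : ℕ} (hD : ∀ v, (N.graph.neighborSet v).ncard ≤ D)
    (hn : (D + 1) ^ (3 * k + 1) ≤ n) (h : TokenAt φ N r k n t x par)
    (a b : V) (c : Fin (n + 1)) (hab : N.graph.dist a b ≤ 3 * k + 1)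
    (ha : (pv φ N r k n (t + 1) a).color = some c)
    (hb : (pv φ N r k n (t + 1) b).color = some c) : a = b := by
  have hold : ∀ v, v ≠ x → (pv φ N r k n (t + 1) v).color = (pv φ N r k n t v).color :=
    fun v hv => color_succ_of_not_ready φ r hN hk fun hr => hv (h.eq_of_ready hN hL hr)
  by_cases hxc : (pv φ N r k n (t + 1) x).color = (pv φ N r k n t x).color
  · have hall : ∀ v, (pv φ N r k n (t + 1) v).color = (pv φ N r k n t v).color := by
      intro v
      by_cases hv : v = x
      · rw [hv, hxc]
      · exact hold v hv
    rw [hall] at ha hb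
    exact h.proper a b c hab ha hb
  · have hready : ReadyAt φ N r k n t x := by
      by_contra hnr
      exact hxc (color_succ_of_not_ready φ r hN hk hnr)
    have hnone : (pv φ N r k n t x).color = none := by
      by_contra hne
      obtain ⟨c', hc'⟩ := Option.ne_none_iff_exists'.1 hne
      rw [hc', color_succ φ r hN hc'] at hxc
      exact hxc rfl
    have hnew : (pv φ N r k n (t + 1) x).color =
        some (Classical.epsilon fun c => Fact.col c ∉ kn φ N r k n t x (Fin.last _)) := by
      rw [pv_succ φ r hN (h.awake hN)]
      have hx' := hready
      rw [ReadyAt] at hx'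
      simp [Priv.color', hk, hnone, hx']
    have key : ∀ v, v ≠ x → N.graph.dist v x ≤ 3 * k + 1 →
        (pv φ N r k n (t + 1) v).color = some c → (pv φ N r k n (t + 1) x).color ≠ some c := by
      intro v hv hvx hvc hxc'
      rw [hold v hv] at hvc
      rw [hnew] at hxc'
      have hf := fresh (φ := φ) (r := r) hN hD hn t x
      rw [Option.some.inj hxc'] at hf
      -- Time `t - (3 * k + 1)` is when the timer was zero. By `recent` the color of `v` existed
      -- then, and it has since had time to arrive.
      refine hf ((mem_kn_iff φ r hN).2 ⟨v, t - (3 * k + 1), hvx, ?_, ?_⟩)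
      · have h1 := h.timer_le
        rw [hready.2.2] at h1
        simp only [Fin.val_last] at h1
        omega
      · have h1 := h.recent v (by rw [hvc]; simp)
        rw [hready.2.2] at h1
        simp only [Fin.val_last] at h1
        obtain ⟨c', hc'⟩ := Option.ne_none_iff_exists'.1 h1
        rw [col_mem_iff φ r hN, hc', ← hvc]
        exact (color_mono φ r hN (Nat.sub_le _ _) hc').symm
    by_cases hax : a = x
    · by_cases hbx : b = x
      · rw [hax, hbx]
      · subst hax
        exact (key b hbx (by rwa [SimpleGraph.dist_comm]) hb ha).elim
    · by_cases hbx : b = x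
      · subst hbx
        exact (key a hax hab ha hb).elim
      · rw [hold a hax] at ha
        rw [hold b hbx] at hb
        exact h.proper a b c hab ha hb

theorem timer_succ_of_ne (hN : N.graph.Connected) (hL : N.NeighborsDistinct)
    (h : TokenAt φ N r k n t x par) {v : V} (hv : v ≠ x) :
    (pv φ N r k n (t + 1) v).timer = 0 := by
  rcases Nat.lt_or_ge t (N.graph.dist r v) with hd | hd
  · rw [pv_init φ r hN hd]
  · rw [pv_succ φ r hN hd]
    have hh : ¬ (pv φ N r k n t v).Holds (kn φ N r k n t v) (mg φ N r k n t v) := by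
      rw [holds_iff φ r hN hL h.trav]; exact hv
    simp [Priv.timer', hh]

/-- The holder waits, passes the token on, or is stuck. In the last case the invariant persists with
the token staying where it is. -/
theorem succ (hN : N.graph.Connected) (hL : N.NeighborsDistinct) (hk : k ≠ 0)
    {D : ℕ} (hD : ∀ v, (N.graph.neighborSet v).ncard ≤ D)
    (hn : (D + 1) ^ (3 * k + 1) ≤ n) (h : TokenAt φ N r k n t x par) :
    ∃ x' par', TokenAt φ N r k n (t + 1) x' par' := by
  have haw := h.awake hN
  have hholds := (holds_iff φ r hN hL h.trav x).2 rfl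
  have hprop := h.proper_succ hN hL hk hD hn
  have htim : ∀ v, v ≠ x → (pv φ N r k n (t + 1) v).timer = 0 :=
    fun v hv => h.timer_succ_of_ne hN hL hv
  have hnr : ∀ v, v ≠ x → ¬ ReadyAt φ N r k n t v := fun v hv hr => hv (h.eq_of_ready hN hL hr)
  by_cases hready : ReadyAt φ N r k n t x
  · obtain ⟨par', hT, hx, hpar⟩ := h.processed hN hL hk hready
    have htimx : (pv φ N r k n (t + 1) x).timer = 0 := by
      rw [pv_succ φ r hN haw]
      simp [Priv.timer', hready.2.2]
    have htim0 : ∀ v, (pv φ N r k n (t + 1) v).timer = 0 := fun v => by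
      by_cases hv : v = x
      · rw [hv, htimx]
      · exact htim v hv
    cases hd : destAt φ N r k n t x with
    | none =>
      have hU : Passed φ N r k n (t + 1) = Passed φ N r k n t := by
        funext a b
        rw [eq_iff_iff, passed_succ_iff φ r hN]
        refine or_iff_left ?_
        rintro ⟨-, -, h1, h2⟩
        rw [h.eq_of_ready hN hL h1, hd] at h2
        simp at h2
      refine ⟨x, par', ?_, hpar, htim, ?_, ?_, hprop, ?_⟩
      · rw [hU]; exact hT
      · rw [htimx]; simp
      · intro a ha; rw [htimx]; exact ha
      -- The accounting of time is claimed only up to the moment of getting stuck, so nothing is to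
      -- be shown.
      · intro hall
        exact (hall t (by omega) x haw hready hd).elim
    | some c =>
      obtain ⟨w, hw, hwc, hnp, hlast⟩ := exists_dest hN hL haw hT hx (hpar x) hd
      have hU : Passed φ N r k n (t + 1) =
          fun a b => Passed φ N r k n t a b ∨ (a = x ∧ b = w) := by
        funext a b
        rw [eq_iff_iff, passed_succ_iff φ r hN]
        refine or_congr Iff.rfl ⟨?_, ?_⟩
        · rintro ⟨hab, -, h1, h2⟩
          obtain rfl := h.eq_of_ready hN hL h1
          rw [hd] at h2
          refine ⟨rfl, hL a b w (Or.inr hab) (Or.inr hw) ?_⟩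
          rw [hwc]; exact (Option.some.inj h2).symm
        · rintro ⟨rfl, rfl⟩
          exact ⟨hw, haw, hready, by rw [hd, hwc]⟩
      refine ⟨w, par', ?_, hpar, fun v _ => htim0 v, ?_, ?_, hprop, ?_⟩
      · rw [hU]; exact hT.move hx hw hnp hlast
      · rw [htim0]; simp
      · intro a ha; rw [htim0]; exact ha
      · intro hall
        -- The timer value `3 * k + 1` and the round of the move together pay for one more dart.
        have hb := h.budget fun s hs => hall s (by omega)
        rw [hready.2.2] at hb
        rw [htim0, hU, Traversal.sum_move hnp]
        simp only [Fin.val_last, Fin.val_zero] at hb ⊢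
        linarith
  · have hne : (pv φ N r k n t x).timer ≠ Fin.last _ := fun he => hready ⟨hk, hholds, he⟩
    have hnr' : ∀ v, ¬ ReadyAt φ N r k n t v := fun v hv =>
      hready (h.eq_of_ready hN hL hv ▸ hv)
    have hcol : ∀ v, (pv φ N r k n (t + 1) v).color = (pv φ N r k n t v).color :=
      fun v => color_succ_of_not_ready φ r hN hk (hnr' v)
    have htimx : ((pv φ N r k n (t + 1) x).timer : ℕ) = (pv φ N r k n t x).timer + 1 := by
      rw [pv_succ φ r hN haw]
      simp only [Priv.timer', hholds, hne, ne_eq, not_false_eq_true, and_self, if_true]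
      exact Fin.val_add_one_of_lt (Fin.lt_last_iff_ne_last.2 hne)
    have hU : Passed φ N r k n (t + 1) = Passed φ N r k n t := by
      funext a b
      rw [eq_iff_iff, passed_succ_iff φ r hN]
      exact or_iff_left fun hh => hnr' a hh.2.2.1
    refine ⟨x, par, ?_, ?_, htim, ?_, ?_, hprop, ?_⟩
    · simp only [hU, hcol]; exact h.trav
    · intro v; rw [parent_succ_of_not_ready φ r hN (hnr' v), h.parent]
    · rw [htimx]; have := h.timer_le; omega
    · intro a ha
      rw [htimx, Nat.add_sub_add_right]
      rw [hcol] at ha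
      exact h.recent a ha
    · intro hall
      have hb := h.budget fun s hs => hall s (by omega)
      rw [htimx, hU]
      omega

end TokenAt

end Token

section Stages

variable {C : Type} [Finite C] [Nonempty C] {p ℓ k n : ℕ} (φ : Formula p (ℓ + 1) (ℓ + 1))
  {V : Type} [Fintype V] (N : Network V C p) (r : V)

/-! #### The end of the traversal -/

/-- The fixpoint computation starts at `r` at time `T`, when all colors are fixed. -/
structure Started (k n : ℕ) (T : ℕ) (col : V → Fin (n + 1)) : Prop where
  color_eq : ∀ {t v c}, (pv φ N r k n t v).color = some c → c = col v
  color_of_lt : ∀ {t v}, T + N.graph.dist r v < t → (pv φ N r k n t v).color = some (col v)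
  go_iff : ∀ {t v}, Fact.go ∈ fa φ N r k n t v ↔ T + N.graph.dist r v < t
  used_mem : ∀ {t v c c'}, Fact.used c c' ∈ fa φ N r k n t v →
    Fact.used c c' ∈ fa φ N r k n T v
  distinct : ∀ {a b}, N.graph.dist a b ≤ 3 * k → col a = col b → a = b

variable {N}

/-- Labels of adjacent nodes may coincide when `k = 0`, so no token can be used. None is needed:
each neighborhood is a single node, and one color separates its elements. -/
theorem started_zero (hN : N.graph.Connected) : Started φ N r 0 n 0 (fun _ => 0) := by
  have hnr : ∀ t v, ¬ (pv φ N r 0 n t v).Ready (kn φ N r 0 n t v) (mg φ N r 0 n t v) :=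
    fun t v h => h.1 rfl
  refine ⟨?_, ?_, ?_, ?_, ?_⟩
  · intro t v c h
    rcases Nat.lt_or_ge (N.graph.dist r v) t with hd | hd
    · rw [color_zero φ r hN t v hd] at h
      exact (Option.some.inj h).symm
    · rw [pv_init φ r hN hd] at h
      simp at h
  · intro t v h
    exact color_zero φ r hN t v (by omega)
  · intro t v
    refine go_mem_iff φ r hN (Or.inr ⟨rfl, (requesting_mem_dat φ r hN).2 rfl⟩) ?_ t v
    rintro t v - (⟨h, -⟩ | ⟨-, h⟩)
    · exact (hnr t v h).elim
    · exact ⟨(requesting_mem_dat φ r hN).1 h, Nat.zero_le _⟩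
  · intro t v c c'
    refine round_induction (N.graph.dist r v) (Q := fun t => Fact.used c c' ∈ fa φ N r 0 n t v → _)
      ?_ ?_ t
    · intro t ht h
      exact (notMem_fa φ r hN ht h).elim
    · intro t ht ih h
      rw [mem_fa_succ φ r hN ht] at h
      rcases h with h | ⟨h, -⟩
      · exact ih h
      · exact (hnr t v h).elim
  · intro a b h _
    exact hN.dist_eq_zero_iff.1 (by omega)

/-- Each move costs `3 * k + 2` rounds and uses a new dart, so the token gets stuck in linear time;
at that point all nodes are colored and all darts are used. -/
theorem exists_started_of_ne_zero (hN : N.graph.Connected) (hL : N.NeighborsDistinct) (hk : k ≠ 0)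
    {D : ℕ} (hD : ∀ v, (N.graph.neighborSet v).ncard ≤ D) (hn : (D + 1) ^ (3 * k + 1) ≤ n) :
    ∃ T ≤ (3 * k + 2) * (D * Fintype.card V + 1), ∃ col, Started φ N r k n T col := by
  classical
  have hinv : ∀ t, ∃ x par, TokenAt φ N r k n t x par := by
    intro t
    induction t with
    | zero => exact ⟨r, _, TokenAt.start hN⟩
    | succ t ih =>
      obtain ⟨x, par, h⟩ := ih
      exact h.succ hN hL hk hD hn
  have hbound : ∃ s ≤ (3 * k + 2) * (D * Fintype.card V + 1), ∃ v, N.graph.dist r v ≤ s ∧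
      ReadyAt φ N r k n s v ∧ destAt φ N r k n s v = none := by
    -- Otherwise the budget would account for all these rounds by at most `D * |V|` moves and one
    -- incomplete stay.
    by_contra hno
    push Not at hno
    obtain ⟨x, par, h⟩ := hinv ((3 * k + 2) * (D * Fintype.card V + 1))
    have hb := h.budget fun s hs v h1 h2 => hno s hs.le v h1 h2
    have h1 := h.trav.ncard_le hD
    rw [Nat.card_eq_fintype_card] at h1
    have h2 := (pv φ N r k n ((3 * k + 2) * (D * Fintype.card V + 1)) x).timer.2
    have h3 := Nat.mul_le_mul_left (3 * k + 2) h1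
    have h4 := Nat.mul_add (3 * k + 2) (D * Fintype.card V) 1
    omega
  obtain ⟨s, hs, hv⟩ := hbound
  have hex : ∃ s, ∃ v, N.graph.dist r v ≤ s ∧ ReadyAt φ N r k n s v ∧
      destAt φ N r k n s v = none := ⟨s, hv⟩
  -- The first such moment is taken, as `go_mem_iff` requires that no start precedes `T`.
  have hT := Nat.find_spec hex
  have hmin : ∀ {t v}, N.graph.dist r v ≤ t → ReadyAt φ N r k n t v →
      destAt φ N r k n t v = none → Nat.find hex ≤ t :=
    fun h1 h2 h3 => Nat.find_min' hex ⟨_, h1, h2, h3⟩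
  have hle : Nat.find hex ≤ (3 * k + 2) * (D * Fintype.card V + 1) :=
    (Nat.find_min' hex hv).trans hs
  generalize Nat.find hex = T at hT hmin hle
  obtain ⟨v, haw, hready, hdest⟩ := hT
  obtain ⟨x, par, h⟩ := hinv T
  obtain ⟨rfl, hcol, hpass⟩ := h.stuck hN hL hk hready hdest
  choose col hcol using fun a => Option.ne_none_iff_exists'.1 (hcol a)
  refine ⟨T, hle, col, ?_, ?_, ?_, ?_, ?_⟩
  · intro t a c hc
    rcases le_total t (T + 1) with hle | hle
    · have h1 := color_mono φ v hN hle hc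
      rw [hcol] at h1
      exact (Option.some.inj h1).symm
    · have h1 := color_mono φ v hN hle (hcol a)
      rw [hc] at h1
      exact Option.some.inj h1
  · intro t a ht
    exact color_mono φ v hN (by omega) (hcol a)
  · intro t a
    refine go_mem_iff φ v hN (Or.inl ⟨hready, hdest⟩) ?_ t a
    rintro t a ha (⟨h1, h2⟩ | ⟨h1, -⟩)
    · obtain ⟨x, par, h⟩ := hinv t
      exact ⟨(h.stuck hN hL hk h1 h2).1, hmin ha h1 h2⟩
    · exact (hk h1).elim
  · intro t a c c' hu
    obtain ⟨rfl, w, hw, rfl⟩ := used_mem φ v hN hu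
    exact (hpass a w hw).2
  · intro a b hab hc
    obtain ⟨x, par, h⟩ := hinv (T + 1)
    exact h.proper a b (col a) (by omega) (hcol a) (by rw [hcol, hc])

namespace Started

variable {φ r} {T : ℕ} {col : V → Fin (n + 1)}

/-! #### Facts about the structure of the network -/

theorem clock_eq (hN : N.graph.Connected) (h : Started φ N r k n T col) (t : ℕ) (v : V) :
    ((pv φ N r k n t v).clock : ℕ) = (t - (T + N.graph.dist r v + 1)) % (2 * k + 3) := by
  refine round_induction (N.graph.dist r v) (Q := fun t => ((pv φ N r k n t v).clock : ℕ) =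
    (t - (T + N.graph.dist r v + 1)) % (2 * k + 3)) ?_ ?_ t
  · intro t ht
    rw [pv_init φ r hN ht, Nat.sub_eq_zero_of_le (by omega)]
    simp
  · intro t ht ih
    rw [pv_succ φ r hN ht]
    have hgo : Fact.go ∈ kn φ N r k n t v 0 ↔ T + N.graph.dist r v < t := h.go_iff
    simp only [Priv.clock', hgo]
    split_ifs with hlt
    · have : t + 1 - (T + N.graph.dist r v + 1) = t - (T + N.graph.dist r v + 1) + 1 := by omega
      rw [this, Fin.val_add, ih, Nat.add_mod (t - (T + N.graph.dist r v + 1))]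
      simp
    · rw [Nat.sub_eq_zero_of_le (by omega)]
      simp

theorem name_mem_iff (hN : N.graph.Connected) {t : ℕ} {v : V} {x : Fin (n + 1)} {c : C} :
    Fact.name x c ∈ fa φ N r k n t v ↔
      (pv φ N r k n t v).color = some x ∧ c = N.label v := by
  refine round_induction (N.graph.dist r v) (Q := fun t => Fact.name x c ∈ fa φ N r k n t v ↔
      (pv φ N r k n t v).color = some x ∧ c = N.label v) ?_ ?_ t
  · intro t ht
    simp [pv_init φ r hN ht, notMem_fa φ r hN ht]
  · intro t ht ih
    rw [mem_fa_succ φ r hN ht, ih]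
    simp only [Priv.New, me_eq φ r hN]
    constructor
    · rintro (⟨h1, h2⟩ | ⟨h1, h2⟩)
      · exact ⟨color_succ φ r hN h1, h2⟩
      · rw [pv_succ φ r hN ht]; exact ⟨h1, h2⟩
    · rintro ⟨h1, h2⟩
      rw [pv_succ φ r hN ht] at h1
      exact Or.inr ⟨h1, h2⟩

theorem prop_mem_iff (hN : N.graph.Connected) {t : ℕ} {v : V} {x : Fin (n + 1)} {Q : Fin p} :
    Fact.prop x Q ∈ fa φ N r k n t v ↔
      (pv φ N r k n t v).color = some x ∧ N.prop Q v := by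
  refine round_induction (N.graph.dist r v) (Q := fun t => Fact.prop x Q ∈ fa φ N r k n t v ↔
      (pv φ N r k n t v).color = some x ∧ N.prop Q v) ?_ ?_ t
  · intro t ht
    simp [pv_init φ r hN ht, notMem_fa φ r hN ht]
  · intro t ht ih
    rw [mem_fa_succ φ r hN ht, ih]
    simp only [Priv.New, prop_mem_dat φ r hN]
    constructor
    · rintro (⟨h1, h2⟩ | ⟨h1, h2⟩)
      · exact ⟨color_succ φ r hN h1, h2⟩
      · rw [pv_succ φ r hN ht]; exact ⟨h1, h2⟩
    · rintro ⟨h1, h2⟩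
      rw [pv_succ φ r hN ht] at h1
      exact Or.inr ⟨h1, h2⟩

theorem edge_mem (hN : N.graph.Connected) (h : Started φ N r k n T col) {t : ℕ} {v : V}
    {x y : Fin (n + 1)} (hf : Fact.edge x y ∈ fa φ N r k n t v) :
    x = col v ∧ y ≠ x ∧ ∃ u, N.graph.Adj v u ∧ y = col u := by
  revert hf
  refine round_induction (N.graph.dist r v) (Q := fun t => Fact.edge x y ∈ fa φ N r k n t v →
    x = col v ∧ y ≠ x ∧ ∃ u, N.graph.Adj v u ∧ y = col u) ?_ ?_ t
  · intro t ht hf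
    exact (notMem_fa φ r hN ht hf).elim
  · intro t ht ih hf
    rw [mem_fa_succ φ r hN ht] at hf
    rcases hf with hf | ⟨h1, h2, h3⟩
    · exact ih hf
    · have hx : x = col v := h.color_eq (t := t + 1) (by rw [pv_succ φ r hN ht]; exact h1)
      refine ⟨hx, h2, ?_⟩
      obtain ⟨a, ha, hc⟩ := (mem_mg_iff φ r hN).1 h3
      have hy := h.color_eq ((col_mem_iff φ r hN).1 hc)
      rcases ha with rfl | ha
      · exact (h2 (by rw [hx, hy])).elim
      · exact ⟨a, ha, hy⟩

/-- The neighbor may be one step farther from `r`; it surely has its color at time `T + dist r v +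
2`, and the edge is recorded one round later. -/
theorem mem_edge (hN : N.graph.Connected) (h : Started φ N r k n T col) {t : ℕ} {v u : V}
    (hvu : N.graph.Adj v u) (hne : col u ≠ col v) (ht : T + N.graph.dist r v + 2 < t) :
    Fact.edge (col v) (col u) ∈ fa φ N r k n t v := by
  obtain ⟨t, rfl⟩ : ∃ s, t = s + 1 := ⟨t - 1, by omega⟩
  rw [mem_fa_succ φ r hN (by omega)]
  refine Or.inr ⟨?_, hne, (mem_mg_iff φ r hN).2 ⟨u, Or.inr hvu, (col_mem_iff φ r hN).2 ?_⟩⟩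
  · have := h.color_of_lt (t := t + 1) (v := v) (by omega)
    rwa [pv_succ φ r hN (by omega)] at this
  · have := dist_le_succ hN r hvu.symm
    exact h.color_of_lt (by omega)

/-! #### The neighborhood as seen by a node -/

section View

variable {t : ℕ} {v : V}

/-- The bound on `t` serves all facts about the `k`-ball: a node there may hear the signal `k`
rounds after `v`, its edges take three rounds, and the way back takes at most `k`. -/
theorem col_mem_kn_iff (hN : N.graph.Connected) (h : Started φ N r k n T col)
    (ht : T + N.graph.dist r v + 2 * k + 3 ≤ t) {x : Fin (n + 1)} :
    Fact.col x ∈ kn φ N r k n t v ⟨k, by omega⟩ ↔ ∃ a, N.graph.dist a v ≤ k ∧ x = col a := by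
  rw [mem_kn_iff φ r hN]
  constructor
  · rintro ⟨a, s, h1, -, h3⟩
    exact ⟨a, h1, h.color_eq ((col_mem_iff φ r hN).1 h3)⟩
  · rintro ⟨a, ha, rfl⟩
    have htri := hN.dist_triangle (u := r) (v := v) (w := a)
    rw [SimpleGraph.dist_comm (u := v)] at htri
    exact ⟨a, t - N.graph.dist a v, ha, by omega,
      (col_mem_iff φ r hN).2 (h.color_of_lt (by omega))⟩

theorem name_mem_kn (hN : N.graph.Connected) (h : Started φ N r k n T col)
    {x : Fin (n + 1)} {c : C} (hx : Fact.name x c ∈ kn φ N r k n t v ⟨k, by omega⟩) :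
    ∃ a, N.graph.dist a v ≤ k ∧ x = col a ∧ c = N.label a := by
  obtain ⟨a, s, h1, -, h3⟩ := (mem_kn_iff φ r hN).1 hx
  obtain ⟨h4, h5⟩ := (name_mem_iff hN).1 h3
  exact ⟨a, h1, h.color_eq h4, h5⟩

theorem mem_kn_name (hN : N.graph.Connected) (h : Started φ N r k n T col)
    (ht : T + N.graph.dist r v + 2 * k + 3 ≤ t) {a : V} (ha : N.graph.dist a v ≤ k) :
    Fact.name (col a) (N.label a) ∈ kn φ N r k n t v ⟨k, by omega⟩ := by
  have htri := hN.dist_triangle (u := r) (v := v) (w := a)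
  rw [SimpleGraph.dist_comm (u := v)] at htri
  exact (mem_kn_iff φ r hN).2 ⟨a, t - N.graph.dist a v, ha, by omega,
    (name_mem_iff hN).2 ⟨h.color_of_lt (by omega), rfl⟩⟩

theorem eq_of_col_eq (hN : N.graph.Connected) (h : Started φ N r k n T col) {a b : V}
    (ha : N.graph.dist a v ≤ k) (hb : N.graph.dist b v ≤ k) (hab : col a = col b) : a = b := by
  have htri := hN.dist_triangle (u := a) (v := v) (w := b)
  rw [SimpleGraph.dist_comm (u := v)] at htri
  exact h.distinct (by omega) hab

theorem prop_mem_kn_iff (hN : N.graph.Connected) (h : Started φ N r k n T col)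
    (ht : T + N.graph.dist r v + 2 * k + 3 ≤ t) {a : V} (ha : N.graph.dist a v ≤ k) {Q : Fin p} :
    Fact.prop (col a) Q ∈ kn φ N r k n t v ⟨k, by omega⟩ ↔ N.prop Q a := by
  rw [mem_kn_iff φ r hN]
  constructor
  · rintro ⟨b, s, h1, -, h3⟩
    obtain ⟨h4, h5⟩ := (prop_mem_iff hN).1 h3
    rwa [h.eq_of_col_eq hN ha h1 (h.color_eq h4)]
  · intro hQ
    have htri := hN.dist_triangle (u := r) (v := v) (w := a)
    rw [SimpleGraph.dist_comm (u := v)] at htri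
    exact ⟨a, t - N.graph.dist a v, ha, by omega,
      (prop_mem_iff hN).2 ⟨h.color_of_lt (by omega), hQ⟩⟩

theorem edge_mem_kn_iff (hN : N.graph.Connected) (h : Started φ N r k n T col)
    (ht : T + N.graph.dist r v + 2 * k + 3 ≤ t) {a b : V} (ha : N.graph.dist a v ≤ k)
    (hb : N.graph.dist b v ≤ k) :
    Fact.edge (col a) (col b) ∈ kn φ N r k n t v ⟨k, by omega⟩ ↔ N.graph.Adj a b := by
  rw [mem_kn_iff φ r hN]
  constructor
  · rintro ⟨a', s, h1, -, h3⟩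
    obtain ⟨h4, h5, u, hu, h6⟩ := h.edge_mem hN h3
    obtain rfl := h.eq_of_col_eq hN ha h1 h4
    suffices hub : u = b by rwa [← hub]
    refine h.distinct ?_ h6.symm
    -- The nodes `u` and `b` are at distance at most `2 * k + 1`, which is within `3 * k` only for
    -- `k ≠ 0`; for `k = 0` there are no edges between different colors.
    have hk : k ≠ 0 := by
      rintro rfl
      have e1 := hN.dist_eq_zero_iff.1 (Nat.le_zero.1 ha)
      have e2 := hN.dist_eq_zero_iff.1 (Nat.le_zero.1 hb)
      rw [e1, e2] at h5
      exact h5 rfl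
    have h7 := dist_le_succ hN v hu.symm
    have h8 := hN.dist_triangle (u := u) (v := v) (w := b)
    rw [SimpleGraph.dist_comm (u := v) (v := b), SimpleGraph.dist_comm (u := u) (v := v)] at h8
    rw [SimpleGraph.dist_comm (u := v) (v := a)] at h7
    have h1' : N.graph.dist a v ≤ k := ha
    omega
  · intro hab
    have htri := hN.dist_triangle (u := r) (v := v) (w := a)
    rw [SimpleGraph.dist_comm (u := v)] at htri
    refine ⟨a, t - N.graph.dist a v, ha, by omega, h.mem_edge hN hab ?_ (by omega)⟩
    intro hc
    exact hab.ne' (h.eq_of_col_eq hN hb ha hc)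

/-- A node evaluates the formula correctly once it knows the current stage. -/
theorem evals_iff (hN : N.graph.Connected) (h : Started φ N r k n T col)
    (ht : T + N.graph.dist r v + 2 * k + 3 ≤ t)
    (hclock : (pv φ N r k n t v).clock = Fin.last _) {i : ℕ}
    (htab : ∀ y, Fact.tab y ∈ kn φ N r k n t v ⟨k, by omega⟩ ↔
      ∃ e ∈ (φ.localize k).stage N.graph N.prop i, N.graph.dist (e 0) v ≤ k ∧ y = col ∘ e)
    (y : Fin (ℓ + 1) → Fin (n + 1)) :
    (pv φ N r k n t v).Evals (kn φ N r k n t v) φ y ↔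
      ∃ e, (φ.localize k).Holds N.graph N.prop ((φ.localize k).stage N.graph N.prop i) e ∧
        e 0 = v ∧ y = col ∘ e := by
  have hgo : Fact.go ∈ kn φ N r k n t v 0 := h.go_iff.2 (by omega)
  have hcolor := h.color_of_lt (t := t) (v := v) (by omega)
  have htrans : ∀ e : Fin (ℓ + 1) → V, (∀ j, N.graph.dist v (e j) ≤ k) →
      (φ.HoldsIn {b | N.graph.dist v b ≤ k} N.graph.Adj N.prop
        ((φ.localize k).stage N.graph N.prop i) e ↔
      φ.HoldsIn {x | Fact.col x ∈ kn φ N r k n t v ⟨k, by omega⟩}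
        (fun x y => Fact.edge x y ∈ kn φ N r k n t v ⟨k, by omega⟩)
        (fun Q x => Fact.prop x Q ∈ kn φ N r k n t v ⟨k, by omega⟩)
        {y | Fact.tab y ∈ kn φ N r k n t v ⟨k, by omega⟩} (col ∘ e)) := by
    intro e he
    have hcm : ∀ {a}, a ∈ {b | N.graph.dist v b ≤ k} → N.graph.dist a v ≤ k := by
      intro a ha
      rw [SimpleGraph.dist_comm]; exact ha
    refine Formula.holdsIn_comp col ?_ ?_ ?_ ?_ ?_ φ e he
    · ext x
      rw [Set.mem_ofPred_eq, h.col_mem_kn_iff hN ht]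
      constructor
      · rintro ⟨a, ha, rfl⟩
        exact ⟨a, hcm ha, rfl⟩
      · rintro ⟨a, ha, rfl⟩
        exact ⟨a, by rw [Set.mem_ofPred_eq, SimpleGraph.dist_comm]; exact ha, rfl⟩
    · intro a ha b hb hab
      exact h.eq_of_col_eq hN (hcm ha) (hcm hb) hab
    · intro a ha b hb
      exact (h.edge_mem_kn_iff hN ht (hcm ha) (hcm hb)).symm
    · intro Q a ha
      exact (h.prop_mem_kn_iff hN ht (hcm ha)).symm
    · intro z hz
      rw [Set.mem_ofPred_eq, htab]
      constructor
      · intro hzi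
        exact ⟨z, hzi, hcm (hz 0), rfl⟩
      · rintro ⟨e', he', h0, heq⟩
        suffices hze : z = e' by rwa [hze]
        have hz0 : z 0 = e' 0 := h.eq_of_col_eq hN (hcm (hz 0)) h0 (congrFun heq 0)
        funext j
        -- The two entries are within `3 * k`: from `z j` to `v`, from `v` to the common first node,
        -- and from there to `e' j`. This comparison determines how far colors must be distinct.
        refine h.distinct ?_ (congrFun heq j)
        have d1 := Formula.dist_le_of_mem_stage hN N.prop k φ he' j
        rw [← hz0] at d1
        have d2 := hN.dist_triangle (u := z j) (v := v) (w := e' j)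
        have d3 := hN.dist_triangle (u := v) (v := z 0) (w := e' j)
        have d4 : N.graph.dist v (z 0) ≤ k := hz 0
        have d5 := hcm (hz j)
        omega
  constructor
  · rintro ⟨-, -, hy0, hycol, hhold⟩
    have hex : ∀ j, ∃ a, N.graph.dist a v ≤ k ∧ y j = col a := fun j =>
      (h.col_mem_kn_iff hN ht).1 (hycol j)
    choose e he hye using hex
    obtain rfl : y = col ∘ e := funext hye
    have he0 : e 0 = v := by
      rw [hcolor] at hy0
      exact h.eq_of_col_eq hN (v := v) (he 0) (by simp) (Option.some.inj hy0).symm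
    have hed : ∀ j, N.graph.dist v (e j) ≤ k := fun j => by
      rw [SimpleGraph.dist_comm]; exact he j
    refine ⟨e, ?_, he0, rfl⟩
    rw [Formula.holds_localize hN, he0]
    exact ⟨hed, (htrans e hed).2 hhold⟩
  · rintro ⟨e, hhold, rfl, rfl⟩
    rw [Formula.holds_localize hN] at hhold
    refine ⟨hgo, hclock, hcolor, fun j => ?_, (htrans e hhold.1).1 hhold.2⟩
    refine (h.col_mem_kn_iff hN ht).2 ⟨e j, ?_, rfl⟩
    rw [SimpleGraph.dist_comm]
    exact hhold.1 j

end View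

/-! #### The stages of the fixpoint -/

/-- The stage that a node has reached at time `t`. -/
noncomputable def stageIndex (N : Network V C p) (r : V) (k T t : ℕ) (v : V) : ℕ :=
  (t - (T + N.graph.dist r v + 1)) / (2 * k + 3)

/-- Clocks of nodes differ by at most their distance. A tuple of the next stage thus cannot reach
`v` before `v` has evaluated that stage itself, while the current stage of the whole `k`-ball has
arrived after at most `2 * k` rounds. Both estimates refer to earlier times at other nodes, hence
the strong induction. -/
theorem tab_mem_iff (hN : N.graph.Connected) (h : Started φ N r k n T col) (t : ℕ) (v : V)
    (y : Fin (ℓ + 1) → Fin (n + 1)) :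
    Fact.tab y ∈ fa φ N r k n t v ↔
      ∃ e ∈ (φ.localize k).stage N.graph N.prop (stageIndex N r k T t v),
        e 0 = v ∧ y = col ∘ e := by
  induction t using Nat.strong_induction_on generalizing v y with
  | _ t ih =>
  rcases Nat.lt_or_ge (N.graph.dist r v) t with hd | hd
  swap
  · have h0 : stageIndex N r k T t v = 0 := by
      rw [stageIndex, Nat.sub_eq_zero_of_le (by omega), Nat.zero_div]
    rw [h0]
    simp [notMem_fa φ r hN hd, Formula.stage]
  obtain ⟨t, rfl⟩ : ∃ s, t = s + 1 := ⟨t - 1, by omega⟩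
  rw [mem_fa_succ φ r hN (by omega), ih t (by omega)]
  have hc := h.clock_eq hN t v
  by_cases hev : T + N.graph.dist r v < t ∧ (pv φ N r k n t v).clock = Fin.last _
  · obtain ⟨hlt, hclock⟩ := hev
    rw [hclock, Fin.val_last] at hc
    obtain ⟨m, hm⟩ : ∃ m, t = T + N.graph.dist r v + 1 + m := ⟨t - (T + N.graph.dist r v + 1),
      by omega⟩
    have hm' : t - (T + N.graph.dist r v + 1) = m := by omega
    rw [hm'] at hc
    have hdiv := Nat.div_add_mod m (2 * k + 3)
    have hidx : stageIndex N r k T t v = m / (2 * k + 3) := by rw [stageIndex, hm']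
    generalize hi : m / (2 * k + 3) = i at hidx hdiv
    have hmi : m = (2 * k + 3) * i + (2 * k + 2) := by omega
    have hidx' : stageIndex N r k T (t + 1) v = i + 1 := by
      have : t + 1 - (T + N.graph.dist r v + 1) = (2 * k + 3) * (i + 1) := by
        rw [Nat.mul_add]; omega
      rw [stageIndex, this, Nat.mul_div_cancel_left _ (by omega)]
    rw [hidx, hidx']
    have htab : ∀ y, Fact.tab y ∈ kn φ N r k n t v ⟨k, by omega⟩ ↔
        ∃ e ∈ (φ.localize k).stage N.graph N.prop i, N.graph.dist (e 0) v ≤ k ∧ y = col ∘ e := by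
      intro y
      rw [mem_kn_iff φ r hN]
      constructor
      · rintro ⟨a, s, h1, h2, h3⟩
        rw [ih s (by omega)] at h3
        obtain ⟨e, he, rfl, rfl⟩ := h3
        -- Nothing too new: a fact that has reached `v` left its source before the source was past
        -- stage `i`.
        refine ⟨e, Formula.stage_mono N.prop _ ?_ he, h1, rfl⟩
        have htri := hN.dist_triangle (u := r) (v := e 0) (w := v)
        rw [stageIndex, ← Nat.lt_succ_iff, Nat.div_lt_iff_lt_mul (by omega), Nat.succ_mul,
          mul_comm i]
        omega
      · rintro ⟨e, he, h1, rfl⟩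
        refine ⟨e 0, t - N.graph.dist (e 0) v, h1, by omega, ?_⟩
        rw [ih _ (by omega)]
        -- Nothing missing: stage `i` was complete at the source early enough to arrive.
        refine ⟨e, Formula.stage_mono N.prop _ ?_ he, rfl, rfl⟩
        have htri := hN.dist_triangle (u := r) (v := v) (w := e 0)
        rw [SimpleGraph.dist_comm (u := v)] at htri
        have h1' : N.graph.dist (e 0) v ≤ k := h1
        rw [stageIndex, Nat.le_div_iff_mul_le (by omega), mul_comm i]
        omega
    change _ ∨ (pv φ N r k n t v).Evals (kn φ N r k n t v) φ y ↔ _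
    rw [h.evals_iff hN (by omega) hclock htab]
    constructor
    · rintro (⟨e, he, h0⟩ | ⟨e, he, h0⟩)
      · exact ⟨e, Or.inr he, h0⟩
      · exact ⟨e, Or.inl he, h0⟩
    · rintro ⟨e, he | he, h0⟩
      · exact Or.inr ⟨e, he, h0⟩
      · exact Or.inl ⟨e, he, h0⟩
  · have hnew : ¬ (pv φ N r k n t v).New (kn φ N r k n t v) (mg φ N r k n t v) φ (Fact.tab y) :=
      fun hn => hev ⟨h.go_iff.1 hn.1, hn.2.1⟩
    have hidx : stageIndex N r k T (t + 1) v = stageIndex N r k T t v := by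
      rw [stageIndex, stageIndex]
      by_cases hlt : T + N.graph.dist r v < t
      · have hne : ((pv φ N r k n t v).clock : ℕ) ≠ 2 * k + 2 := fun he =>
          hev ⟨hlt, Fin.ext he⟩
        rw [hc] at hne
        have : t + 1 - (T + N.graph.dist r v + 1) = t - (T + N.graph.dist r v + 1) + 1 := by omega
        rw [this]
        refine Nat.succ_div_of_not_dvd ?_
        intro hdvd
        have h1 := Nat.mod_lt (t - (T + N.graph.dist r v + 1)) (show 0 < 2 * k + 3 by omega)
        have h2 := Nat.add_mod (t - (T + N.graph.dist r v + 1)) 1 (2 * k + 3)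
        rw [Nat.mod_eq_zero_of_dvd hdvd, Nat.mod_eq_of_lt (show 1 < 2 * k + 3 by omega),
          Nat.mod_eq_of_lt (by omega)] at h2
        omega
      · rw [Nat.sub_eq_zero_of_le (by omega), Nat.sub_eq_zero_of_le (by omega)]
    rw [hidx, or_iff_left hnew]

/-- The entries lie in the `k`-ball of the first node, where colors identify nodes. This makes the
count linear in `|V|` instead of a power of it, and so gives linear time. -/
theorem ncard_stage_le (hN : N.graph.Connected) (h : Started φ N r k n T col) (i : ℕ) :
    ((φ.localize k).stage N.graph N.prop i).ncard ≤ Fintype.card V * (n + 1) ^ (ℓ + 1) := by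
  have hinj : Set.InjOn (fun e : Fin (ℓ + 1) → V => (e 0, col ∘ e))
      ((φ.localize k).stage N.graph N.prop i) := by
    intro e he e' he' heq
    obtain ⟨h0, h1⟩ := Prod.mk.inj heq
    funext j
    have d1 := Formula.dist_le_of_mem_stage hN N.prop k φ he j
    have d2 := Formula.dist_le_of_mem_stage hN N.prop k φ he' j
    rw [SimpleGraph.dist_comm] at d1 d2
    rw [← h0] at d2
    exact h.eq_of_col_eq hN d1 d2 (congrFun h1 j)
  rw [← hinj.ncard_image]
  refine (Set.ncard_le_ncard (Set.subset_univ _) (Set.toFinite _)).trans ?_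
  rw [Set.ncard_univ, Nat.card_eq_fintype_card]
  simp

/-- After the fixpoint has been reached, no new facts are found. -/
theorem facts_subset (hN : N.graph.Connected) (h : Started φ N r k n T col) {m : ℕ}
    (hm : ∀ i ≥ m, (φ.localize k).stage N.graph N.prop i = (φ.localize k).stage N.graph N.prop m)
    {T' : ℕ} (hT' : T + Fintype.card V + 3 + m * (2 * k + 3) ≤ T') {t : ℕ} (ht : T' ≤ t) (v : V) :
    fa φ N r k n t v ⊆ fa φ N r k n T' v := by
  have hd := dist_lt_card hN r v
  have hge : T + N.graph.dist r v + 3 < T' := by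
    have : 0 ≤ m * (2 * k + 3) := Nat.zero_le _
    omega
  have hcol : (pv φ N r k n T' v).color = some (col v) := h.color_of_lt (by omega)
  rintro (_ | _ | ⟨c, c'⟩ | x | ⟨x, c⟩ | ⟨x, Q⟩ | ⟨x, y⟩ | y) hf
  · obtain ⟨s, rfl⟩ : ∃ s, T' = s + 1 := ⟨T' - 1, by omega⟩
    rw [mem_fa_succ φ r hN (by omega)]
    exact Or.inr trivial
  · exact h.go_iff.2 (by omega)
  · exact fa_mono φ r (by omega) v (h.used_mem hf)
  · rw [col_mem_iff φ r hN] at hf ⊢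
    rw [h.color_eq hf, hcol]
  · rw [name_mem_iff hN] at hf ⊢
    rw [h.color_eq hf.1, hcol]
    exact ⟨rfl, hf.2⟩
  · rw [prop_mem_iff hN] at hf ⊢
    rw [h.color_eq hf.1, hcol]
    exact ⟨rfl, hf.2⟩
  · obtain ⟨rfl, hne, u, hu, rfl⟩ := h.edge_mem hN hf
    exact h.mem_edge hN hu hne (by omega)
  · rw [h.tab_mem_iff hN] at hf ⊢
    have hidx : m ≤ stageIndex N r k T T' v := by
      rw [stageIndex, Nat.le_div_iff_mul_le (by omega)]
      omega
    have hidx' : m ≤ stageIndex N r k T t v := by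
      rw [stageIndex, Nat.le_div_iff_mul_le (by omega)]
      omega
    rw [hm _ hidx'] at hf
    rw [hm _ hidx]
    exact hf

/-- The result tuples of a node. -/
theorem out_subset (hN : N.graph.Connected) (h : Started φ N r k n T col) {t : ℕ} {v : V}
    {y : Fin ℓ → C} {z : Fin (ℓ + 1) → Fin (n + 1)} (hz : Fact.tab z ∈ kn φ N r k n t v 0)
    (hy : ∀ i, Fact.name (z i.succ) (y i) ∈ kn φ N r k n t v ⟨k, by omega⟩) :
    ∃ b : Fin ℓ → V, (Fin.cons v b : Fin (ℓ + 1) → V) ∈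
      (φ.localize k).fixpoint N.graph N.prop ∧ y = fun i => N.label (b i) := by
  obtain ⟨e, he, rfl, rfl⟩ := (h.tab_mem_iff hN t v z).1 hz
  refine ⟨Fin.tail e, ?_, ?_⟩
  · rw [Fin.cons_self_tail]
    exact Set.mem_iUnion.2 ⟨_, he⟩
  · funext i
    obtain ⟨a, ha, hc, hl⟩ := h.name_mem_kn hN (hy i)
    have hd := Formula.dist_le_of_mem_stage hN N.prop k φ he i.succ
    rw [SimpleGraph.dist_comm] at hd
    rw [hl, ← h.eq_of_col_eq hN hd ha hc]
    rfl

/-- By this time every node has passed stage `m`, and the names of the nodes in its ball have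
arrived. -/
theorem subset_out (hN : N.graph.Connected) (h : Started φ N r k n T col) {m : ℕ}
    (hm : ∀ i ≥ m, (φ.localize k).stage N.graph N.prop i = (φ.localize k).stage N.graph N.prop m)
    {t : ℕ} (ht : T + Fintype.card V + 3 + m * (2 * k + 3) + 2 * k ≤ t) {v : V} {b : Fin ℓ → V}
    (hb : (Fin.cons v b : Fin (ℓ + 1) → V) ∈ (φ.localize k).fixpoint N.graph N.prop) :
    ∃ z, Fact.tab z ∈ kn φ N r k n t v 0 ∧
      ∀ i, Fact.name (z i.succ) (N.label (b i)) ∈ kn φ N r k n t v ⟨k, by omega⟩ := by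
  obtain ⟨i, hi⟩ := Set.mem_iUnion.1 hb
  have hd := dist_lt_card hN r v
  have hmem : (Fin.cons v b : Fin (ℓ + 1) → V) ∈ (φ.localize k).stage N.graph N.prop m := by
    rcases le_total i m with him | him
    · exact Formula.stage_mono N.prop _ him hi
    · rwa [← hm i him]
  refine ⟨col ∘ Fin.cons v b, (h.tab_mem_iff hN t v _).2 ⟨_, ?_, rfl, rfl⟩, fun j => ?_⟩
  · rwa [hm]
    rw [ge_iff_le, stageIndex, Nat.le_div_iff_mul_le (by omega)]
    omega
  · have hdj := Formula.dist_le_of_mem_stage hN N.prop k φ hmem j.succ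
    rw [SimpleGraph.dist_comm] at hdj
    have : 0 ≤ m * (2 * k + 3) := Nat.zero_le _
    exact h.mem_kn_name hN (by omega) hdj

end Started

end Stages

/-- The machine that does nothing. -/
def idleEngine (C : Type) (p ℓ : ℕ) : Engine C p ℓ where
  W := Empty
  A := Unit
  Λ := Unit
  σ := Unit
  main := ()
  start := ()
  prog := fun _ => .halt

theorem exists_started {C : Type} [Finite C] [Nonempty C] {p ℓ k n D : ℕ}
    (φ : Formula p (ℓ + 1) (ℓ + 1)) {V : Type} [Fintype V] {N : Network V C p} (r : V)
    (hN : N.graph.Connected) (hL : N.LocallyConsistent k)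
    (hD : ∀ v, (N.graph.neighborSet v).ncard ≤ D) (hn : (D + 1) ^ (3 * k + 1) ≤ n) :
    ∃ T ≤ (3 * k + 2) * (D * Fintype.card V + 1), ∃ col, Started φ N r k n T col := by
  by_cases hk : k = 0
  · subst hk
    exact ⟨0, Nat.zero_le _, _, started_zero φ r hN⟩
  · exact exists_started_of_ne_zero φ r hN (hL.neighborsDistinct hk) hk hD hn

end NetLogic

/-! ### The main theorem -/

open NetLogic in
theorem theorem11 (p ℓ k D : ℕ) (C : Type) [Finite C]
    (φ : NetLogic.Formula p (ℓ + 1) (ℓ + 1)) :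
    ∃ (M : NetLogic.Engine C p ℓ) (c : ℕ),
      ∀ (V : Type) [Fintype V] (N : NetLogic.Network V C p),
        N.graph.Connected →
        (∀ v, (N.graph.neighborSet v).ncard ≤ D) →
        N.LocallyConsistent k →
        ∀ (r : V) (E : ℕ → V → M.NodeState), M.IsExecution N r E →
          -- in-node time per round
          (∀ t v, (E t v).awake = true → M.HaltsWithin (E t v) c) ∧
          -- message size
          (∀ t v, ∀ m ∈ M.sent (E t v), m.length ≤ c) ∧
          -- number of messages sent by a node
          (∀ v s, ∑ t ∈ Finset.range s, (M.sent (E t v)).length ≤ c) ∧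
          -- distributed time, and correctness of the distributed result
          ∃ τ ≤ c * Fintype.card V, ∀ t ≥ τ, ∀ v,
            M.sent (E t v) = [] ∧
            M.held (E t v) =
              {y | ∃ b : Fin ℓ → V,
                (Fin.cons v b : Fin (ℓ + 1) → V) ∈ (φ.localize k).fixpoint N.graph N.prop ∧
                y = fun i => N.label (b i)} := by
  rcases isEmpty_or_nonempty C with hC | hC
  -- Without labels there is no node, and in particular no requesting node.
  · refine ⟨idleEngine C p ℓ, 0, fun V _ N _ _ _ r => (hC.false (N.label r)).elim⟩
  let n := (D + 1) ^ (3 * k + 1)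
  let P : Gossip C p ℓ (3 * k + 1) (Fact C p ℓ n) := protocol k n φ
  obtain ⟨d, b, hsim⟩ := P.automaton.engine_correct D
  -- The constants bound the message length, the number of messages, and the rounds per node; in
  -- `c₃` additive constants are charged to `|V| ≥ 1`.
  let c₁ := P.automaton.size
  let c₂ := (3 * k + 1 + 1) * Nat.card (Fact C p ℓ n)
  let c₃ := (3 * k + 2) * (D + 1) + 1 + 3 + (n + 1) ^ (ℓ + 1) * (2 * k + 3) + (3 * k + 1)
  refine ⟨P.automaton.engine d b, 1 + c₁ + c₂ + c₃, ?_⟩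
  intro V _ N hN hD hL r E hE
  have hsim := hsim V N hD r E hE
  have hhalt : ∀ (s : (P.automaton.engine d b).NodeState) (j : ℕ),
      (P.automaton.engine d b).HaltsWithin s 1 → (P.automaton.engine d b).HaltsWithin s (1 + j) := by
    intro s j h
    induction j with
    | zero => exact h
    | succ j ih =>
      rw [Engine.HaltsWithin, ← Nat.add_assoc, Function.iterate_succ_apply']
      rw [Engine.HaltsWithin] at ih
      generalize (P.automaton.engine d b).next^[1 + j] ((P.automaton.engine d b).begin s) = x at ih
      obtain ⟨l, var, stk⟩ := x
      simp only at ih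
      subst ih
      rfl
  refine ⟨fun t v ha => ?_, fun t v m hm => ?_, fun v s => ?_, ?_⟩
  · rw [Nat.add_assoc, Nat.add_assoc]
    exact hhalt _ _ ((hsim t v).1 ha)
  · rw [(hsim t v).2.1] at hm
    simp only [Option.mem_toList, Option.map_eq_some_iff] at hm
    obtain ⟨m', -, rfl⟩ := hm
    have := P.automaton.length_encode_le m'
    omega
  · have h := P.sum_emit_le r N s v
    have heq : ∀ t, ((P.automaton.engine d b).sent (E t v)).length =
        (P.automaton.run N r t v).emit.toList.length := by
      intro t
      rw [(hsim t v).2.1]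
      cases (P.automaton.run N r t v).emit <;> rfl
    simp only [heq]
    omega
  · obtain ⟨T, hT, col, hS⟩ := exists_started φ r hN hL hD le_rfl
    obtain ⟨m, hmle, hm⟩ := Formula.exists_stage_eq N.prop (φ.localize k) _
      (hS.ncard_stage_le hN)
    refine ⟨T + Fintype.card V + 3 + m * (2 * k + 3) + (3 * k + 1), ?_, fun t ht v => ⟨?_, ?_⟩⟩
    · have hpos : 1 ≤ Fintype.card V := Fintype.card_pos_iff.2 ⟨r⟩
      have h1 : m * (2 * k + 3) ≤
          ((n + 1) ^ (ℓ + 1) * (2 * k + 3)) * Fintype.card V := by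
        refine (Nat.mul_le_mul_right _ hmle).trans (le_of_eq ?_)
        ring
      have h2 : (3 * k + 2) * (D * Fintype.card V + 1) ≤
          ((3 * k + 2) * (D + 1)) * Fintype.card V := by
        rw [Nat.mul_assoc]
        refine Nat.mul_le_mul_left _ ?_
        rw [Nat.add_mul]
        omega
      have h3 : (3 * k + 1) ≤ (3 * k + 1) * Fintype.card V := Nat.le_mul_of_pos_right _ hpos
      have h4 : c₃ * Fintype.card V ≤ (1 + c₁ + c₂ + c₃) * Fintype.card V :=
        Nat.mul_le_mul_right _ (Nat.le_add_left _ _)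
      have h5 : c₃ * Fintype.card V = ((3 * k + 2) * (D + 1)) * Fintype.card V + Fintype.card V +
          3 * Fintype.card V + ((n + 1) ^ (ℓ + 1) * (2 * k + 3)) * Fintype.card V +
          (3 * k + 1) * Fintype.card V := by
        simp only [c₃]; ring
      omega
    · rw [(hsim t v).2.1, P.emit_eq_none r hN (T := T + Fintype.card V + 3 + m * (2 * k + 3))
        (fun t ht a => hS.facts_subset hN hm le_rfl ht a) ht v]
      rfl
    · rw [(hsim t v).2.2]
      ext y
      rw [P.mem_res_iff r hN]
      constructor
      -- The tuple may have been output at any earlier time `s`, so `out_subset` is needed without a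
      -- lower bound on time.
      · rintro ⟨s, -, -, z, hz, hy⟩
        exact hS.out_subset hN hz hy
      · rintro ⟨b, hb, rfl⟩
        have hd := dist_lt_card hN r v
        exact ⟨t, le_rfl, by omega, hS.subset_out hN hm (by omega) hb⟩
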